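/- Graphs are finite and simple. Let $\mathbb K$ be a field, let $G$ be a graph with vertex set $V$, and let $d\in\mathbb Z_{\ge 2}^{V}$. For $F\subseteq V$ put $D_F=\prod_{v\in F}\{1,\dots,d_v\}$, and for $i\in D_V$ let $i_F\in D_F$ be its restriction. Regard $G$ as a simplicial complex whose faces are the empty set, the vertices and the edges. The toric ideal $I_{G,d}$ is the kernel of the $\mathbb K$-algebra homomorphism $$\mathbb K[p_i : i\in D_V]\to\mathbb K[a^F_j : F \text{ a facet of } G,\ j\in D_F],\qquad p_i\mapsto\prod_{F\text{ facet of }G}a^F_{i_F},$$ and the Markov width $\mu(G,d)$ is the largest degree of an element of a minimal set of homogeneous generators of $I_{G,d}$ (it is $0$ if $I_{G,d}=0$). The graph $G$ is \emph{Markov slim} if for every independent set $I$ of $G$ and every $d$ with $d_v\ge 2$ for $v\in I$ and $d_v=2$ for $v\in V\setminus I$ one has $\mu(G,d)\le 4$. The graph $G$ is \emph{outerplanar} if it can be embedded in a closed disc, with vertices as distinct points and edges as simple arcs that meet only in common end vertices, such that all vertices lie on the boundary circle. A class of graphs is \emph{minor-closed} if it contains every graph isomorphic to a minor of one of its members. \textbf{Theorem.}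 The class of outerplanar graphs is the largest minor-closed class of Markov slim graphs: it is minor-closed, all its members are Markov slim, and every minor-closed class all of whose members are Markov slim is contained in it. -/

import Mathlib

universe u v

namespace MarkovSlim

noncomputable section

/-! ### Hierarchical models -/

/-- The toric homomorphism of the hierarchical model of a simplicial complex `Γ` on the vertex
set `V` (a family of finite sets closed under taking subsets, the empty face included) with `d v`
levels at the vertex `v`: the variable `p_i`, `i ∈ ∏_{v ∈ V} [d v]`, is sent to the product over
the facets `F` of `Γ` of the parameters `a^F_{i_F}`, where `i_F` is the restriction of `i`. -/
def toricHom (K : Type v) [Field K] {V : Type u} (Γ : LowerSet (Finset V)) (d : V → ℕ) :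
    MvPolynomial ((w : V) → Fin (d w)) K →ₐ[K]
      MvPolynomial
        (Σ F : {F : Finset V // Maximal (fun A : Finset V => A ∈ Γ) F},
          ((w : {x : V // x ∈ F.1}) → Fin (d w.1))) K :=
  MvPolynomial.aeval fun i =>
    ∏ᶠ F : {F : Finset V // Maximal (fun A : Finset V => A ∈ Γ) F},
      MvPolynomial.X ⟨F, fun w => i w.1⟩

/-- The toric ideal of the hierarchical model of `(Γ, d)`. -/
def toricIdeal (K : Type v) [Field K] {V : Type u} (Γ : LowerSet (Finset V)) (d : V → ℕ) :
    Ideal (MvPolynomial ((w : V) → Fin (d w)) K) :=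
  RingHom.ker (toricHom K Γ d)

/-- A graph as a simplicial complex of dimension at most one: the faces are the empty set, the
vertices and the edges. -/
def graphComplex {V : Type u} (G : SimpleGraph V) : LowerSet (Finset V) where
  carrier := {F | F.card ≤ 2 ∧ G.IsClique (F : Set V)}
  lower' := fun _ _ hBA hA =>
    ⟨(Finset.card_le_card hBA).trans hA.1, hA.2.subset (Finset.coe_subset.2 hBA)⟩

/-- `S` is a set of homogeneous generators of the ideal `I`. -/
def IsHomogeneousGenerating {K : Type v} [Field K] {σ : Type u} (I : Ideal (MvPolynomial σ K))
    (S : Set (MvPolynomial σ K)) : Prop :=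
  (∀ f ∈ S, ∃ n : ℕ, f.IsHomogeneous n) ∧ Ideal.span S = I

/-- `μ(I)`: the largest degree of an element of an inclusion-minimal set of homogeneous
generators of the homogeneous ideal `I` (`0` for the zero ideal). -/
def maxGeneratorDegree {K : Type v} [Field K] {σ : Type u} (I : Ideal (MvPolynomial σ K)) : ℕ∞ :=
  ⨆ (S : Set (MvPolynomial σ K)) (_ : Minimal (IsHomogeneousGenerating I) S) (f ∈ S),
    (f.totalDegree : ℕ∞)

/-- The Markov width `μ(G, d)` of the graph model of `G` with levels `d`. -/
def markovWidth (K : Type v) [Field K] {V : Type u} (G : SimpleGraph V) (d : V → ℕ) : ℕ∞ :=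
  maxGeneratorDegree (toricIdeal K (graphComplex G) d)

/-- A graph is Markov slim if, for every independent set `I`, all models with at least two levels
at the vertices in `I` and exactly two levels at all the others have Markov width at most four. -/
def IsMarkovSlim (K : Type v) [Field K] {V : Type u} (G : SimpleGraph V) : Prop :=
  ∀ I : Set V, G.IsIndepSet I →
    ∀ d : V → ℕ, (∀ w ∈ I, 2 ≤ d w) → (∀ w ∉ I, d w = 2) → markovWidth K G d ≤ 4

/-! ### Outerplanar graphs -/

/-- An embedding of a graph in the closed unit disc of the plane with all vertices on the unit
circle: vertices are distinct points of the circle, each edge is a simple arc in the disc between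
its two ends, an arc contains no other vertex, and two arcs meet at most in a common end. -/
structure OuterplanarEmbedding {V : Type u} (G : SimpleGraph V) where
  /-- The positions of the vertices. -/
  pos : V → ℂ
  /-- The arcs that represent the edges. -/
  arc : G.edgeSet → C(unitInterval, ℂ)
  pos_injective : Function.Injective pos
  pos_mem_circle : ∀ w : V, pos w ∈ Metric.sphere (0 : ℂ) 1
  arc_injective : ∀ e : G.edgeSet, Function.Injective (arc e)
  arc_mem_disc : ∀ (e : G.edgeSet) (t : unitInterval), arc e t ∈ Metric.closedBall (0 : ℂ) 1
  arc_ends : ∀ e : G.edgeSet, s(arc e 0, arc e 1) = Sym2.map pos e.1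
  arc_vertex : ∀ (e : G.edgeSet) (w : V), pos w ∈ Set.range (arc e) → w ∈ e.1
  arc_inter : ∀ e e' : G.edgeSet, e ≠ e' →
    ∀ z ∈ Set.range (arc e) ∩ Set.range (arc e'), ∃ w : V, w ∈ e.1 ∧ w ∈ e'.1 ∧ z = pos w

/-- A graph is outerplanar if it has a planar embedding with all vertices on a circle and all
edges in the disc that the circle bounds. -/
def IsOuterplanar {V : Type u} (G : SimpleGraph V) : Prop :=
  Nonempty (OuterplanarEmbedding G)

/-! ### Minors and classes of finite graphs -/

/-- `H` is (isomorphic to) a minor of `G`: there are pairwise disjoint, connected, non-empty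
branch sets in `G`, one for each vertex of `H`, with an edge of `G` between the branch sets of any
two adjacent vertices of `H`. -/
def IsMinor {W V : Type u} (H : SimpleGraph W) (G : SimpleGraph V) : Prop :=
  ∃ B : W → Set V,
    (∀ x : W, (G.induce (B x)).Connected) ∧
    (∀ x y : W, x ≠ y → Disjoint (B x) (B y)) ∧
    (∀ x y : W, H.Adj x y → ∃ a ∈ B x, ∃ b ∈ B y, G.Adj a b)

/-- A finite simple graph. -/
structure FinGraph where
  /-- The vertex set. -/
  V : Type u
  finite_V : Finite V
  /-- The adjacency structure. -/
  graph : SimpleGraph V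

/-- A class of finite graphs is minor-closed if it contains every graph that is isomorphic to a
minor of one of its members. -/
def MinorClosed (𝒞 : Set FinGraph.{u}) : Prop :=
  ∀ G H : FinGraph.{u}, IsMinor H.graph G.graph → G ∈ 𝒞 → H ∈ 𝒞

end

end MarkovSlim

/-! A binomial of the toric ideal records two multisets of rows with the same vertex and edge
margins. If any two such multisets are joined by exchanges of at most `k` rows, the ideal is
generated in degree `k` (`span_binomials_eq_ker`, `markovWidth_le`). Conversely, a multiset of more
than `k` rows that is not alone in its fibre and shares no row with any other member forces a
generator of degree above `k` (`lt_maxGeneratorDegree`).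

Outerplanarity is made combinatorial: it is equivalent to a linear vertex order in which no two
edges cross (`isOuterplanar_iff`). Arcs with alternating ends meet by a winding argument, and in the
other direction straight chords serve as arcs.

Members are slim (`linkedAll_four_of_noncrossing`): by induction on the vertices, a leaf or an edge
with vertices on both sides lets the model be glued from smaller ones without raising the degree.
Otherwise a vertex of `I`, rotated to the front, has exactly two neighbours, both binary. The model
is glued from a triangle with two binary vertices, which needs degree four, and the graph without
the vertex. If the neighbours are not adjacent, the gluing adds the missing edge; it works because
both sides are then forests, with quadratic moves.

Minor-closedness: represent each branch set by one vertex; disjoint connected sets cannot alternate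
in a noncrossing order.

Maximality: the binary model on `K₄` and the model on `K_{2,3}` with levels 3, 3, 2, 2, 2 both need
a generator of degree six. So a minor-closed class of slim graphs excludes both graphs as minors,
and graphs without these minors have noncrossing orders (`exists_noncrossingOn_of_excluded`), by an
induction over vertex sets that rests on Menger's theorem for two connections. -/

namespace MarkovSlim

/-! ### Moves between multisets of rows -/

section Moves

variable {X Y Z S : Type*}

/-- An equivalence relation on multisets that behaves like having the same margins. -/
structure IsMarginRel (R : Multiset X → Multiset X → Prop) : Prop where
  refl : ∀ A, R A A
  symm : ∀ {A B}, R A B → R B A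
  trans : ∀ {A B C}, R A B → R B C → R A C
  add_right : ∀ {A B} (C), R A B → R (A + C) (B + C)
  cancel_right : ∀ {A B} (C), R (A + C) (B + C) → R A B
  card_eq : ∀ {A B}, R A B → A.card = B.card

/-- The second multiset arises from the first by exchanging at most `k` rows without
changing the margins. -/
def Step (R : Multiset X → Multiset X → Prop) (k : ℕ) (T U : Multiset X) : Prop :=
  ∃ A B C : Multiset X, A.card ≤ k ∧ R A B ∧ T = A + C ∧ U = B + C

/-- Two multisets are linked if they are joined by a chain of exchanges of at most `k` rows. -/
def Linked (R : Multiset X → Multiset X → Prop) (k : ℕ) : Multiset X → Multiset X → Prop :=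
  Relation.ReflTransGen (Step R k)

/-- Any two multisets with the same margins are linked. -/
def LinkedAll (R : Multiset X → Multiset X → Prop) (k : ℕ) : Prop :=
  ∀ T T', R T T' → Linked R k T T'

variable {R : Multiset X → Multiset X → Prop} {k l : ℕ}

theorem Step.rel (hR : IsMarginRel R) {T T' : Multiset X} (h : Step R k T T') : R T T' := by
  obtain ⟨A, B, C, -, hAB, rfl, rfl⟩ := h
  exact hR.add_right C hAB

theorem Linked.rel (hR : IsMarginRel R) {T T' : Multiset X} (h : Linked R k T T') : R T T' := by
  induction h with
  | refl => exact hR.refl _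
  | tail _ hs ih => exact hR.trans ih (hs.rel hR)

theorem Step.symm (hR : IsMarginRel R) {T T' : Multiset X} (h : Step R k T T') :
    Step R k T' T := by
  obtain ⟨A, B, C, hk, hAB, rfl, rfl⟩ := h
  exact ⟨B, A, C, hR.card_eq hAB ▸ hk, hR.symm hAB, rfl, rfl⟩

theorem Linked.symm (hR : IsMarginRel R) {T T' : Multiset X} (h : Linked R k T T') :
    Linked R k T' T := by
  induction h with
  | refl => exact .refl
  | tail _ hs ih => exact .head (hs.symm hR) ih

theorem Linked.mono {R' : Multiset X → Multiset X → Prop} (hkl : k ≤ l)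
    (hRR : ∀ A B, R A B → R' A B) {T T' : Multiset X} (h : Linked R k T T') :
    Linked R' l T T' := by
  refine Relation.ReflTransGen.mono ?_ _ _ h
  rintro _ _ ⟨A, B, C, hk, hAB, rfl, rfl⟩
  exact ⟨A, B, C, hk.trans hkl, hRR _ _ hAB, rfl, rfl⟩

theorem Linked.add_right {T T' : Multiset X} (D : Multiset X) (h : Linked R k T T') :
    Linked R k (T + D) (T' + D) := by
  induction h with
  | refl => exact .refl
  | tail _ hs ih =>
    obtain ⟨A, B, C, hk, hAB, rfl, rfl⟩ := hs
    exact ih.tail ⟨A, B, C + D, hk, hAB, by rw [add_assoc], by rw [add_assoc]⟩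

theorem Linked.cons {T T' : Multiset X} (x : X) (h : Linked R k T T') :
    Linked R k (x ::ₘ T) (x ::ₘ T') := by
  have := h.add_right {x}
  rwa [add_comm, Multiset.singleton_add, add_comm, Multiset.singleton_add] at this

theorem map_eq_map_of_factors {f : X → Y} {g : X → Z} (hfg : ∀ x y, g x = g y → f x = f y)
    {T T' : Multiset X} (h : T.map g = T'.map g) : T.map f = T'.map f := by
  rw [← Multiset.rel_eq, Multiset.rel_map] at h ⊢
  exact h.mono fun a _ b _ hab => hfg a b hab

theorem exists_add_of_map_eq_add (p : Z → X) {T : Multiset Z} {A C : Multiset X}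
    (h : T.map p = A + C) : ∃ T₁ T₂, T = T₁ + T₂ ∧ T₁.map p = A ∧ T₂.map p = C := by
  induction A using Multiset.induction generalizing T with
  | empty => exact ⟨0, T, by simp, rfl, by simpa using h⟩
  | cons a A ih =>
    classical
    rw [Multiset.cons_add, ← Multiset.map_eq_cons] at h
    obtain ⟨z, hz, rfl, hT⟩ := h
    obtain ⟨T₁, T₂, h₁, rfl, rfl⟩ := ih hT
    exact ⟨z ::ₘ T₁, T₂, by rw [Multiset.cons_add, ← h₁, Multiset.cons_erase hz], by simp, rfl⟩

/-- `Z` is the fibre product of `X` and `Y` over `S`. -/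
structure IsFiberProduct (p : Z → X) (q : Z → Y) (f : X → S) (g : Y → S) : Prop where
  comm : ∀ z, f (p z) = g (q z)
  lift : ∀ x y, f x = g y → ∃ z, p z = x ∧ q z = y
  ext : ∀ {z z'}, p z = p z' → q z = q z' → z = z'

namespace IsFiberProduct

variable {p : Z → X} {q : Z → Y} {f : X → S} {g : Y → S}

theorem swap (h : IsFiberProduct p q f g) : IsFiberProduct q p g f where
  comm z := (h.comm z).symm
  lift x y hxy := (h.lift y x hxy.symm).imp fun _ => And.symm
  ext h₁ h₂ := h.ext h₂ h₁

theorem map_map (h : IsFiberProduct p q f g) (T : Multiset Z) :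
    (T.map p).map f = (T.map q).map g := by
  simp [h.comm]

theorem exists_map_eq (h : IsFiberProduct p q f g) {B : Multiset X} {D : Multiset Y}
    (hBD : B.map f = D.map g) : ∃ E : Multiset Z, E.map p = B ∧ E.map q = D := by
  induction B using Multiset.induction generalizing D with
  | empty =>
    refine ⟨0, by simp, ?_⟩
    simpa [eq_comm] using hBD
  | cons x B ih =>
    classical
    rw [Multiset.map_cons, eq_comm, ← Multiset.map_eq_cons] at hBD
    obtain ⟨y, hy, hxy, hD⟩ := hBD
    obtain ⟨E, rfl, hE⟩ := ih hD.symm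
    obtain ⟨z, rfl, rfl⟩ := h.lift x y hxy.symm
    exact ⟨z ::ₘ E, by simp, by rw [Multiset.map_cons, hE, Multiset.cons_erase hy]⟩

/-- Two rows over the same point of `S` may exchange their `Y`-parts, which is a quadratic move that
changes neither projection. Such swaps produce the rows of `T` one at a time. -/
theorem linked_of_map_eq (h : IsFiberProduct p q f g)
    {RZ : Multiset Z → Multiset Z → Prop}
    (hRZ : ∀ T T', T.map p = T'.map p → T.map q = T'.map q → RZ T T') {T T' : Multiset Z}
    (hp : T.map p = T'.map p) (hq : T.map q = T'.map q) : Linked RZ 2 T' T := by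
  induction T using Multiset.induction generalizing T' with
  | empty =>
    have : T' = 0 := by simpa using hp.symm
    exact this ▸ .refl
  | cons z T ih =>
    classical
    rw [Multiset.map_cons, eq_comm, ← Multiset.map_eq_cons] at hp
    obtain ⟨z', hz', hpz, hp⟩ := hp
    obtain ⟨U, rfl⟩ := Multiset.exists_cons_of_mem hz'
    rw [Multiset.erase_cons_head] at hp
    by_cases hqz : q z' = q z
    · obtain rfl := h.ext hpz hqz
      exact (ih hp.symm (by simpa using hq)).cons _
    · rw [Multiset.map_cons, Multiset.map_cons] at hq
      have hmem : q z ∈ U.map q := by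
        have : q z ∈ q z' ::ₘ U.map q := hq ▸ Multiset.mem_cons_self _ _
        exact (Multiset.mem_cons.1 this).resolve_left (Ne.symm hqz)
      obtain ⟨y, hy, hyz⟩ := Multiset.mem_map.1 hmem
      obtain ⟨W, rfl⟩ := Multiset.exists_cons_of_mem hy
      -- The rows `z'` and `y` lie over the same point of `S`. Exchanging their `Y`-parts turns them
      -- into `z` and `w`.
      obtain ⟨w, hwp, hwq⟩ := h.lift (p y) (q z') (by
        rw [h.comm, hyz, ← h.comm, ← hpz, h.comm])
      refine .head (b := z ::ₘ w ::ₘ W) ?_ ((ih ?_ ?_).cons z)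
      · refine ⟨{z', y}, {z, w}, W, by simp, hRZ _ _ ?_ ?_, by simp, by simp⟩
        · simp [hpz, hwp]
        · simpa [hwq, hyz] using Multiset.pair_comm _ _
      · rw [← hp]; simp [hwp]
      · simp only [Multiset.map_cons, hyz, hwq] at hq ⊢
        rw [Multiset.cons_swap] at hq
        exact (Multiset.cons_inj_right _).1 hq

/-- A move in `X` keeps the margin over `S`, so the `Y`-parts of the exchanged rows can be
redistributed over the new `X`-rows. The lifted move has the same size and leaves the `Y`-projection
alone. -/
theorem lift_linked (h : IsFiberProduct p q f g) {RX : Multiset X → Multiset X → Prop}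
    {RZ : Multiset Z → Multiset Z → Prop}
    (hRZ : ∀ T T', RX (T.map p) (T'.map p) → T.map q = T'.map q → RZ T T')
    (hf : ∀ A B, RX A B → A.map f = B.map f) {T : Multiset Z} {B : Multiset X}
    (hB : Linked RX k (T.map p) B) :
    ∃ T', T'.map p = B ∧ T'.map q = T.map q ∧ Linked RZ k T T' := by
  induction hB with
  | refl => exact ⟨T, rfl, rfl, .refl⟩
  | tail _ hs ih =>
    obtain ⟨T', hp, hq, hl⟩ := ih
    obtain ⟨A, B, C, hk, hAB, rfl, rfl⟩ := hs
    obtain ⟨T₁, T₂, rfl, rfl, rfl⟩ := exists_add_of_map_eq_add p hp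
    obtain ⟨E, rfl, hE⟩ := h.exists_map_eq (B := B) (D := T₁.map q)
      ((hf _ _ hAB).symm.trans (h.map_map T₁))
    refine ⟨E + T₂, by simp, by simp [hE, ← hq], hl.tail ⟨T₁, E, T₂, by simpa using hk, ?_, rfl, rfl⟩⟩
    exact hRZ _ _ hAB hE.symm

/-- Gluing two models along a common margin. -/
theorem linkedAll (h : IsFiberProduct p q f g) {RX : Multiset X → Multiset X → Prop}
    {RY : Multiset Y → Multiset Y → Prop} {RZ : Multiset Z → Multiset Z → Prop}
    (hX : IsMarginRel RX) (hY : IsMarginRel RY)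
    (hRZ : ∀ T T', RZ T T' ↔ RX (T.map p) (T'.map p) ∧ RY (T.map q) (T'.map q))
    (hf : ∀ A B, RX A B → A.map f = B.map f) (hg : ∀ A B, RY A B → A.map g = B.map g)
    (hk : 2 ≤ k) (hlX : LinkedAll RX k) (hlY : LinkedAll RY k) : LinkedAll RZ k := by
  intro T T' hT
  obtain ⟨h₁, h₂⟩ := (hRZ _ _).1 hT
  -- Lifted moves correct the `X`-projection and then the `Y`-projection; what remains is a
  -- rearrangement with both projections fixed, done by quadratic swaps.
  obtain ⟨T₁, hp₁, hq₁, hl₁⟩ := h.lift_linked (RZ := RZ)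
    (fun U U' hU hU' => (hRZ _ _).2 ⟨hU, hU' ▸ hY.refl _⟩) hf (hlX _ _ h₁)
  obtain ⟨T₂, hq₂, hp₂, hl₂⟩ := h.swap.lift_linked (RZ := RZ) (T := T₁)
    (fun U U' hU hU' => (hRZ _ _).2 ⟨hU' ▸ hX.refl _, hU⟩) hg (hq₁ ▸ hlY _ _ h₂)
  refine hl₁.trans (hl₂.trans ?_)
  refine (h.linked_of_map_eq (RZ := RZ) (fun U U' hU hU' => (hRZ _ _).2
    ⟨hU ▸ hX.refl _, hU' ▸ hY.refl _⟩) ?_ ?_).mono hk fun _ _ => id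
  · rw [hp₂, hp₁]
  · rw [hq₂]

end IsFiberProduct

end Moves

/-! ### Gluing along two nonadjacent binary vertices. -/

section Chord

variable {X Y Z : Type*} {k : ℕ}

theorem count_map_fst (P : Multiset (Bool × Bool)) (b : Bool) :
    (P.map Prod.fst).count b = P.count (b, false) + P.count (b, true) := by
  induction P using Multiset.induction with
  | empty => simp
  | cons s P ih =>
    rw [Multiset.map_cons, Multiset.count_cons, Multiset.count_cons, Multiset.count_cons, ih]
    obtain ⟨x, y⟩ := s
    cases b <;> cases x <;> cases y <;> simp <;> omega

theorem count_map_snd (P : Multiset (Bool × Bool)) (b : Bool) :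
    (P.map Prod.snd).count b = P.count (false, b) + P.count (true, b) := by
  induction P using Multiset.induction with
  | empty => simp
  | cons s P ih =>
    rw [Multiset.map_cons, Multiset.count_cons, Multiset.count_cons, Multiset.count_cons, ih]
    obtain ⟨x, y⟩ := s
    cases b <;> cases x <;> cases y <;> simp <;> omega

/-- A `2 × 2` table is determined by its margins and one entry. -/
theorem eq_of_margins_of_count {P Q : Multiset (Bool × Bool)}
    (h₁ : P.map Prod.fst = Q.map Prod.fst) (h₂ : P.map Prod.snd = Q.map Prod.snd)
    (h : P.count (false, false) = Q.count (false, false)) : P = Q := by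
  have a := count_map_fst P
  have b := count_map_fst Q
  have c := count_map_snd P
  have d := count_map_snd Q
  rw [← h₁] at b
  rw [← h₂] at d
  have a0 := (a false).symm.trans (b false)
  have a1 := (a true).symm.trans (b true)
  have c0 := (c false).symm.trans (d false)
  have c1 := (c true).symm.trans (d true)
  ext ⟨x, y⟩
  cases x <;> cases y <;> omega

/-- With both one-dimensional margins fixed, two rows can raise the entry `(false, false)` only by
the exchange of 01, 10 for 00, 11; in particular it rises by exactly one. -/
theorem pair_of_count_lt : ∀ s₁ s₂ t₁ t₂ : Bool × Bool,
    ({s₁.1, s₂.1} : Multiset Bool) = {t₁.1, t₂.1} → ({s₁.2, s₂.2} : Multiset Bool) = {t₁.2, t₂.2} →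
    ({s₁, s₂} : Multiset (Bool × Bool)).count (false, false) <
      ({t₁, t₂} : Multiset (Bool × Bool)).count (false, false) →
    (s₁ = (false, true) ∧ s₂ = (true, false) ∨ s₂ = (false, true) ∧ s₁ = (true, false)) ∧
    (t₁ = (false, false) ∧ t₂ = (true, true) ∨ t₂ = (false, false) ∧ t₁ = (true, true)) := by
  decide

theorem exists_pairs_of_count_lt {f : X → Bool × Bool} {A B : Multiset X} (hA : A.card ≤ 2)
    (hAB : A.card = B.card) (h₁ : (A.map f).map Prod.fst = (B.map f).map Prod.fst)
    (h₂ : (A.map f).map Prod.snd = (B.map f).map Prod.snd)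
    (h : (A.map f).count (false, false) < (B.map f).count (false, false)) :
    ∃ x₁ x₂ y₁ y₂, A = {x₁, x₂} ∧ B = {y₁, y₂} ∧ f x₁ = (false, true) ∧ f x₂ = (true, false) ∧
      f y₁ = (false, false) ∧ f y₂ = (true, true) := by
  obtain hc | hc | hc : A.card = 0 ∨ A.card = 1 ∨ A.card = 2 := by omega
  · rw [hc] at hAB
    rw [Multiset.card_eq_zero.1 hc, Multiset.card_eq_zero.1 hAB.symm] at h
    exact absurd h (lt_irrefl _)
  · rw [hc] at hAB
    obtain ⟨x, rfl⟩ := Multiset.card_eq_one.1 hc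
    obtain ⟨y, rfl⟩ := Multiset.card_eq_one.1 hAB.symm
    have : f x = f y := Prod.ext (by simpa using h₁) (by simpa using h₂)
    simp [this] at h
  · rw [hc] at hAB
    obtain ⟨x₁, x₂, rfl⟩ := Multiset.card_eq_two.1 hc
    obtain ⟨y₁, y₂, rfl⟩ := Multiset.card_eq_two.1 hAB.symm
    obtain ⟨hx, hy⟩ := pair_of_count_lt (f x₁) (f x₂) (f y₁) (f y₂) (by simpa using h₁)
      (by simpa using h₂) (by simpa using h)
    obtain hx | hx := hx <;> obtain hy | hy := hy
    · exact ⟨x₁, x₂, y₁, y₂, rfl, rfl, hx.1, hx.2, hy.1, hy.2⟩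
    · exact ⟨x₁, x₂, y₂, y₁, rfl, Multiset.pair_comm _ _, hx.1, hx.2, hy.1, hy.2⟩
    · exact ⟨x₂, x₁, y₁, y₂, Multiset.pair_comm _ _, rfl, hx.1, hx.2, hy.1, hy.2⟩
    · exact ⟨x₂, x₁, y₂, y₁, Multiset.pair_comm _ _, Multiset.pair_comm _ _, hx.1, hx.2, hy.1, hy.2⟩

/-- In a model with quadratic moves, one can raise one entry of a binary pair margin in steps
of one. -/
theorem exists_raise {RX : Multiset X → Multiset X → Prop} (hX : IsMarginRel RX)
    {f : X → Bool × Bool}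
    (h₁ : ∀ A B, RX A B → (A.map f).map Prod.fst = (B.map f).map Prod.fst)
    (h₂ : ∀ A B, RX A B → (A.map f).map Prod.snd = (B.map f).map Prod.snd)
    (hl : LinkedAll RX 2) {A B : Multiset X} (hAB : RX A B)
    (hlt : (A.map f).count (false, false) < (B.map f).count (false, false)) :
    ∃ x₁ x₂ y₁ y₂ C, RX A ({x₁, x₂} + C) ∧ A.map f = ({x₁, x₂} + C).map f ∧
      RX {x₁, x₂} {y₁, y₂} ∧ f x₁ = (false, true) ∧ f x₂ = (true, false) ∧
      f y₁ = (false, false) ∧ f y₂ = (true, true) := by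
  -- Along the chain from `A` to `B` each quadratic move changes the entry by at most one, so some
  -- move passes from `L` to `L + 1`. The case needed is `L` equal to the entry of `A`, where the
  -- table before that move has the same pair margin as `A`.
  have key : ∀ L : ℕ, (A.map f).count (false, false) ≤ L → L < (B.map f).count (false, false) →
    ∃ x₁ x₂ y₁ y₂ C, RX A ({x₁, x₂} + C) ∧
      (({x₁, x₂} + C).map f).count (false, false) = L ∧
      RX {x₁, x₂} {y₁, y₂} ∧ f x₁ = (false, true) ∧ f x₂ = (true, false) ∧
      f y₁ = (false, false) ∧ f y₂ = (true, true) := by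
    intro L
    induction hl _ _ hAB using Relation.ReflTransGen.head_induction_on with
    | refl => intro h h'; omega
    | head hs hrest ih =>
      rename_i A A₁
      intro h h'
      by_cases hL : (A₁.map f).count (false, false) ≤ L
      · obtain ⟨x₁, x₂, y₁, y₂, C, hC, hr⟩ := ih (Linked.rel hX hrest) (lt_of_le_of_lt hL h') hL h'
        exact ⟨x₁, x₂, y₁, y₂, C, hX.trans (hs.rel hX) hC, hr⟩
      · obtain ⟨A₀, B₀, C, hk, hr, rfl, rfl⟩ := hs
        simp only [Multiset.map_add, Multiset.count_add] at h hL
        obtain ⟨x₁, x₂, y₁, y₂, rfl, rfl, hx₁, hx₂, hy₁, hy₂⟩ := exists_pairs_of_count_lt hk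
          (hX.card_eq hr) (h₁ _ _ hr) (h₂ _ _ hr) (by omega)
        refine ⟨x₁, x₂, y₁, y₂, C, hX.refl _, ?_, hr, hx₁, hx₂, hy₁, hy₂⟩
        simp [hx₁, hx₂, hy₁, hy₂] at h hL ⊢
        omega
  obtain ⟨x₁, x₂, y₁, y₂, C, hr, hL, hrest⟩ := key _ le_rfl hlt
  exact ⟨x₁, x₂, y₁, y₂, C, hr, eq_of_margins_of_count (h₁ _ _ hr) (h₂ _ _ hr) hL.symm, hrest⟩

theorem IsMarginRel.and_map {S : Type*} {R : Multiset X → Multiset X → Prop} (hR : IsMarginRel R)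
    (e : X → S) : IsMarginRel fun A B => R A B ∧ A.map e = B.map e :=
  ⟨fun A => ⟨hR.refl A, rfl⟩, fun h => ⟨hR.symm h.1, h.2.symm⟩,
    fun h h' => ⟨hR.trans h.1 h'.1, h.2.trans h'.2⟩,
    fun C h => ⟨hR.add_right C h.1, by simp [h.2]⟩,
    fun C h => ⟨hR.cancel_right C h.1, by simpa using h.2⟩, fun h => hR.card_eq h.1⟩

/-- Gluing two models along two binary vertices that are not joined by an edge. -/
theorem IsFiberProduct.linkedAll_of_chord {p : Z → X} {q : Z → Y} {f : X → Bool × Bool}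
    {g : Y → Bool × Bool} (h : IsFiberProduct p q f g) {RX : Multiset X → Multiset X → Prop}
    {RY : Multiset Y → Multiset Y → Prop} {RZ : Multiset Z → Multiset Z → Prop}
    (hX : IsMarginRel RX) (hY : IsMarginRel RY) (hZ : IsMarginRel RZ)
    (hRZ : ∀ T T', RZ T T' ↔ RX (T.map p) (T'.map p) ∧ RY (T.map q) (T'.map q))
    (hf₁ : ∀ A B, RX A B → (A.map f).map Prod.fst = (B.map f).map Prod.fst)
    (hf₂ : ∀ A B, RX A B → (A.map f).map Prod.snd = (B.map f).map Prod.snd)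
    (hg₁ : ∀ A B, RY A B → (A.map g).map Prod.fst = (B.map g).map Prod.fst)
    (hg₂ : ∀ A B, RY A B → (A.map g).map Prod.snd = (B.map g).map Prod.snd)
    (hk : 2 ≤ k) (hlX : LinkedAll RX 2) (hlY : LinkedAll RY 2)
    (hlX' : LinkedAll (fun A B => RX A B ∧ A.map f = B.map f) k)
    (hlY' : LinkedAll (fun A B => RY A B ∧ A.map g = B.map g) k) : LinkedAll RZ k := by
  -- If the pair margins agree already, the situation is that of the models with the missing edge
  -- added, and gluing along a common margin applies.
  have key : ∀ T T', RZ T T' → (T.map p).map f = (T'.map p).map f → Linked RZ k T T' := by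
    intro T T' hT hTT
    have := h.linkedAll (RZ := fun T T' => (RX (T.map p) (T'.map p) ∧
      (T.map p).map f = (T'.map p).map f) ∧ (RY (T.map q) (T'.map q) ∧
      (T.map q).map g = (T'.map q).map g)) (hX.and_map f) (hY.and_map g) (fun _ _ => Iff.rfl)
      (fun _ _ h => h.2) (fun _ _ h => h.2) hk hlX' hlY'
    obtain ⟨h₁, h₂⟩ := (hRZ _ _).1 hT
    refine (this T T' ⟨⟨h₁, hTT⟩, h₂, ?_⟩).mono le_rfl fun A B hAB => (hRZ _ _).2 ⟨hAB.1.1, hAB.2.1⟩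
    rw [← h.map_map, ← h.map_map, hTT]
  -- Induction on the difference of the entries at `(false, false)`. Each round raises the entry of
  -- `T` by one through a single quadratic move, prepared on both sides at once.
  have main : ∀ n T T', RZ T T' → ((T'.map p).map f).count (false, false) =
      ((T.map p).map f).count (false, false) + n → Linked RZ k T T' := by
    intro n
    induction n with
    | zero =>
      intro T T' hT hn
      obtain ⟨h₁, -⟩ := (hRZ _ _).1 hT
      exact key _ _ hT (eq_of_margins_of_count (hf₁ _ _ h₁) (hf₂ _ _ h₁) hn.symm)
    | succ n ih =>
      intro T T' hT hn
      obtain ⟨hTX, hTY⟩ := (hRZ _ _).1 hT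
      obtain ⟨x₁, x₂, y₁, y₂, C, hC, hCf, hxy, hx₁, hx₂, hy₁, hy₂⟩ :=
        exists_raise hX hf₁ hf₂ hlX hTX (by omega)
      obtain ⟨u₁, u₂, v₁, v₂, D, hD, hDg, huv, hu₁, hu₂, hv₁, hv₂⟩ :=
        exists_raise hY hg₁ hg₂ hlY hTY (by rw [← h.map_map, ← h.map_map]; omega)
      -- On both sides the pair about to be exchanged has types 01 and 10. Removing it from equal
      -- pair margins leaves equal pair margins, so the remainders can be pasted.
      obtain ⟨E, rfl, rfl⟩ := h.exists_map_eq (B := C) (D := D) (by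
        have := hCf.symm.trans ((h.map_map T).trans hDg)
        simpa [hx₁, hx₂, hu₁, hu₂] using this)
      obtain ⟨z₁, rfl, rfl⟩ := h.lift x₁ u₁ (hx₁.trans hu₁.symm)
      obtain ⟨z₂, rfl, rfl⟩ := h.lift x₂ u₂ (hx₂.trans hu₂.symm)
      obtain ⟨w₁, rfl, rfl⟩ := h.lift y₁ v₁ (hy₁.trans hv₁.symm)
      obtain ⟨w₂, rfl, rfl⟩ := h.lift y₂ v₂ (hy₂.trans hv₂.symm)
      have hT₁ : RZ T ({z₁, z₂} + E) := (hRZ _ _).2 ⟨by simpa using hC, by simpa using hD⟩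
      have hT₂ : RZ {z₁, z₂} {w₁, w₂} := (hRZ _ _).2 ⟨by simpa using hxy, by simpa using huv⟩
      have hl₁ : Linked RZ k T ({z₁, z₂} + E) := key _ _ hT₁ (by simpa using hCf)
      refine hl₁.trans (.head (b := {w₁, w₂} + E)
        ⟨{z₁, z₂}, {w₁, w₂}, E, by simpa using hk, hT₂, rfl, rfl⟩ (ih _ _ ?_ ?_))
      · exact hZ.trans (hZ.symm (hZ.add_right E hT₂)) (hZ.trans (hZ.symm hT₁) hT)
      · rw [hn, hCf]
        simp [hx₁, hx₂, hy₁, hy₂]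
        omega
  intro T T' hT
  obtain hle | hle := le_total (((T.map p).map f).count (false, false))
    (((T'.map p).map f).count (false, false))
  · exact main _ T T' hT (Nat.add_sub_cancel' hle).symm
  · exact (main _ T' T (hZ.symm hT) (Nat.add_sub_cancel' hle).symm).symm hZ

end Chord

/-! ### Graph models -/

section GraphModel

variable {V : Type*} {α : V → Type*} {G : SimpleGraph V} {k : ℕ}

/-- Two multisets of rows have the same margins at all vertices and edges of the graph. -/
def SameMargins (G : SimpleGraph V) (T T' : Multiset (∀ v, α v)) : Prop :=
  T.card = T'.card ∧ ∀ v w, (v = w ∨ G.Adj v w) →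
    T.map (fun r => (r v, r w)) = T'.map (fun r => (r v, r w))

theorem isMarginRel_sameMargins (G : SimpleGraph V) :
    IsMarginRel (SameMargins (α := α) G) where
  refl _ := ⟨rfl, fun _ _ _ => rfl⟩
  symm h := ⟨h.1.symm, fun v w hvw => (h.2 v w hvw).symm⟩
  trans h h' := ⟨h.1.trans h'.1, fun v w hvw => (h.2 v w hvw).trans (h'.2 v w hvw)⟩
  add_right C h := ⟨by simp [h.1], fun v w hvw => by simp [h.2 v w hvw]⟩
  cancel_right C h := ⟨by simpa using h.1, fun v w hvw => by simpa using h.2 v w hvw⟩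
  card_eq h := h.1

theorem SameMargins.map_eq {S : Type*} {T T' : Multiset (∀ v, α v)} (h : SameMargins G T T')
    {a b : V} (hab : a = b ∨ G.Adj a b) {f : (∀ v, α v) → S}
    (hf : ∀ r r', r a = r' a → r b = r' b → f r = f r') : T.map f = T'.map f :=
  map_eq_map_of_factors (fun r r' hr => hf r r' (congrArg Prod.fst hr) (congrArg Prod.snd hr))
    (h.2 a b hab)

theorem SameMargins.map_eq_of_forall {S : Type*} {T T' : Multiset (∀ v, α v)}
    (h : SameMargins G T T') {f : (∀ v, α v) → S} (hf : ∀ r r', f r = f r') :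
    T.map f = T'.map f :=
  map_eq_map_of_factors (g := fun _ => ()) (fun r r' _ => hf r r') (by simp [h.1])

/-- Every vertex and every edge lies in one of the two parts, so each margin is visible in one of
the restrictions. -/
theorem sameMargins_iff_restrict {A B : Set V}
    (hcov : ∀ v w, (v = w ∨ G.Adj v w) → (v ∈ A ∧ w ∈ A) ∨ (v ∈ B ∧ w ∈ B))
    (T T' : Multiset (∀ v, α v)) :
    SameMargins G T T' ↔ SameMargins (G.induce A) (T.map A.domRestrict) (T'.map A.domRestrict) ∧
      SameMargins (G.induce B) (T.map B.domRestrict) (T'.map B.domRestrict) := by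
  constructor
  · intro h
    refine ⟨⟨by simpa using h.1, fun v w hvw => ?_⟩, ⟨by simpa using h.1, fun v w hvw => ?_⟩⟩ <;>
    · rw [Multiset.map_map, Multiset.map_map]
      exact h.2 v w (hvw.imp (congrArg Subtype.val) id)
  · rintro ⟨hA, hB⟩
    refine ⟨by simpa using hA.1, fun v w hvw => ?_⟩
    obtain ⟨hv, hw⟩ | ⟨hv, hw⟩ := hcov v w hvw
    · have := hA.2 ⟨v, hv⟩ ⟨w, hw⟩ (hvw.imp (fun h => Subtype.ext h) id)
      rwa [Multiset.map_map, Multiset.map_map] at this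
    · have := hB.2 ⟨v, hv⟩ ⟨w, hw⟩ (hvw.imp (fun h => Subtype.ext h) id)
      rwa [Multiset.map_map, Multiset.map_map] at this

/-- The condition on `f` and `g` says that they encode the restriction to `A ∩ B`. Leaving `S` open
allows it to be either the rows on `A ∩ B` or `Bool × Bool`. -/
theorem isFiberProduct_restrict {S : Type*} {A B : Set V} (hAB : ∀ v, v ∈ A ∨ v ∈ B)
    {f : (∀ v : A, α v) → S} {g : (∀ v : B, α v) → S}
    (hfg : ∀ x y, f x = g y ↔ ∀ v (hA : v ∈ A) (hB : v ∈ B), x ⟨v, hA⟩ = y ⟨v, hB⟩) :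
    IsFiberProduct (A.domRestrict (π := α)) (B.domRestrict (π := α)) f g where
  comm z := (hfg _ _).2 fun _ _ _ => rfl
  lift x y hxy := by
    classical
    rw [hfg] at hxy
    refine ⟨fun v => if h : v ∈ A then x ⟨v, h⟩ else y ⟨v, (hAB v).resolve_left h⟩, ?_, ?_⟩
    · ext ⟨v, hv⟩
      exact dif_pos hv
    · ext ⟨v, hv⟩
      by_cases h : v ∈ A
      · exact (dif_pos h).trans (hxy v h hv)
      · exact dif_neg h
  ext {z z'} h hz := by
    ext v
    obtain hv | hv := hAB v
    · exact congrFun h ⟨v, hv⟩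
    · exact congrFun hz ⟨v, hv⟩

/-- Gluing along a separating clique with at most two vertices. -/
theorem linkedAll_of_separator {A B : Set V}
    (hcov : ∀ v w, (v = w ∨ G.Adj v w) → (v ∈ A ∧ w ∈ A) ∨ (v ∈ B ∧ w ∈ B))
    (hS : A ∩ B = ∅ ∨ ∃ a b, A ∩ B = {a, b} ∧ (a = b ∨ G.Adj a b)) (hk : 2 ≤ k)
    (hA : LinkedAll (SameMargins (α := fun v : A => α v) (G.induce A)) k)
    (hB : LinkedAll (SameMargins (α := fun v : B => α v) (G.induce B)) k) :
    LinkedAll (SameMargins (α := α) G) k := by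
  have hAB : ∀ v, v ∈ A ∨ v ∈ B := fun v => (hcov v v (.inl rfl)).imp And.left And.left
  refine (isFiberProduct_restrict (S := ∀ v : (A ∩ B : Set V), α v) hAB
    (f := fun x v => x ⟨v, v.2.1⟩) (g := fun y v => y ⟨v, v.2.2⟩) ?_).linkedAll
    (isMarginRel_sameMargins _) (isMarginRel_sameMargins _) (sameMargins_iff_restrict hcov)
    ?_ ?_ hk hA hB
  · intro x y
    exact ⟨fun h v h₁ h₂ => congrFun h ⟨v, h₁, h₂⟩, fun h => funext fun v => h v.1 v.2.1 v.2.2⟩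
  · intro T T' hT
    obtain hS | ⟨a, b, hS, hab⟩ := hS
    · exact hT.map_eq_of_forall fun r r' => funext fun v => (hS ▸ v.2 : v.1 ∈ (∅ : Set V)).elim
    · have ha : a ∈ A ∩ B := by simp [hS]
      have hb : b ∈ A ∩ B := by simp [hS]
      refine hT.map_eq (a := ⟨a, ha.1⟩) (b := ⟨b, hb.1⟩) (hab.imp (fun h => Subtype.ext h) id) ?_
      intro r r' hra hrb
      ext ⟨v, hv⟩
      obtain rfl | rfl : v = a ∨ v = b := by simpa [hS] using hv
      exacts [hra, hrb]
  · intro T T' hT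
    obtain hS | ⟨a, b, hS, hab⟩ := hS
    · exact hT.map_eq_of_forall fun r r' => funext fun v => (hS ▸ v.2 : v.1 ∈ (∅ : Set V)).elim
    · have ha : a ∈ A ∩ B := by simp [hS]
      have hb : b ∈ A ∩ B := by simp [hS]
      refine hT.map_eq (a := ⟨a, ha.2⟩) (b := ⟨b, hb.2⟩) (hab.imp (fun h => Subtype.ext h) id) ?_
      intro r r' hra hrb
      ext ⟨v, hv⟩
      obtain rfl | rfl : v = a ∨ v = b := by simpa [hS] using hv
      exacts [hra, hrb]

theorem sameMargins_induce_sup_edge_iff {a b : V} (hab : a ≠ b) {A : Set V} (ha : a ∈ A)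
    (hb : b ∈ A) (T T' : Multiset (∀ v : A, α v)) :
    SameMargins ((G ⊔ SimpleGraph.edge a b).induce A) T T' ↔ SameMargins (G.induce A) T T' ∧
      T.map (fun r => (r ⟨a, ha⟩, r ⟨b, hb⟩)) = T'.map (fun r => (r ⟨a, ha⟩, r ⟨b, hb⟩)) := by
  constructor
  · intro h
    refine ⟨⟨h.1, fun v w hvw => h.2 v w (hvw.imp id fun h => .inl h)⟩, h.2 _ _ (.inr (.inr ?_))⟩
    simp [SimpleGraph.edge_adj, hab]
  · rintro ⟨h, hm⟩
    refine ⟨h.1, fun v w hvw => ?_⟩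
    obtain hvw | hvw | hvw := hvw
    · exact h.2 v w (.inl hvw)
    · exact h.2 v w (.inr hvw)
    · obtain ⟨v, hv⟩ := v
      obtain ⟨w, hw⟩ := w
      obtain ⟨⟨rfl, rfl⟩ | ⟨rfl, rfl⟩, -⟩ := (SimpleGraph.edge_adj ..).1 hvw
      · exact hm
      · exact map_eq_map_of_factors (fun r r' hr => by simp_all) hm

/-- Gluing along a separating pair of binary vertices. -/
theorem linkedAll_of_binary_separator {A B : Set V} {a b : V} (hab : a ≠ b)
    (hcov : ∀ v w, (v = w ∨ G.Adj v w) → (v ∈ A ∧ w ∈ A) ∨ (v ∈ B ∧ w ∈ B))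
    (hS : A ∩ B = {a, b}) (ea : α a ≃ Bool) (eb : α b ≃ Bool) (hk : 2 ≤ k)
    (hA : LinkedAll (SameMargins (α := fun v : A => α v) (G.induce A)) 2)
    (hB : LinkedAll (SameMargins (α := fun v : B => α v) (G.induce B)) 2)
    (hA' : LinkedAll
      (SameMargins (α := fun v : A => α v) ((G ⊔ SimpleGraph.edge a b).induce A)) k)
    (hB' : LinkedAll
      (SameMargins (α := fun v : B => α v) ((G ⊔ SimpleGraph.edge a b).induce B)) k) :
    LinkedAll (SameMargins (α := α) G) k := by
  have hAB : ∀ v, v ∈ A ∨ v ∈ B := fun v => (hcov v v (.inl rfl)).imp And.left And.left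
  have ha : a ∈ A ∩ B := by simp [hS]
  have hb : b ∈ A ∩ B := by simp [hS]
  have congr_rel : ∀ (C : Set V) (ha : a ∈ C) (hb : b ∈ C),
      SameMargins (α := fun v : C => α v) ((G ⊔ SimpleGraph.edge a b).induce C) =
      fun T T' => SameMargins (G.induce C) T T' ∧
        T.map (fun x => (ea (x ⟨a, ha⟩), eb (x ⟨b, hb⟩))) =
        T'.map (fun x => (ea (x ⟨a, ha⟩), eb (x ⟨b, hb⟩))) := by
    intro C ha hb
    ext T T'
    rw [sameMargins_induce_sup_edge_iff hab ha hb]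
    refine and_congr_right fun _ => ⟨fun h => ?_, fun h => ?_⟩ <;>
    exact map_eq_map_of_factors (fun r r' hr => by simpa using hr) h
  rw [congr_rel A ha.1 hb.1] at hA'
  rw [congr_rel B ha.2 hb.2] at hB'
  refine (isFiberProduct_restrict hAB
    (f := fun x => (ea (x ⟨a, ha.1⟩), eb (x ⟨b, hb.1⟩)))
    (g := fun y => (ea (y ⟨a, ha.2⟩), eb (y ⟨b, hb.2⟩))) ?_).linkedAll_of_chord
    (isMarginRel_sameMargins _) (isMarginRel_sameMargins _) (isMarginRel_sameMargins _)
    (sameMargins_iff_restrict hcov) ?_ ?_ ?_ ?_ hk hA hB hA' hB'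
  · intro x y
    simp only [Prod.mk.injEq, EmbeddingLike.apply_eq_iff_eq]
    constructor
    · rintro ⟨h₁, h₂⟩ v hvA hvB
      obtain rfl | rfl : v = a ∨ v = b := by
        have : v ∈ A ∩ B := ⟨hvA, hvB⟩
        simpa [hS] using this
      exacts [h₁, h₂]
    · exact fun h => ⟨h a ha.1 ha.2, h b hb.1 hb.2⟩
  all_goals
    intro T T' hT
    rw [Multiset.map_map, Multiset.map_map]
  · exact hT.map_eq (a := ⟨a, ha.1⟩) (.inl rfl) fun r r' h _ => by simp [h]
  · exact hT.map_eq (a := ⟨b, hb.1⟩) (.inl rfl) fun r r' h _ => by simp [h]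
  · exact hT.map_eq (a := ⟨a, ha.2⟩) (.inl rfl) fun r r' h _ => by simp [h]
  · exact hT.map_eq (a := ⟨b, hb.2⟩) (.inl rfl) fun r r' h _ => by simp [h]

/-- There is only one row, so the cardinality clause of `SameMargins` makes the multisets equal. -/
theorem linkedAll_of_isEmpty [IsEmpty V] : LinkedAll (SameMargins (α := α) G) k := by
  intro T T' hT
  have := hT.map_eq_of_forall (f := id) fun r r' => Subsingleton.elim _ _
  rw [Multiset.map_id, Multiset.map_id] at this
  exact this ▸ .refl

theorem linkedAll_of_pair {a b : V} (hV : ∀ v, v = a ∨ v = b) (hab : a = b ∨ G.Adj a b) :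
    LinkedAll (SameMargins (α := α) G) k := by
  intro T T' hT
  have := hT.map_eq (f := id) hab fun r r' h₁ h₂ => funext fun v => by
    obtain rfl | rfl := hV v
    exacts [h₁, h₂]
  rw [Multiset.map_id, Multiset.map_id] at this
  exact this ▸ .refl

/-- Adding a vertex with at most one neighbour. -/
theorem linkedAll_of_leaf {m c : V} (hm : ∀ w, G.Adj m w → w = c) (hk : 2 ≤ k)
    (h : LinkedAll (SameMargins (α := fun v : ({m}ᶜ : Set V) => α v) (G.induce {m}ᶜ)) k) :
    LinkedAll (SameMargins (α := α) G) k := by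
  by_cases hmc : G.Adj m c
  · refine linkedAll_of_separator (A := {m}ᶜ) (B := {m, c}) ?_ (.inr ⟨c, c, ?_, .inl rfl⟩) hk h
      (linkedAll_of_pair (a := ⟨m, by simp⟩) (b := ⟨c, by simp⟩) ?_ (.inr hmc))
    · rintro v w (rfl | hvw)
      · by_cases h : v = m <;> simp [h]
      · by_cases hv : v = m
        · subst hv; simp [hm w hvw]
        · by_cases hw : w = m
          · subst hw; simp [hm v hvw.symm]
          · simp [hv, hw]
    · ext v
      have := hmc.ne
      by_cases hv : v = m
      · subst hv; simp [this]
      · simp [hv]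
    · rintro ⟨v, rfl | rfl⟩ <;> simp
  · have hm' : ∀ w, ¬ G.Adj m w := fun w hw => hmc (hm w hw ▸ hw)
    refine linkedAll_of_separator (A := {m}ᶜ) (B := {m}) ?_ (.inl (by simp)) hk h
      (linkedAll_of_pair (a := ⟨m, by simp⟩) (b := ⟨m, by simp⟩) ?_ (.inl rfl))
    · rintro v w (rfl | hvw)
      · by_cases h : v = m <;> simp [h]
      · left
        constructor
        · rintro rfl; exact hm' _ hvw
        · rintro rfl; exact hm' _ hvw.symm
    · rintro ⟨v, rfl⟩; simp

theorem SameMargins.of_triangle {v a b : V} (hV : ∀ w, w = v ∨ w = a ∨ w = b)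
    {T T' : Multiset (∀ v, α v)} (h₁ : T.map (fun r => (r v, r a)) = T'.map (fun r => (r v, r a)))
    (h₂ : T.map (fun r => (r v, r b)) = T'.map (fun r => (r v, r b)))
    (h₃ : T.map (fun r => (r a, r b)) = T'.map (fun r => (r a, r b))) : SameMargins G T T' := by
  refine ⟨by simpa using congrArg Multiset.card h₁, fun x y _ => ?_⟩
  have key : ∀ r r' : ∀ v, α v, ∀ x y, (r x, r y) = (r' x, r' y) ↔ r x = r' x ∧ r y = r' y :=
    fun _ _ _ _ => Iff.of_eq (Prod.mk.injEq ..)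
  obtain rfl | rfl | rfl := hV x <;> obtain rfl | rfl | rfl := hV y
  all_goals
    first
    | exact map_eq_map_of_factors (fun r r' hr => by
        rw [key] at hr ⊢; first | exact hr | exact hr.symm | exact ⟨hr.1, hr.1⟩ | exact ⟨hr.2, hr.2⟩) h₁
    | exact map_eq_map_of_factors (fun r r' hr => by
        rw [key] at hr ⊢; first | exact hr | exact hr.symm | exact ⟨hr.1, hr.1⟩ | exact ⟨hr.2, hr.2⟩) h₂
    | exact map_eq_map_of_factors (fun r r' hr => by
        rw [key] at hr ⊢; first | exact hr | exact hr.symm) h₃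

/-- The triangle with two binary vertices. -/
theorem linkedAll_triangle {v a b : V} (hV : ∀ w, w = v ∨ w = a ∨ w = b)
    (hva : G.Adj v a) (hvb : G.Adj v b) (hab : G.Adj a b)
    (ha : ∀ x y z : α a, x ≠ z → y ≠ z → x = y) (hb : ∀ x y z : α b, x ≠ z → y ≠ z → x = y) :
    LinkedAll (SameMargins (α := α) G) 4 := by
  classical
  have hext : ∀ {r r' : ∀ w, α w}, r v = r' v → r a = r' a → r b = r' b → r = r' := by
    intro r r' h₁ h₂ h₃
    ext w
    obtain rfl | rfl | rfl := hV w
    exacts [h₁, h₂, h₃]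
  have hR := isMarginRel_sameMargins (α := α) G
  intro T
  induction hn : T.card using Nat.strong_induction_on generalizing T with
  | _ n ih =>
  intro T' hT
  have cancel : ∀ (z) (U U' : Multiset (∀ v, α v)), (z ::ₘ U).card = n →
      SameMargins G (z ::ₘ U) (z ::ₘ U') → Linked (SameMargins G) 4 (z ::ₘ U) (z ::ₘ U') := by
    intro z U U' hU hUU
    refine (ih _ ?_ U rfl U' (hR.cancel_right {z} ?_)).cons z
    · rw [← hU]; simp
    · rwa [add_comm, Multiset.singleton_add, add_comm, Multiset.singleton_add]
  by_cases hd : ∃ z ∈ T, z ∈ T'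
  · obtain ⟨z, hz, hz'⟩ := hd
    obtain ⟨U, rfl⟩ := Multiset.exists_cons_of_mem hz
    obtain ⟨U', rfl⟩ := Multiset.exists_cons_of_mem hz'
    exact cancel z U U' hn hT
  push Not at hd
  have find : ∀ {U U' : Multiset (∀ v, α v)}, SameMargins G U U' → ∀ z ∈ U', ∀ x y, G.Adj x y →
      ∃ r ∈ U, r x = z x ∧ r y = z y := by
    intro U U' hU z hz x y hxy
    have : (z x, z y) ∈ U.map (fun r => (r x, r y)) := by
      rw [hU.2 x y (.inr hxy)]
      exact Multiset.mem_map_of_mem _ hz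
    obtain ⟨r, hr, hrz⟩ := Multiset.mem_map.1 this
    exact ⟨r, hr, congrArg Prod.fst hrz, congrArg Prod.snd hrz⟩
  obtain rfl | ⟨z, hz⟩ := Multiset.empty_or_exists_mem T'
  · have : T = 0 := Multiset.card_eq_zero.1 (by simpa using hT.1)
    exact this ▸ .refl
  -- With coordinates `(v, a, b)` and `z = (i, 0, 0)`, the margins and the absence of common rows
  -- force `T` to contain `r = (i, 0, 1)`, `s = (i, 1, 0)`, `t = (j, 0, 0)` and `u = (j, 1, 1)`. The
  -- last one is found through `q = (j, 0, 1)` in `T'`.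
  obtain ⟨r, hr, hrv, hra⟩ := find hT z hz v a hva
  obtain ⟨s, hs, hsv, hsb⟩ := find hT z hz v b hvb
  obtain ⟨t, ht, hta, htb⟩ := find hT z hz a b hab
  obtain ⟨q, hq, hqv, hqa⟩ := find (hR.symm hT) t ht v a hva
  obtain ⟨u, hu, huv, hub⟩ := find hT q hq v b hvb
  have hrb : r b ≠ z b := fun h => hd r hr (hext hrv hra h ▸ hz)
  have hsa : s a ≠ z a := fun h => hd s hs (hext hsv h hsb ▸ hz)
  have htv : t v ≠ z v := fun h => hd t ht (hext h hta htb ▸ hz)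
  have hqb : q b ≠ t b := fun h => hd t ht (hext hqv.symm hqa.symm h.symm ▸ hq)
  have hua : u a ≠ q a := fun h => hd u hu (hext huv h hub ▸ hq)
  have hua' : u a = s a := ha _ _ (z a) (by rwa [← hta, ← hqa]) hsa
  have hub' : u b = r b := hb _ _ (z b) (by rwa [hub, ← htb]) hrb
  obtain ⟨U, rfl⟩ := Multiset.exists_cons_of_mem hr
  have hs' : s ∈ U := (Multiset.mem_cons.1 hs).resolve_left (by rintro rfl; exact hsa hra)
  obtain ⟨U, rfl⟩ := Multiset.exists_cons_of_mem hs'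
  have ht' : t ∈ U := ((Multiset.mem_cons.1 ht).resolve_left (by rintro rfl; exact htv hrv) |>
    Multiset.mem_cons.1).resolve_left (by rintro rfl; exact htv hsv)
  obtain ⟨U, rfl⟩ := Multiset.exists_cons_of_mem ht'
  have hu' : u ∈ U := (((Multiset.mem_cons.1 hu).resolve_left
    (by rintro rfl; exact htv (by rw [← hqv, ← huv, hrv])) |>
    Multiset.mem_cons.1).resolve_left (by rintro rfl; exact htv (by rw [← hqv, ← huv, hsv])) |>
    Multiset.mem_cons.1).resolve_left (by rintro rfl; exact hua hqa.symm)
  obtain ⟨U, rfl⟩ := Multiset.exists_cons_of_mem hu'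
  have hav := hva.ne'
  have hbv := hvb.ne'
  have hba := hab.ne'
  -- The quartic move of the triangle exchanges the rows for those with the value at `a` flipped,
  -- and `z` is `s` with this value flipped. It makes `z` a common row, which is then cancelled.
  have hmove : SameMargins G ({r} + {s} + {t} + {u}) ({z} + {Function.update r a (s a)} +
      {Function.update t a (u a)} + {Function.update u a (t a)}) := by
    refine SameMargins.of_triangle hV ?_ ?_ ?_
    · simp only [Multiset.map_add, Multiset.map_singleton, Function.update_self,
        Function.update_of_ne hva.ne, hrv, hra, hsv, hta, huv, hqv, hua']
      ac_rfl
    · simp only [Multiset.map_add, Multiset.map_singleton, Function.update_of_ne hba,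
        Function.update_of_ne hva.ne, hrv, hsv, huv, hqv, hsb]
      ac_rfl
    · simp only [Multiset.map_add, Multiset.map_singleton, Function.update_self,
        Function.update_of_ne hba, hra, hsb, hta, htb, hua', hub']
      ac_rfl
  obtain ⟨U', rfl⟩ := Multiset.exists_cons_of_mem hz
  have hsplit : r ::ₘ s ::ₘ t ::ₘ u ::ₘ U = {r} + {s} + {t} + {u} + U := by
    simp only [← Multiset.singleton_add]; ac_rfl
  have hsplit' : z ::ₘ (Function.update r a (s a) ::ₘ Function.update t a (u a) ::ₘ
      Function.update u a (t a) ::ₘ U) = {z} + {Function.update r a (s a)} +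
      {Function.update t a (u a)} + {Function.update u a (t a)} + U := by
    simp only [← Multiset.singleton_add]; ac_rfl
  have hmove' := hR.add_right U hmove
  refine .head (b := z ::ₘ (Function.update r a (s a) ::ₘ Function.update t a (u a) ::ₘ
      Function.update u a (t a) ::ₘ U)) ⟨_, _, U, ?_, hmove, hsplit, hsplit'⟩ (cancel _ _ _ ?_ ?_)
  · simp
  · rw [← hn]; simp
  · rw [hsplit']
    rw [hsplit] at hT
    exact hR.trans (hR.symm hmove') hT

end GraphModel

universe w

/-! ### Noncrossing orders -/

/-- `f` orders the vertices in `A` such that no two edges inside `A` cross. -/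
structure NoncrossingOn {V : Type*} (G : SimpleGraph V) (f : V → ℝ) (A : Set V) : Prop where
  injOn : Set.InjOn f A
  not_cross : ∀ a ∈ A, ∀ b ∈ A, ∀ c ∈ A, ∀ d ∈ A, f a < f b → f b < f c → f c < f d →
    G.Adj a c → ¬ G.Adj b d

section Noncrossing

variable {V : Type*} {G : SimpleGraph V} {f : V → ℝ} {A B : Set V}

theorem NoncrossingOn.induce (h : NoncrossingOn G f Set.univ) (A : Set V) :
    NoncrossingOn (G.induce A) (fun v => f v) Set.univ where
  injOn _ _ _ _ hvw := Subtype.ext (h.injOn trivial trivial hvw)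
  not_cross a _ b _ c _ d _ h₁ h₂ h₃ hac hbd :=
    h.not_cross a trivial b trivial c trivial d trivial h₁ h₂ h₃ hac hbd

theorem exists_forall_lt_of_finite (hA : A.Finite) (f : V → ℝ) : ∃ M : ℝ, ∀ a ∈ A, |f a| < M := by
  obtain ⟨M, hM⟩ := (hA.image fun a => |f a|).bddAbove
  exact ⟨M + 1, fun a ha => (hM ⟨a, ha, rfl⟩).trans_lt (lt_add_one M)⟩

/-- A noncrossing order may be rotated. -/
theorem NoncrossingOn.exists_rotate (h : NoncrossingOn G f A) (hA : A.Finite) {s : V}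
    (hs : s ∈ A) : ∃ g, NoncrossingOn G g A ∧ ∀ a ∈ A, g s ≤ g a := by
  classical
  obtain ⟨M, hM⟩ := exists_forall_lt_of_finite hA f
  have hM' : ∀ a ∈ A, -M < f a ∧ f a < M := fun a ha => abs_lt.1 (hM a ha)
  -- Since `M` bounds `|f|` on `A`, adding `2 * M` moves the vertices before `s` behind all others
  -- and keeps their mutual order.
  have key : ∀ a ∈ A, ∀ b ∈ A, (if f a < f s then f a + 2 * M else f a) <
      (if f b < f s then f b + 2 * M else f b) ↔
      (f s ≤ f a ∧ f b < f s) ∨ ((f a < f s ↔ f b < f s) ∧ f a < f b) := by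
    intro a ha b hb
    have := hM' a ha
    have := hM' b hb
    split_ifs with h₁ h₂ h₂
    · simp [h₁, h₂]
    · have : ¬ f s ≤ f a := not_le.2 h₁
      simp only [this, h₁, h₂]; constructor <;> intro h
      · linarith
      · simp at h
    · have : f s ≤ f a := not_lt.1 h₁
      simp only [this, h₂]; simp; linarith
    · simp [h₁, h₂]
  refine ⟨fun v => if f v < f s then f v + 2 * M else f v, ⟨?_, ?_⟩, ?_⟩
  · intro a ha b hb hab
    have := hM' a ha
    have := hM' b hb
    simp only at hab
    apply h.injOn ha hb
    split_ifs at hab <;> linarith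
  · intro a ha b hb c hc d hd h₁ h₂ h₃ hac hbd
    simp only [key _ ha _ hb, key _ hb _ hc, key _ hc _ hd] at h₁ h₂ h₃
    -- In the old order the four vertices form a cyclic shift of `a, b, c, d`, and crossing is
    -- invariant under such shifts.
    by_cases hla : f a < f s <;> by_cases hlb : f b < f s <;> by_cases hlc : f c < f s <;>
      by_cases hld : f d < f s <;>
      simp only [hla, hlb, hlc, hld, iff_true, iff_false, true_and, false_and, and_true,
        and_false, not_true, not_false_eq_true, or_false, false_or, not_le.2, not_lt.1] at h₁ h₂ h₃ <;>
      first
      | exact h.not_cross a ha b hb c hc d hd (by linarith) (by linarith) (by linarith) hac hbd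
      | exact h.not_cross b hb c hc d hd a ha (by linarith) (by linarith) (by linarith) hbd hac.symm
      | exact h.not_cross c hc d hd a ha b hb (by linarith) (by linarith) (by linarith) hac.symm
          hbd.symm
      | exact h.not_cross d hd a ha b hb c hc (by linarith) (by linarith) (by linarith) hbd.symm hac
  · intro a ha
    have := hM' a ha
    have := hM' s hs
    simp only [lt_irrefl, if_false]
    split_ifs <;> linarith

end Noncrossing

/-! ### Outerplanar graph models are generated in degree four -/

section Outerplanar

/-- Every vertex has at most one earlier neighbour, so the last vertex can be removed as a leaf or
an isolated vertex. This is the form in which forests arise from a noncrossing order. -/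
theorem linkedAll_two_of_forest {V : Type u} [Finite V] (G : SimpleGraph V) (α : V → Type w)
    (f : V → ℝ) (hf : Function.Injective f)
    (h : ∀ v x y, f x < f v → f y < f v → G.Adj v x → G.Adj v y → x = y) :
    LinkedAll (SameMargins (α := α) G) 2 := by
  induction hn : Nat.card V using Nat.strong_induction_on generalizing V with
  | _ n ih =>
  obtain hV | hV := isEmpty_or_nonempty V
  · exact linkedAll_of_isEmpty
  obtain ⟨m, hm⟩ := Finite.exists_max f
  have hlt : ∀ x, x ≠ m → f x < f m := fun x hx => lt_of_le_of_ne (hm x) (hf.ne hx)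
  obtain ⟨c, hc⟩ : ∃ c, ∀ x, G.Adj m x → x = c := by
    by_cases hne : ∃ c, G.Adj m c
    · obtain ⟨c, hc⟩ := hne
      exact ⟨c, fun x hx => h m x c (hlt _ hx.ne') (hlt _ hc.ne') hx hc⟩
    · push Not at hne
      -- For an isolated `m` the name of its only neighbour is a dummy value.
      exact ⟨m, fun x hx => (hne x hx).elim⟩
  refine linkedAll_of_leaf hc le_rfl (ih _ ?_ (G.induce {m}ᶜ) _ (fun v => f v)
    (hf.comp Subtype.val_injective) ?_ rfl)
  · rw [← hn]
    exact Set.ncard_lt_card (s := {m}ᶜ) (by simp)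
  · intro v x y h₁ h₂ h₃ h₄
    exact Subtype.ext (h v x y h₁ h₂ h₃ h₄)

theorem binary_eq {β : Type*} (e : β ≃ Bool) (x y z : β) (hx : x ≠ z) (hy : y ≠ z) : x = y := by
  apply e.injective
  have h₁ := e.injective.ne hx
  have h₂ := e.injective.ne hy
  revert h₁ h₂
  generalize e x = a; generalize e y = b; generalize e z = c
  revert a b c
  decide

/-- When no leaf and no separating edge is left, an edge can only join vertices consecutive in the
cyclic order. A vertex taken from `I` then has two binary neighbours, and cutting it off leaves a
triangle after the edge between them is added if necessary. -/
theorem linkedAll_four_of_noncrossing {V : Type u} [Finite V] (G : SimpleGraph V) (α : V → Type w)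
    (f : V → ℝ) (hf : NoncrossingOn G f Set.univ) (I : Set V) (hI : G.IsIndepSet I)
    (hα : ∀ v ∉ I, Nonempty (α v ≃ Bool)) : LinkedAll (SameMargins (α := α) G) 4 := by
  induction hn : Nat.card V using Nat.strong_induction_on generalizing V with
  | _ n ih =>
  have hlt : ∀ A : Set V, A ≠ Set.univ → Nat.card A < n := fun A hA =>
    hn ▸ Set.ncard_lt_card hA
  have ind : ∀ A : Set V, A ≠ Set.univ →
      LinkedAll (SameMargins (α := fun v : A => α v) (G.induce A)) 4 := by
    intro A hA
    refine ih _ (hlt A hA) (G.induce A) _ _ (hf.induce A) (Subtype.val ⁻¹' I) ?_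
      (fun v hv => hα v hv) rfl
    intro v hv w hw hvw
    exact hI hv hw (fun h => hvw (Subtype.ext h))
  by_cases hleaf : ∃ m c, ∀ x, G.Adj m x → x = c
  · obtain ⟨m, c, hmc⟩ := hleaf
    exact linkedAll_of_leaf hmc (by norm_num) (ind _ (by simp))
  push Not at hleaf
  obtain hV | hV := isEmpty_or_nonempty V
  · exact linkedAll_of_isEmpty
  -- Either way no neighbour of `v` belongs to `I`, so all neighbours of `v` are binary.
  obtain ⟨v, hvI⟩ : ∃ v, v ∈ I ∨ I = ∅ := by
    obtain rfl | ⟨v, hv⟩ := I.eq_empty_or_nonempty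
    · exact ⟨Classical.arbitrary V, .inr rfl⟩
    · exact ⟨v, .inl hv⟩
  obtain ⟨f, hf, hv⟩ := hf.exists_rotate Set.finite_univ (Set.mem_univ v)
  have hinj : Function.Injective f := fun x y h => hf.injOn trivial trivial h
  -- An edge with vertices strictly inside and strictly outside separates the graph, because no edge
  -- crosses it.
  by_cases hsep : ∃ a b x y, G.Adj a b ∧ f a < f x ∧ f x < f b ∧ (f y < f a ∨ f b < f y)
  · obtain ⟨a, b, x, y, hab, hax, hxb, hy⟩ := hsep
    have cross : ∀ p q, (f a < f p ∧ f p < f b) → (f q < f a ∨ f b < f q) → ¬ G.Adj p q := by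
      rintro p q ⟨h₁, h₂⟩ (h₃ | h₃) hpq
      · exact hf.not_cross q trivial a trivial p trivial b trivial h₃ h₁ h₂ hpq.symm hab
      · exact hf.not_cross a trivial p trivial b trivial q trivial h₁ h₂ h₃ hab hpq
    refine linkedAll_of_separator (A := {p | f a ≤ f p ∧ f p ≤ f b})
      (B := {p | f p ≤ f a ∨ f b ≤ f p}) ?_ (.inr ⟨a, b, ?_, .inr hab⟩) (by norm_num)
      (ind _ ?_) (ind _ ?_)
    · rintro p q (rfl | hpq)
      · by_contra! h
        simp only [Set.mem_ofPred_eq] at h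
        grind
      · by_contra! h
        simp only [Set.mem_ofPred_eq] at h
        have h₁ := cross p q
        have h₂ := cross q p
        have := hpq.symm
        grind
    · ext p
      simp only [Set.mem_inter_iff, Set.mem_ofPred_eq, Set.mem_insert_iff, Set.mem_singleton_iff]
      constructor
      · rintro ⟨⟨h₁, h₂⟩, h₃ | h₃⟩
        · exact .inl (hinj (le_antisymm h₃ h₁))
        · exact .inr (hinj (le_antisymm h₂ h₃))
      · rintro (rfl | rfl)
        · exact ⟨⟨le_rfl, by linarith⟩, .inl le_rfl⟩
        · exact ⟨⟨by linarith, le_rfl⟩, .inr le_rfl⟩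
    · intro h
      have : y ∈ {p | f a ≤ f p ∧ f p ≤ f b} := h ▸ Set.mem_univ y
      simp only [Set.mem_ofPred_eq] at this
      grind
    · intro h
      have : x ∈ {p | f p ≤ f a ∨ f b ≤ f p} := h ▸ Set.mem_univ x
      simp only [Set.mem_ofPred_eq] at this
      grind
  push Not at hsep
  obtain ⟨a, b, hva, hvb, hab⟩ : ∃ a b, G.Adj v a ∧ G.Adj v b ∧ f a < f b := by
    obtain ⟨a, hva, -⟩ := hleaf v v
    obtain ⟨b, hvb, hba⟩ := hleaf v a
    obtain h | h := lt_or_gt_of_ne (hinj.ne hba)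
    · exact ⟨b, a, hvb, hva, h⟩
    · exact ⟨a, b, hva, hvb, h⟩
  have hmin : ∀ x, x ≠ v → f v < f x := fun x hx =>
    lt_of_le_of_ne (hv x trivial) (hinj.ne hx.symm)
  -- From here on an edge that skips a vertex joins the first vertex to the last. The edge from `v`
  -- to `b` skips `a`, so `b` is last; similarly `a` comes immediately after `v`.
  have hmax : ∀ x, f x ≤ f b := fun x => (hsep v b a x hvb (hmin a hva.ne') hab).2
  have hsucc : ∀ x, x ≠ v → f a ≤ f x := by
    intro x hx
    by_contra! h
    exact (not_le.2 hab) (hsep v a x b hva (hmin x hx) h).2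
  have hnbr : ∀ x, G.Adj v x → x = a ∨ x = b := by
    intro x hx
    by_contra! h
    have h₁ : f a < f x := lt_of_le_of_ne (hsucc x hx.ne') (hinj.ne h.1.symm)
    exact h.2 (hinj (le_antisymm (hmax x) (hsep v x a b hx (hmin a hva.ne') h₁).2))
  have hane : a ≠ b := fun h => hab.ne (congrArg f h)
  have hbin : ∀ x, G.Adj v x → x ∉ I := by
    rintro x hx hxI
    obtain hvI | rfl := hvI
    · exact hI hvI hxI hx.ne hx
    · exact hxI
  have hcov : ∀ x y, (x = y ∨ G.Adj x y) → (x ∈ ({v, a, b} : Set V) ∧ y ∈ ({v, a, b} : Set V)) ∨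
      (x ∈ ({v}ᶜ : Set V) ∧ y ∈ ({v}ᶜ : Set V)) := by
    rintro x y (rfl | hxy)
    · by_cases h : x = v <;> simp [h]
    · by_cases hx : x = v
      · subst hx
        left
        simpa using (hnbr y hxy).imp id id |> Or.inr
      · by_cases hy : y = v
        · subst hy
          left
          simpa using (hnbr x hxy.symm).imp id id |> Or.inr
        · right; exact ⟨hx, hy⟩
  have hS : ({v, a, b} : Set V) ∩ {v}ᶜ = {a, b} := by
    ext x
    have := hva.ne'
    have := hvb.ne'
    simp only [Set.mem_inter_iff, Set.mem_insert_iff, Set.mem_singleton_iff, Set.mem_compl_iff]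
    grind
  obtain ⟨ea⟩ := hα a (hbin a hva)
  obtain ⟨eb⟩ := hα b (hbin b hvb)
  have htri : ∀ H : SimpleGraph V, G ≤ H → H.Adj a b →
      LinkedAll (SameMargins (α := fun x : ({v, a, b} : Set V) => α x) (H.induce {v, a, b})) 4 := by
    intro H hGH hHab
    refine linkedAll_triangle (v := ⟨v, by simp⟩) (a := ⟨a, by simp⟩) (b := ⟨b, by simp⟩) ?_
      (hGH hva) (hGH hvb) hHab (binary_eq ea) (binary_eq eb)
    rintro ⟨x, rfl | rfl | rfl⟩ <;> simp
  by_cases hadj : G.Adj a b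
  · exact linkedAll_of_separator hcov (.inr ⟨a, b, hS, .inr hadj⟩) (by norm_num)
      (htri G le_rfl hadj) (ind _ (by simp))
  -- Without the edge `ab` the small side is a path. The rest is a forest too: two earlier
  -- neighbours of a vertex would give an edge that skips a vertex and has `v` outside.
  refine linkedAll_of_binary_separator hane hcov hS ea eb (by norm_num) ?_ ?_
    (htri _ le_sup_left (.inr (by simp [SimpleGraph.edge_adj, hane]))) ?_
  · refine linkedAll_two_of_forest _ _ (fun x => f x) (hinj.comp Subtype.val_injective) ?_
    have h₁ := hmin a hva.ne'
    have h₂ := hmin b hvb.ne'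
    have h₃ : ¬ G.Adj b a := fun h => hadj h.symm
    rintro ⟨x, rfl | rfl | rfl⟩ ⟨y, rfl | rfl | rfl⟩ ⟨z, rfl | rfl | rfl⟩ hy hz hxy hxz <;>
      first | rfl | (simp at hy hz hxy hxz; linarith) | exact (h₃ hxy).elim | exact (h₃ hxz).elim |
        (exfalso; simp only at hy hz; linarith)
  · refine linkedAll_two_of_forest _ _ (fun x => f x) (hinj.comp Subtype.val_injective) ?_
    rintro ⟨x, hx⟩ ⟨y, hy⟩ ⟨z, hz⟩ hyx hzx hxy hxz
    simp only at hyx hzx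
    by_contra hyz
    replace hyz : y ≠ z := fun h => hyz (Subtype.ext h)
    have hvx := hmin x hx
    have hvy := hmin y hy
    have hvz := hmin z hz
    obtain h | h := lt_or_gt_of_ne (hinj.ne hyz)
    · have := (hsep y x z v (SimpleGraph.Adj.symm hxy) h hzx).1
      linarith
    · have := (hsep z x y v (SimpleGraph.Adj.symm hxz) h hyx).1
      linarith
  · have hedge : ∀ x y, (SimpleGraph.edge a b).Adj x y → x = a ∧ y = b ∨ x = b ∧ y = a :=
      fun x y h => by simpa [eq_comm] using ((SimpleGraph.edge_adj ..).1 h).1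
    -- After the removal of `v` the new edge joins the first vertex to the last and crosses nothing.
    -- Its ends are outside `I`, so `I` stays independent.
    refine ih _ (hlt _ (by simp)) _ _ (fun x => f x) ⟨fun x _ y _ h => Subtype.ext (hinj h), ?_⟩
      (Subtype.val ⁻¹' I) ?_ (fun x hx => hα x hx) rfl
    · rintro ⟨x, hx⟩ - ⟨y, hy⟩ - ⟨z, hz⟩ - ⟨t, ht⟩ - h₁ h₂ h₃ hxz hyt
      simp only at h₁ h₂ h₃
      have hx' := hsucc x hx
      have ht' := hmax t
      obtain hxz | hxz := hxz
      · obtain hyt | hyt := hyt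
        · exact hf.not_cross x trivial y trivial z trivial t trivial h₁ h₂ h₃ hxz hyt
        · obtain ⟨rfl, rfl⟩ | ⟨rfl, rfl⟩ := hedge y t hyt <;>
          linarith
      · obtain ⟨rfl, rfl⟩ | ⟨rfl, rfl⟩ := hedge x z hxz <;>
          linarith
    · rintro ⟨x, hx⟩ hxI ⟨y, hy⟩ hyI hxy (h | h)
      · exact hI hxI hyI (fun h => hxy (Subtype.ext h)) h
      · obtain ⟨rfl, rfl⟩ | ⟨rfl, rfl⟩ := hedge x y h
        · exact hbin _ hva hxI
        · exact hbin _ hva hyI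

end Outerplanar

/-! ### Kernels of monomial homomorphisms -/

section Toric

open MvPolynomial

variable {σ τ : Type*} {K : Type*} [Field K] {k : ℕ}

open Classical in
/-- The monomial with a given multiset of variables. -/
noncomputable def mon (K : Type*) [Field K] {σ : Type*} (T : Multiset σ) : MvPolynomial σ K :=
  monomial (Multiset.toFinsupp T) 1

theorem mon_add (A B : Multiset σ) : mon K (A + B) = mon K A * mon K B := by
  classical
  simp [mon, monomial_mul]

theorem mon_zero : mon K (0 : Multiset σ) = 1 := by
  classical
  simp [mon]

theorem mon_singleton (x : σ) : mon K {x} = X x := by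
  classical
  simp [mon, X]

theorem monomial_eq_C_mul_mon (s : σ →₀ ℕ) (c : K) :
    monomial s c = C c * mon K (Finsupp.toMultiset s) := by
  classical
  simp [mon, C_mul_monomial]

open Classical in
theorem coeff_mon (T : Multiset σ) (s : σ →₀ ℕ) :
    coeff s (mon K T) = if T = Finsupp.toMultiset s then 1 else 0 := by
  rw [mon, coeff_monomial]
  congr 1
  rw [eq_iff_iff, Multiset.toFinsupp_eq_iff]

theorem isHomogeneous_mon (T : Multiset σ) : (mon K T).IsHomogeneous T.card := by
  classical
  refine isHomogeneous_monomial _ ?_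
  exact Multiset.toFinsupp_sum_eq T

/-- The binomials of degree at most `k` of a relation. -/
def binomials (K : Type*) [Field K] {σ : Type*} (R : Multiset σ → Multiset σ → Prop) (k : ℕ) :
    Set (MvPolynomial σ K) :=
  {g | ∃ A B, A.card ≤ k ∧ R A B ∧ g = mon K A - mon K B}

theorem mon_sub_mon_mem_of_linked {R : Multiset σ → Multiset σ → Prop} {T T' : Multiset σ}
    (h : Linked R k T T') : mon K T - mon K T' ∈ Ideal.span (binomials K R k) := by
  induction h with
  | refl => simp
  | tail _ hs ih =>
    obtain ⟨A, B, C, hk, hAB, rfl, rfl⟩ := hs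
    have hmem : mon K A - mon K B ∈ binomials K R k := ⟨A, B, hk, hAB, rfl⟩
    have := Ideal.mul_mem_right (mon K C) _ (Ideal.subset_span hmem)
    rw [sub_mul, ← mon_add, ← mon_add] at this
    simpa using add_mem ih this

variable {φ : MvPolynomial σ K →ₐ[K] MvPolynomial τ K} {m : Multiset σ → Multiset τ}

/-- Let `ρ` send each monomial in the image to one chosen preimage. Modulo `J` a monomial depends
only on its image, so `p` is congruent to `ρ (φ p)`, which is zero on the kernel. -/
theorem mem_of_mem_ker (hφ : ∀ T, φ (mon K T) = mon K (m T)) {J : Ideal (MvPolynomial σ K)}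
    (hJ : ∀ T T', m T = m T' → mon K T - mon K T' ∈ J) : RingHom.ker φ ≤ J := by
  classical
  let ρ : MvPolynomial τ K →ₗ[K] MvPolynomial σ K := (basisMonomials τ K).constr K fun t =>
    if h : ∃ T, m T = Finsupp.toMultiset t then mon K h.choose else 0
  have hρ : ∀ T, mon K T - ρ (mon K (m T)) ∈ J := by
    intro T
    have h : ∃ T', m T' = Finsupp.toMultiset (Multiset.toFinsupp (m T)) := ⟨T, by simp⟩
    have : ρ (mon K (m T)) = mon K h.choose := by
      have := (basisMonomials τ K).constr_basis K (fun t =>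
        if h : ∃ T, m T = Finsupp.toMultiset t then mon K h.choose else 0)
        (Multiset.toFinsupp (m T))
      rw [dif_pos h] at this
      simpa [mon, ρ] using this
    rw [this]
    exact hJ _ _ (h.choose_spec.trans (by simp)).symm
  have key : ∀ p, p - ρ (φ p) ∈ J := by
    intro p
    induction p using MvPolynomial.induction_on' with
    | monomial s c =>
      rw [monomial_eq_C_mul_mon, ← smul_eq_C_mul, map_smul, map_smul, hφ, ← smul_sub, smul_eq_C_mul]
      exact J.mul_mem_left _ (hρ _)
    | add p q hp hq =>
      rw [map_add, map_add, add_sub_add_comm]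
      exact add_mem hp hq
  intro p hp
  have := key p
  rwa [(RingHom.mem_ker).1 hp, map_zero, sub_zero] at this

/-- This is the fundamental theorem on Markov bases, in the direction from connected fibres to
generators: the binomial of a chain telescopes into monomial multiples of the binomials of its
moves. -/
theorem span_binomials_eq_ker (hφ : ∀ T, φ (mon K T) = mon K (m T))
    {R : Multiset σ → Multiset σ → Prop} (hR : ∀ T T', m T = m T' ↔ R T T')
    (hl : LinkedAll R k) : Ideal.span (binomials K R k) = RingHom.ker φ := by
  apply le_antisymm
  · rw [Ideal.span_le]
    rintro _ ⟨A, B, -, hAB, rfl⟩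
    simp only [SetLike.mem_coe, RingHom.mem_ker, map_sub, hφ, (hR A B).2 hAB, sub_self]
  · exact mem_of_mem_ker hφ fun T T' h => mon_sub_mon_mem_of_linked (hl _ _ ((hR _ _).1 h))

/-- Term by term in `a`, the component is zero or a multiple of `s`, and for `n < d` it is always
zero. -/
theorem homogeneousComponent_mul_mem {s : MvPolynomial σ K} {d : ℕ} (hs : s.IsHomogeneous d)
    {J : Ideal (MvPolynomial σ K)} {n : ℕ} (hJ : d ≤ n → s ∈ J) (a : MvPolynomial σ K) :
    homogeneousComponent n (a * s) ∈ J := by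
  induction a using MvPolynomial.induction_on' with
  | monomial u c =>
    have h : (monomial u c * s).IsHomogeneous (u.degree + d) :=
      (isHomogeneous_monomial c rfl).mul hs
    rw [homogeneousComponent_of_mem h]
    split_ifs with hn
    · exact J.mul_mem_left _ (hJ (by omega))
    · exact zero_mem _
  | add p q hp hq =>
    rw [add_mul, map_add]
    exact add_mem hp hq

/-- The largest degree of a minimal generator is bounded by the degrees in any homogeneous
generating set. -/
theorem maxGeneratorDegree_le {I : Ideal (MvPolynomial σ K)} {B : Set (MvPolynomial σ K)}
    (hB : ∀ g ∈ B, ∃ n ≤ k, g.IsHomogeneous n) (hI : Ideal.span B = I) :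
    maxGeneratorDegree I ≤ k := by
  refine iSup_le fun S => iSup_le fun hS => iSup₂_le fun f hf => ?_
  by_contra hlt
  push Not at hlt
  replace hlt : k < f.totalDegree := by exact_mod_cast hlt
  -- Components of degree at most `k` of the ideal involve only these generators. Hence `S'` already
  -- generates `B`, and minimality of `S` excludes the generator `f` of larger degree.
  set S' : Set (MvPolynomial σ K) := {s | s ∈ S ∧ s.totalDegree ≤ k} with hS'
  have hsub : S' ⊆ S := fun s hs => hs.1
  have key : ∀ x ∈ Ideal.span S, ∀ a, ∀ n ≤ k, homogeneousComponent n (a * x) ∈ Ideal.span S' := by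
    intro x hx
    induction hx using Submodule.span_induction with
    | mem s hs =>
      intro a n hn
      obtain ⟨d, hd⟩ := hS.prop.1 s hs
      refine homogeneousComponent_mul_mem hd (fun hdn => ?_) a
      have hmem : s ∈ S' := ⟨hs, hd.totalDegree_le.trans (hdn.trans hn)⟩
      exact Ideal.subset_span hmem
    | zero => simp
    | add x y _ _ hx hy =>
      intro a n hn
      rw [mul_add, map_add]
      exact add_mem (hx a n hn) (hy a n hn)
    | smul b x _ hx =>
      intro a n hn
      rw [smul_eq_mul, ← mul_assoc]
      exact hx _ n hn
  have hgen : IsHomogeneousGenerating I S' := by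
    refine ⟨fun s hs => hS.prop.1 s hs.1, le_antisymm ?_ ?_⟩
    · exact (Ideal.span_mono hsub).trans hS.prop.2.le
    · rw [← hI, Ideal.span_le]
      intro g hg
      obtain ⟨n, hn, hgn⟩ := hB g hg
      have := key g (by rw [hS.prop.2, ← hI]; exact Ideal.subset_span hg) 1 n hn
      rwa [one_mul, homogeneousComponent_of_mem hgn, if_pos rfl] at this
  exact (not_le.2 hlt) (hS.le_of_le hgen hsub hf).2

/-- A lower bound for the supremum in `maxGeneratorDegree` needs some minimal generating set. By
noetherianity finitely many elements of `B` suffice, and they have only finitely many subsets. -/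
theorem exists_minimal_generating [Finite σ] {I : Ideal (MvPolynomial σ K)}
    {B : Set (MvPolynomial σ K)} (hB : ∀ g ∈ B, ∃ n, g.IsHomogeneous n) (hI : Ideal.span B = I) :
    ∃ S, Minimal (IsHomogeneousGenerating I) S := by
  classical
  obtain ⟨B₀, hB₀, hspan⟩ := (Submodule.fg_span_iff_fg_span_finset_subset B).1
    (IsNoetherian.noetherian (Ideal.span B))
  have hgen : IsHomogeneousGenerating I (B₀ : Set (MvPolynomial σ K)) :=
    ⟨fun f hf => hB f (hB₀ hf), hspan.symm.trans hI⟩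
  have hfin : {S : Set (MvPolynomial σ K) | S ⊆ B₀ ∧ IsHomogeneousGenerating I S}.Finite :=
    (B₀.finite_toSet.finite_subsets).subset fun S hS => hS.1
  obtain ⟨S, -, hS⟩ := hfin.exists_le_minimal (a := (B₀ : Set (MvPolynomial σ K)))
    ⟨subset_rfl, hgen⟩
  exact ⟨S, hS.prop.2, fun S' hS' hle => hS.le_of_le ⟨hle.trans hS.prop.1, hS'⟩ hle⟩

/-- A monomial alone in its fibre meets no other term under `φ`, so its coefficient reappears
unchanged in the image. -/
theorem coeff_eq_zero_of_mem_ker (hφ : ∀ T, φ (mon K T) = mon K (m T)) {w : σ →₀ ℕ}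
    (hw : ∀ T, m T = m (Finsupp.toMultiset w) → T = Finsupp.toMultiset w) {p : MvPolynomial σ K}
    (hp : p ∈ RingHom.ker φ) : coeff w p = 0 := by
  classical
  have key : ∀ p, coeff w p = coeff (Multiset.toFinsupp (m (Finsupp.toMultiset w))) (φ p) := by
    intro p
    induction p using MvPolynomial.induction_on' with
    | monomial s c =>
      rw [monomial_eq_C_mul_mon, ← smul_eq_C_mul, map_smul, hφ, coeff_smul, coeff_smul, coeff_mon,
        coeff_mon, Multiset.toFinsupp_toMultiset]
      congr 2
      exact propext ⟨fun h => by rw [h], hw _⟩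
    | add p q hp hq => rw [map_add, coeff_add, coeff_add, hp, hq]
  rw [key, (RingHom.mem_ker).1 hp, coeff_zero]

/-- A monomial that shares no variable with any other monomial in its fibre forces a generator of
its degree. -/
theorem lt_maxGeneratorDegree [Finite σ] (hφ : ∀ T, φ (mon K T) = mon K (m T))
    (hm : ∀ A B C, m A = m B → m (A + C) = m (B + C))
    (hcard : ∀ A B, m A = m B → A.card = B.card) {u v : Multiset σ} (hk : k < u.card)
    (hu : ∀ w, m w = m u → w = u ∨ Disjoint w u) (hv : m v = m u) (hvu : v ≠ u) :
    k < maxGeneratorDegree (RingHom.ker φ) := by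
  classical
  have hspan : Ideal.span {g : MvPolynomial σ K | ∃ A B, m A = m B ∧ g = mon K A - mon K B} =
      RingHom.ker φ := by
    apply le_antisymm
    · rw [Ideal.span_le]
      rintro _ ⟨A, B, hAB, rfl⟩
      simp only [SetLike.mem_coe, RingHom.mem_ker, map_sub, hφ, hAB, sub_self]
    · exact mem_of_mem_ker hφ fun T T' h => Ideal.subset_span ⟨T, T', h, rfl⟩
  obtain ⟨S, hS⟩ := exists_minimal_generating (by
    rintro _ ⟨A, B, hAB, rfl⟩
    exact ⟨A.card, (isHomogeneous_mon A).sub (hcard A B hAB ▸ isHomogeneous_mon B)⟩) hspan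
  by_contra hle
  push Not at hle
  have hdeg : ∀ s ∈ S, s.totalDegree ≤ k := by
    intro s hs
    have : (s.totalDegree : ℕ∞) ≤ k :=
      (le_iSup₂_of_le (f := fun S (_ : Minimal (IsHomogeneousGenerating (RingHom.ker φ)) S) =>
        ⨆ f ∈ S, (f.totalDegree : ℕ∞)) S hS
        (le_iSup₂_of_le (f := fun f (_ : f ∈ S) => (f.totalDegree : ℕ∞)) s hs le_rfl)).trans hle
    exact_mod_cast this
  have hSker : ∀ s ∈ S, s ∈ RingHom.ker φ := fun s hs => hS.prop.2 ▸ Ideal.subset_span hs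
  -- Generators of degree at most `k` can never produce the monomial `u`, although `mon K u - mon K
  -- v` lies in the ideal.
  have key : ∀ x ∈ Ideal.span S, ∀ a, coeff (Multiset.toFinsupp u) (a * x) = 0 := by
    intro x hx
    induction hx using Submodule.span_induction with
    | mem s hs =>
      intro a
      induction a using MvPolynomial.induction_on' with
      | monomial t c =>
        rw [coeff_monomial_mul']
        split_ifs with ht
        · obtain ⟨w, hw⟩ := exists_add_of_le ht
          have hw' : Multiset.toFinsupp u - t = w := by rw [hw, add_tsub_cancel_left]
          have huw : u = Finsupp.toMultiset w + Finsupp.toMultiset t := by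
            rw [← Finsupp.toMultiset_add, add_comm, ← hw, Multiset.toFinsupp_toMultiset]
          rw [hw']
          by_cases hwk : k < w.degree
          · rw [coeff_eq_zero_of_totalDegree_lt, mul_zero]
            exact (hdeg s hs).trans_lt hwk
          · rw [coeff_eq_zero_of_mem_ker hφ (w := w) _ (hSker s hs), mul_zero]
            -- A second member `T` of the fibre of `w` would give the member `T + t` of the fibre of
            -- `u`. It shares the variables of `t` with `u`, so it must equal `u`; and `t` is
            -- nonempty, since `w` has degree at most `k`.
            intro T hT
            have h₁ := hm _ _ (Finsupp.toMultiset t) hT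
            rw [← huw] at h₁
            obtain h | h := hu _ h₁
            · rw [huw] at h
              exact add_right_cancel h
            · exfalso
              obtain h0 | ⟨y, hy⟩ := Multiset.empty_or_exists_mem (Finsupp.toMultiset t)
              · apply hwk
                rw [h0, add_zero] at huw
                rw [huw, Finsupp.card_toMultiset] at hk
                exact hk
              · refine Multiset.disjoint_left.1 h (Multiset.mem_add.2 (.inr hy)) ?_
                rw [huw]
                exact Multiset.mem_add.2 (.inr hy)
        · rfl
      | add p q hp hq => rw [add_mul, coeff_add, hp, hq, add_zero]
    | zero => simp
    | add x y _ _ hx hy =>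
      intro a
      rw [mul_add, coeff_add, hx, hy, add_zero]
    | smul b x _ hx =>
      intro a
      rw [smul_eq_mul, ← mul_assoc]
      exact hx _
  have := key (mon K u - mon K v) (by
    rw [hS.prop.2, RingHom.mem_ker, map_sub, hφ, hφ, hv, sub_self]) 1
  rw [one_mul, coeff_sub, coeff_mon, coeff_mon, Multiset.toFinsupp_toMultiset] at this
  simp [hvu] at this

end Toric

/-! ### Toric ideals of graph models in terms of margins. -/

section GraphToric

open MvPolynomial

variable {V : Type u} [Finite V] {d : V → ℕ} {k : ℕ}

open Classical in
/-- The multiset of parameters in the image of a monomial under the toric homomorphism. -/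
noncomputable def parameters (Γ : LowerSet (Finset V)) (d : V → ℕ)
    (T : Multiset ((w : V) → Fin (d w))) :
    Multiset (Σ F : {F : Finset V // Maximal (fun A : Finset V => A ∈ Γ) F},
      ((w : {x : V // x ∈ F.1}) → Fin (d w.1))) :=
  letI := Fintype.ofFinite {F : Finset V // Maximal (fun A : Finset V => A ∈ Γ) F}
  T.bind fun i => Finset.univ.val.map fun F => ⟨F, fun w => i w.1⟩

theorem toricHom_mon (K : Type v) [Field K] (Γ : LowerSet (Finset V)) (d : V → ℕ)
    (T : Multiset ((w : V) → Fin (d w))) :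
    toricHom K Γ d (mon K T) = mon K (parameters Γ d T) := by
  classical
  let _ := Fintype.ofFinite {F : Finset V // Maximal (fun A : Finset V => A ∈ Γ) F}
  have aux : ∀ {ι τ : Type u} (s : Finset ι) (g : ι → τ),
      ∏ x ∈ s, (X (g x) : MvPolynomial τ K) = mon K (s.val.map g) := by
    intro ι τ s g
    induction s using Finset.induction_on with
    | empty => simp [mon_zero]
    | insert x s hx ih =>
      rw [Finset.prod_insert hx, ih, Finset.insert_val_of_notMem hx, Multiset.map_cons,
        ← Multiset.singleton_add, mon_add, mon_singleton]
  induction T using Multiset.induction with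
  | empty => simp [parameters, mon_zero]
  | cons i T ih =>
    rw [← Multiset.singleton_add, mon_add, map_mul, ih, mon_singleton, parameters, parameters,
      Multiset.singleton_add, Multiset.cons_bind, mon_add]
    congr 1
    rw [toricHom, aeval_X, finprod_eq_prod_of_fintype]
    exact aux Finset.univ _

theorem count_parameters [DecidableEq V] (Γ : LowerSet (Finset V)) (T : Multiset ((w : V) → Fin (d w)))
    (F : {F : Finset V // Maximal (fun A : Finset V => A ∈ Γ) F})
    (j : (w : {x : V // x ∈ F.1}) → Fin (d w.1)) :
    (parameters Γ d T).count ⟨F, j⟩ =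
      (T.map fun i => fun w : {x : V // x ∈ F.1} => i w.1).count j := by
  classical
  let _ := Fintype.ofFinite {F : Finset V // Maximal (fun A : Finset V => A ∈ Γ) F}
  induction T using Multiset.induction with
  | empty => simp [parameters]
  | cons i T ih =>
    rw [parameters, Multiset.cons_bind, Multiset.count_add, Multiset.map_cons, Multiset.count_cons,
      add_comm]
    congr 1
    · rw [Multiset.count_eq_of_nodup]
      · refine if_congr ?_ rfl rfl
        rw [Multiset.mem_map]
        constructor
        · rintro ⟨F', -, h⟩
          obtain ⟨rfl, h⟩ := Sigma.mk.inj_iff.1 h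
          exact (eq_of_heq h).symm
        · rintro rfl
          exact ⟨F, Finset.mem_univ _, rfl⟩
      · refine Multiset.Nodup.map ?_ Finset.univ.nodup
        intro F F' h
        exact (Sigma.mk.inj_iff.1 h).1

theorem parameters_eq_iff_forall (Γ : LowerSet (Finset V)) (T T' : Multiset ((w : V) → Fin (d w))) :
    parameters Γ d T = parameters Γ d T' ↔
      ∀ F : {F : Finset V // Maximal (fun A : Finset V => A ∈ Γ) F},
        (T.map fun i => fun w : {x : V // x ∈ F.1} => i w.1) =
        (T'.map fun i => fun w : {x : V // x ∈ F.1} => i w.1) := by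
  classical
  constructor
  · intro h F
    ext j
    have := congrArg (Multiset.count ⟨F, j⟩) h
    rwa [count_parameters, count_parameters] at this
  · intro h
    ext ⟨F, j⟩
    rw [count_parameters, count_parameters, h F]

/-- The ideal sees only facets. Each face lies in a facet, whose margin determines that of the face,
and each facet is empty, a vertex or an edge. The empty face accounts for the cardinality. -/
theorem parameters_eq_iff (G : SimpleGraph V) (T T' : Multiset ((w : V) → Fin (d w))) :
    parameters (graphComplex G) d T = parameters (graphComplex G) d T' ↔ SameMargins G T T' := by
  classical
  rw [parameters_eq_iff_forall]
  constructor
  · intro h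
    have key : ∀ F ∈ graphComplex G, ∃ F' : {F : Finset V //
        Maximal (fun A : Finset V => A ∈ graphComplex G) F}, F ⊆ F'.1 := by
      intro F hF
      obtain ⟨F', hle, hF'⟩ := Finite.exists_le_maximal (p := fun A => A ∈ graphComplex G) hF
      exact ⟨⟨F', hF'⟩, hle⟩
    refine ⟨?_, fun v w hvw => ?_⟩
    · obtain ⟨F, -⟩ := key ∅ ⟨by simp, by simp⟩
      simpa using congrArg Multiset.card (h F)
    · obtain ⟨F, hF⟩ := key {v, w} ⟨Finset.card_le_two, by
        rw [Finset.coe_pair, SimpleGraph.isClique_pair]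
        exact fun hne => hvw.resolve_left hne⟩
      refine map_eq_map_of_factors (fun r r' hr => ?_) (h F)
      exact Prod.ext (congrFun hr ⟨v, hF (by simp)⟩) (congrFun hr ⟨w, hF (by simp)⟩)
  · rintro h ⟨F, ⟨hcard, hF⟩, -⟩
    obtain hc | hc | hc : F.card = 0 ∨ F.card = 1 ∨ F.card = 2 := by omega
    · obtain rfl := Finset.card_eq_zero.1 hc
      exact h.map_eq_of_forall fun r r' => funext fun w => (Finset.notMem_empty _ w.2).elim
    · obtain ⟨a, rfl⟩ := Finset.card_eq_one.1 hc
      refine h.map_eq (a := a) (.inl rfl) fun r r' hr _ => funext fun w => ?_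
      obtain ⟨w, hw⟩ := w
      obtain rfl := Finset.mem_singleton.1 hw
      exact hr
    · obtain ⟨a, b, hab, rfl⟩ := Finset.card_eq_two.1 hc
      refine h.map_eq (a := a) (b := b) (.inr (hF (by simp) (by simp) hab)) fun r r' hra hrb =>
        funext fun w => ?_
      obtain ⟨w, hw⟩ := w
      obtain rfl | rfl : w = a ∨ w = b := by simpa using hw
      exacts [hra, hrb]

theorem markovWidth_le (K : Type v) [Field K] {G : SimpleGraph V}
    (hl : LinkedAll (SameMargins (α := fun w => Fin (d w)) G) k) : markovWidth K G d ≤ k := by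
  refine maxGeneratorDegree_le ?_ (span_binomials_eq_ker (toricHom_mon K _ d)
    (parameters_eq_iff G) hl)
  rintro _ ⟨A, B, hk, hAB, rfl⟩
  exact ⟨A.card, hk, (isHomogeneous_mon A).sub (hAB.1 ▸ isHomogeneous_mon B)⟩

theorem lt_markovWidth (K : Type v) [Field K] {G : SimpleGraph V}
    {T T' : Multiset ((w : V) → Fin (d w))} (hk : k < T.card)
    (hT : ∀ U, SameMargins G U T → U = T ∨ Disjoint U T) (hT' : SameMargins G T' T)
    (hne : T' ≠ T) : k < markovWidth K G d := by
  refine lt_maxGeneratorDegree (toricHom_mon K _ d) (fun A B C h => ?_)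
    (fun A B h => ((parameters_eq_iff G A B).1 h).1) hk
    (fun U hU => hT U ((parameters_eq_iff G _ _).1 hU)) ((parameters_eq_iff G _ _).2 hT') hne
  exact (parameters_eq_iff G _ _).2
    ((isMarginRel_sameMargins G).add_right C ((parameters_eq_iff G _ _).1 h))

/-- Graphs with a noncrossing vertex order are Markov slim. -/
theorem isMarkovSlim_of_noncrossing (K : Type v) [Field K] (G : SimpleGraph V) (f : V → ℝ)
    (hf : NoncrossingOn G f Set.univ) : IsMarkovSlim K G := by
  intro I hI d _ hd
  refine markovWidth_le K (linkedAll_four_of_noncrossing G _ f hf I hI fun w hw => ?_)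
  rw [hd w hw]
  exact ⟨finTwoEquiv⟩

end GraphToric

/-! ### The complete graph on four vertices and the complete bipartite graph `K_{2,3}` -/

section Forbidden

/-- This turns equal margins into linear equations between the cell counts, on which `omega` can
work. -/
theorem count_map_eq_sum {β γ : Type*} [Fintype β] [DecidableEq β] [DecidableEq γ] (g : β → γ)
    (P : Multiset β) (y : γ) :
    (P.map g).count y = ∑ x, if g x = y then P.count x else 0 := by
  induction P using Multiset.induction with
  | empty => simp
  | cons a P ih =>
    rw [Multiset.map_cons, Multiset.count_cons, ih]
    simp only [Multiset.count_cons]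
    have : ∀ x, (if g x = y then P.count x + (if x = a then 1 else 0) else 0) =
        (if g x = y then P.count x else 0) + (if x = a then (if y = g a then 1 else 0) else 0) := by
      intro x
      by_cases hx : x = a
      · subst hx; simp only [eq_comm, if_true]; split_ifs <;> simp_all
      · simp [hx]
    simp [this, Finset.sum_add_distrib]

/-- A table with one observation for each singleton and two for the full set. -/
def tableFour : Multiset (Bool × Bool × Bool × Bool) :=
  {(true, false, false, false), (false, true, false, false), (false, false, true, false),
    (false, false, false, true), (true, true, true, true), (true, true, true, true)}

theorem tableFour_fiber (P : Multiset (Bool × Bool × Bool × Bool))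
    (h₁ : P.map (fun r => (r.1, r.2.1)) = tableFour.map (fun r => (r.1, r.2.1)))
    (h₂ : P.map (fun r => (r.1, r.2.2.1)) = tableFour.map (fun r => (r.1, r.2.2.1)))
    (h₃ : P.map (fun r => (r.1, r.2.2.2)) = tableFour.map (fun r => (r.1, r.2.2.2)))
    (h₄ : P.map (fun r => (r.2.1, r.2.2.1)) = tableFour.map (fun r => (r.2.1, r.2.2.1)))
    (h₅ : P.map (fun r => (r.2.1, r.2.2.2)) = tableFour.map (fun r => (r.2.1, r.2.2.2)))
    (h₆ : P.map (fun r => (r.2.2.1, r.2.2.2)) = tableFour.map (fun r => (r.2.2.1, r.2.2.2))) :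
    P = tableFour ∨ Disjoint P tableFour := by
  have e₁ := fun y => (count_map_eq_sum _ P y).symm.trans (congrArg (Multiset.count y) h₁)
  have e₂ := fun y => (count_map_eq_sum _ P y).symm.trans (congrArg (Multiset.count y) h₂)
  have e₃ := fun y => (count_map_eq_sum _ P y).symm.trans (congrArg (Multiset.count y) h₃)
  have e₄ := fun y => (count_map_eq_sum _ P y).symm.trans (congrArg (Multiset.count y) h₄)
  have e₅ := fun y => (count_map_eq_sum _ P y).symm.trans (congrArg (Multiset.count y) h₅)
  have e₆ := fun y => (count_map_eq_sum _ P y).symm.trans (congrArg (Multiset.count y) h₆)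
  clear h₁ h₂ h₃ h₄ h₅ h₆
  simp [Fintype.sum_prod_type, tableFour, Multiset.count_cons, Multiset.count_singleton] at e₁ e₂ e₃ e₄ e₅ e₆
  -- Every pair has entry two at `(true, true)`, so the count is at most two. If it were one, double
  -- counting would give exactly two rows of weight three and none of weight two; the two triples
  -- share a pair, whose entry would be three.
  have key : P.count (true, true, true, true) = 0 ∨ P.count (true, true, true, true) = 2 := by omega
  obtain h0 | h0 := key
  · right
    rw [Multiset.disjoint_right]
    intro r hr
    rw [← Multiset.count_eq_zero]
    simp only [tableFour, Multiset.insert_eq_cons, Multiset.mem_cons, Multiset.mem_singleton] at hr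
    obtain rfl | rfl | rfl | rfl | rfl | rfl := hr <;> omega
  · left
    ext ⟨a, b, c, d⟩
    cases a <;> cases b <;> cases c <;> cases d <;>
    simp [tableFour, -Multiset.count_eq_zero] <;>
    omega

/-- The edges of a hexagon in `K_{3,3}`, coloured alternately. -/
def hexagon : Multiset (Fin 3 × Fin 3 × Bool) :=
  {(0, 0, false), (0, 1, true), (1, 1, false), (1, 2, true), (2, 0, true), (2, 2, false)}

/-- The last two margins together fix how often each pair of the first two coordinates occurs, so
`Q` is a colouring of the same six edges. The other two say that both colours occur at each vertex,
which leaves only the two alternating colourings. -/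
theorem hexagon_fiber (Q : Multiset (Fin 3 × Fin 3 × Bool))
    (h₁ : Q.map (fun r => (r.1, r.2.2)) = hexagon.map (fun r => (r.1, r.2.2)))
    (h₂ : Q.map (fun r => (r.2.1, r.2.2)) = hexagon.map (fun r => (r.2.1, r.2.2)))
    (h₃ : Q.map (fun r => (r.2.1, decide (r.1 = 1))) =
      hexagon.map (fun r => (r.2.1, decide (r.1 = 1))))
    (h₄ : Q.map (fun r => (r.2.1, decide (r.1 ≠ 2))) =
      hexagon.map (fun r => (r.2.1, decide (r.1 ≠ 2)))) :
    Q = hexagon ∨ Disjoint Q hexagon := by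
  have hcard : Q.card = hexagon.card := by simpa using congrArg Multiset.card h₁
  have e₁ := fun y => (count_map_eq_sum _ Q y).symm.trans (congrArg (Multiset.count y) h₁)
  have e₂ := fun y => (count_map_eq_sum _ Q y).symm.trans (congrArg (Multiset.count y) h₂)
  have e₃ := fun y => (count_map_eq_sum _ Q y).symm.trans (congrArg (Multiset.count y) h₃)
  have e₄ := fun y => (count_map_eq_sum _ Q y).symm.trans (congrArg (Multiset.count y) h₄)
  clear h₁ h₂ h₃ h₄
  simp [Fintype.sum_prod_type, Fin.sum_univ_three, Fin.forall_fin_succ, hexagon,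
    Multiset.count_cons, Multiset.count_singleton, -Multiset.count_eq_zero] at e₁ e₂ e₃ e₄
  have key : (Q.count (0, 0, false) = 0 ∧ Q.count (0, 1, true) = 0 ∧
      Q.count (1, 1, false) = 0 ∧ Q.count (1, 2, true) = 0 ∧
      Q.count (2, 0, true) = 0 ∧ Q.count (2, 2, false) = 0) ∨
      (Q.count (0, 0, false) = 1 ∧ Q.count (0, 1, true) = 1 ∧
      Q.count (1, 1, false) = 1 ∧ Q.count (1, 2, true) = 1 ∧
      Q.count (2, 0, true) = 1 ∧ Q.count (2, 2, false) = 1) := by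
    omega
  obtain h | h := key
  · right
    rw [Multiset.disjoint_right]
    intro r hr
    rw [← Multiset.count_eq_zero]
    simp only [hexagon, Multiset.insert_eq_cons, Multiset.mem_cons, Multiset.mem_singleton] at hr
    obtain rfl | rfl | rfl | rfl | rfl | rfl := hr <;> simp only [h]
  · left
    refine (Multiset.eq_of_le_of_card_le ((Multiset.le_iff_subset (by decide)).2 ?_) hcard.le).symm
    intro r hr
    rw [← Multiset.one_le_count_iff_mem]
    simp only [hexagon, Multiset.insert_eq_cons, Multiset.mem_cons, Multiset.mem_singleton] at hr
    obtain rfl | rfl | rfl | rfl | rfl | rfl := hr <;> simp only [h, le_refl]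

/-- Two further binary coordinates that encode the first one. -/
def hexagonLift (r : Fin 3 × Fin 3 × Bool) : Fin 3 × Fin 3 × Bool × Bool × Bool :=
  (r.1, r.2.1, r.2.2, decide (r.1 = 1), decide (r.1 ≠ 2))

/-- The margins of the first coordinate with the last two show that these two are functions of the
first in every row. So `P` is a lift, and the margins at the second coordinate become those of
`hexagon_fiber`. -/
theorem hexagonLift_fiber (P : Multiset (Fin 3 × Fin 3 × Bool × Bool × Bool))
    (h₁ : P.map (fun r => (r.1, r.2.2.1)) =
      (hexagon.map hexagonLift).map (fun r => (r.1, r.2.2.1)))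
    (h₂ : P.map (fun r => (r.1, r.2.2.2.1)) =
      (hexagon.map hexagonLift).map (fun r => (r.1, r.2.2.2.1)))
    (h₃ : P.map (fun r => (r.1, r.2.2.2.2)) =
      (hexagon.map hexagonLift).map (fun r => (r.1, r.2.2.2.2)))
    (h₄ : P.map (fun r => (r.2.1, r.2.2.1)) =
      (hexagon.map hexagonLift).map (fun r => (r.2.1, r.2.2.1)))
    (h₅ : P.map (fun r => (r.2.1, r.2.2.2.1)) =
      (hexagon.map hexagonLift).map (fun r => (r.2.1, r.2.2.2.1)))
    (h₆ : P.map (fun r => (r.2.1, r.2.2.2.2)) =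
      (hexagon.map hexagonLift).map (fun r => (r.2.1, r.2.2.2.2))) :
    P = hexagon.map hexagonLift ∨ Disjoint P (hexagon.map hexagonLift) := by
  have hmem : ∀ r ∈ P, r = hexagonLift (r.1, r.2.1, r.2.2.1) := by
    intro r hr
    have g₂ : (r.1, r.2.2.2.1) ∈ (hexagon.map hexagonLift).map (fun r => (r.1, r.2.2.2.1)) :=
      h₂ ▸ Multiset.mem_map_of_mem (fun r => (r.1, r.2.2.2.1)) hr
    have g₃ : (r.1, r.2.2.2.2) ∈ (hexagon.map hexagonLift).map (fun r => (r.1, r.2.2.2.2)) :=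
      h₃ ▸ Multiset.mem_map_of_mem (fun r => (r.1, r.2.2.2.2)) hr
    have aux : ∀ (x : Fin 3) (y z : Bool),
        (x, y) ∈ (hexagon.map hexagonLift).map (fun r => (r.1, r.2.2.2.1)) →
        (x, z) ∈ (hexagon.map hexagonLift).map (fun r => (r.1, r.2.2.2.2)) →
        y = decide (x = 1) ∧ z = decide (x ≠ 2) := by decide
    obtain ⟨hy, hz⟩ := aux _ _ _ g₂ g₃
    exact Prod.ext rfl (Prod.ext rfl (Prod.ext rfl (Prod.ext hy hz)))
  obtain ⟨Q, rfl⟩ : ∃ Q : Multiset (Fin 3 × Fin 3 × Bool), P = Q.map hexagonLift := by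
    refine ⟨P.map fun r => (r.1, r.2.1, r.2.2.1), ?_⟩
    rw [Multiset.map_map]
    conv_lhs => rw [← Multiset.map_id P]
    exact Multiset.map_congr rfl hmem
  simp only [Multiset.map_map] at h₁ h₄ h₅ h₆
  obtain h | h := hexagon_fiber Q h₁ h₄ h₅ h₆
  · exact .inl (by rw [h])
  · refine .inr (Multiset.disjoint_left.2 fun {r} hr hr' => ?_)
    obtain ⟨s, hs, rfl⟩ := Multiset.mem_map.1 hr
    obtain ⟨t, ht, hts⟩ := Multiset.mem_map.1 hr'
    have : t = s := by
      simp only [hexagonLift, Prod.mk.injEq] at hts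
      exact Prod.ext hts.1 (Prod.ext hts.2.1 hts.2.2.1)
    exact Multiset.disjoint_left.1 h hs (this ▸ ht)

end Forbidden

/-! ### Models on `K₄` and `K_{2,3}` that need degree six. -/

section ForbiddenGraphs

/-- Rows written as tuples have finitely many explicit cells, which makes the fibre computations
above applicable. -/
theorem lt_markovWidth_of_equiv (K : Type v) [Field K] {V : Type u} [Finite V] {d : V → ℕ}
    {G : SimpleGraph V} {k : ℕ} {β : Type*} (e : β ≃ ((w : V) → Fin (d w))) {T T' : Multiset β}
    (hk : k < T.card)
    (hT : ∀ P : Multiset β, SameMargins G (P.map e) (T.map e) → P = T ∨ Disjoint P T)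
    (hT' : SameMargins G (T'.map e) (T.map e)) (hne : T' ≠ T) : k < markovWidth K G d := by
  refine lt_markovWidth K (T := T.map e) (by simpa using hk) (fun U hU => ?_) hT'
    fun h => hne (Multiset.map_injective e.injective h)
  obtain ⟨P, rfl⟩ : ∃ P : Multiset β, U = P.map e := ⟨U.map e.symm, by simp⟩
  refine (hT P hU).imp (congrArg _) fun h => Multiset.disjoint_left.2 fun {r} hr hrT => ?_
  obtain ⟨s, hs, rfl⟩ := Multiset.mem_map.1 hr
  exact Multiset.disjoint_left.1 h hs ((Multiset.mem_map_of_injective e.injective).1 hrT)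

/-- The rows of the binary model on four vertices. -/
def rowsFour : (Bool × Bool × Bool × Bool) ≃ (ULift.{u} (Fin 4) → Fin 2) where
  toFun c w := finTwoEquiv.symm (![c.1, c.2.1, c.2.2.1, c.2.2.2] w.down)
  invFun r := (finTwoEquiv (r ⟨0⟩), finTwoEquiv (r ⟨1⟩), finTwoEquiv (r ⟨2⟩), finTwoEquiv (r ⟨3⟩))
  left_inv c := by simp
  right_inv r := by
    ext ⟨w⟩
    fin_cases w <;> simp

theorem not_isMarkovSlim_four (K : Type v) [Field K] :
    ¬ IsMarkovSlim K (⊤ : SimpleGraph (ULift.{u} (Fin 4))) := by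
  intro h
  have h₁ := h ∅ (by simp [SimpleGraph.IsIndepSet]) (fun _ => 2) (by simp) (by simp)
  refine (not_le.2 ?_) h₁
  -- The second table negates every coordinate of `tableFour`.
  refine lt_markovWidth_of_equiv K rowsFour.{u} (k := 4) (T := tableFour)
    (T' := {(false, false, false, false), (false, false, false, false), (false, true, true, true),
      (true, false, true, true), (true, true, false, true), (true, true, true, false)})
    (by decide) ?_ ?_ (by decide)
  · intro P hP
    have key := fun i j (hij : i ≠ j) => hP.2 ⟨i⟩ ⟨j⟩ (.inr fun h => hij (congrArg ULift.down h))
    simp only [Multiset.map_map] at key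
    refine tableFour_fiber P ?_ ?_ ?_ ?_ ?_ ?_
    · exact map_eq_map_of_factors (fun r r' hr => by simpa [rowsFour] using hr)
        (key 0 1 (by decide))
    · exact map_eq_map_of_factors (fun r r' hr => by simpa [rowsFour] using hr)
        (key 0 2 (by decide))
    · exact map_eq_map_of_factors (fun r r' hr => by simpa [rowsFour] using hr)
        (key 0 3 (by decide))
    · exact map_eq_map_of_factors (fun r r' hr => by simpa [rowsFour] using hr)
        (key 1 2 (by decide))
    · exact map_eq_map_of_factors (fun r r' hr => by simpa [rowsFour] using hr)
        (key 1 3 (by decide))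
    · exact map_eq_map_of_factors (fun r r' hr => by
        simpa only [Prod.mk.injEq] using (show _ ∧ _ by simpa [rowsFour] using hr))
        (key 2 3 (by decide))
  · refine ⟨rfl, ?_⟩
    rintro ⟨i⟩ ⟨j⟩ -
    rw [Multiset.map_map, Multiset.map_map]
    revert i j
    decide

/-- The number of levels of the model on `K_{2,3}`. -/
abbrev levelsTwoThree : ULift.{u} (Fin 2) ⊕ ULift.{u} (Fin 3) → ℕ := Sum.elim (fun _ => 3) fun _ => 2

/-- The rows of the model on `K_{2,3}`. -/
def rowsTwoThree : (Fin 3 × Fin 3 × Bool × Bool × Bool) ≃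
    ((w : ULift.{u} (Fin 2) ⊕ ULift.{u} (Fin 3)) → Fin (levelsTwoThree w)) where
  toFun c w := match w with
    | .inl a => ![c.1, c.2.1] a.down
    | .inr b => finTwoEquiv.symm (![c.2.2.1, c.2.2.2.1, c.2.2.2.2] b.down)
  invFun r := (r (.inl ⟨0⟩), r (.inl ⟨1⟩), finTwoEquiv (r (.inr ⟨0⟩)), finTwoEquiv (r (.inr ⟨1⟩)),
    finTwoEquiv (r (.inr ⟨2⟩)))
  left_inv c := by simp
  right_inv r := by
    ext (⟨w⟩ | ⟨w⟩)
    · fin_cases w <;> rfl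
    · fin_cases w <;> exact congrArg Fin.val (finTwoEquiv.symm_apply_apply _)

theorem not_isMarkovSlim_twoThree (K : Type v) [Field K] :
    ¬ IsMarkovSlim K (completeBipartiteGraph (ULift.{u} (Fin 2)) (ULift.{u} (Fin 3))) := by
  intro h
  have h₁ := h (Set.range Sum.inl) (by
    rintro _ ⟨a, rfl⟩ _ ⟨b, rfl⟩ -
    simp) levelsTwoThree (by rintro _ ⟨a, rfl⟩; simp) (by
    rintro (a | b) hw
    · exact (hw ⟨a, rfl⟩).elim
    · rfl)
  refine (not_le.2 ?_) h₁
  -- The second table is the hexagon with the two colours exchanged.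
  refine lt_markovWidth_of_equiv K rowsTwoThree.{u} (k := 4) (T := hexagon.map hexagonLift)
    (T' := (hexagon.map fun r => (r.1, r.2.1, !r.2.2)).map hexagonLift) (by decide) ?_ ?_
    (by decide)
  · intro P hP
    have key := fun (i : Fin 2) (j : Fin 3) => hP.2 (.inl ⟨i⟩) (.inr ⟨j⟩) (.inr (by simp))
    simp only [Multiset.map_map] at key
    refine hexagonLift_fiber P ?_ ?_ ?_ ?_ ?_ ?_
    · exact map_eq_map_of_factors (fun r r' hr => by simpa [rowsTwoThree] using hr) (key 0 0)
    · exact map_eq_map_of_factors (fun r r' hr => by simpa [rowsTwoThree] using hr) (key 0 1)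
    · exact map_eq_map_of_factors (fun r r' hr => by simpa [rowsTwoThree] using hr) (key 0 2)
    · exact map_eq_map_of_factors (fun r r' hr => by simpa [rowsTwoThree] using hr) (key 1 0)
    · exact map_eq_map_of_factors (fun r r' hr => by simpa [rowsTwoThree] using hr) (key 1 1)
    · exact map_eq_map_of_factors (fun r r' hr => by simpa [rowsTwoThree] using hr) (key 1 2)
  · refine ⟨rfl, ?_⟩
    rintro (⟨i⟩ | ⟨i⟩) (⟨j⟩ | ⟨j⟩) hij
    · obtain rfl : i = j := by simpa using hij
      clear hij
      revert i
      decide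
    · clear hij
      revert i j
      decide
    · clear hij
      revert i j
      decide
    · obtain rfl : i = j := by simpa using hij
      clear hij
      revert i
      decide

end ForbiddenGraphs

/-! ### Paths in a disc whose ends alternate on the circle meet -/

section Crossing

open Complex

/-- In the right half-plane the principal logarithm is continuous, so `ℓ - log γ` is a continuous
logarithm of the constant `w`. By uniqueness of lifts it is constant. -/
theorem log_sub_log_eq {ℓ γ : ℝ → ℂ} (hℓ : Continuous ℓ) (hγ : Continuous γ)
    (hre : ∀ t, 0 < (γ t).re) {w : ℂ} (h : ∀ t, exp (ℓ t) = w * γ t) (s t : ℝ) :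
    ℓ s - ℓ t = log (γ s) - log (γ t) := by
  have hne : ∀ t, γ t ≠ 0 := fun t h0 => by simpa [h0] using hre t
  have hexp : ∀ t, exp (ℓ t - log (γ t)) = w := by
    intro t
    rw [exp_sub, h, exp_log (hne t), mul_div_cancel_right₀ _ (hne t)]
  have hw : w ≠ 0 := hexp 0 ▸ exp_ne_zero _
  have hlog : Continuous fun t => log (γ t) := hγ.clog fun t => .inl (hre t)
  have huniq := isCoveringMapOn_exp.existsUnique_continuousMap_lifts
    (ContinuousMap.const ℝ w) (a₀ := t) (e₀ := ℓ t - log (γ t)) (hexp t) (fun _ => hw)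
  have := huniq.unique (y₁ := ⟨fun t => ℓ t - log (γ t), hℓ.sub hlog⟩)
    (y₂ := ContinuousMap.const ℝ (ℓ t - log (γ t))) ⟨rfl, funext hexp⟩
    ⟨rfl, funext fun _ => hexp t⟩
  have := congrArg (fun F : C(ℝ, ℂ) => F s) this
  simp only [ContinuousMap.coe_mk, ContinuousMap.const_apply] at this
  linear_combination this

/-- The polar form is `1 - exp (ψ * I) = 2 * sin (ψ / 2) * exp (((ψ - π) / 2) * I)`, with positive
modulus. -/
theorem arg_one_sub_exp {ψ : ℝ} (h₀ : 0 < ψ) (h₁ : ψ < 2 * Real.pi) :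
    (log (1 - exp (ψ * I))).im = (ψ - Real.pi) / 2 := by
  have hs : 0 < Real.sin (ψ / 2) := Real.sin_pos_of_pos_of_lt_pi (by linarith) (by linarith)
  have : 1 - exp (ψ * I) = (2 * Real.sin (ψ / 2) : ℝ) *
      (cos ((ψ - Real.pi) / 2 : ℝ) + sin ((ψ - Real.pi) / 2 : ℝ) * I) := by
    have hc : Real.cos ((ψ - Real.pi) / 2) = Real.sin (ψ / 2) := by
      rw [sub_div, Real.cos_sub_pi_div_two]
    have hs' : Real.sin ((ψ - Real.pi) / 2) = -Real.cos (ψ / 2) := by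
      rw [sub_div, Real.sin_sub_pi_div_two]
    rw [← ofReal_cos, ← ofReal_sin, hc, hs', exp_mul_I, ← ofReal_cos, ← ofReal_sin]
    have h2 : Real.cos ψ = 1 - 2 * Real.sin (ψ / 2) ^ 2 := by
      have h := Real.cos_two_mul (ψ / 2)
      have h' := Real.sin_sq_add_cos_sq (ψ / 2)
      rw [mul_div_cancel₀ _ two_ne_zero] at h
      linarith
    have h3 : Real.sin ψ = 2 * Real.sin (ψ / 2) * Real.cos (ψ / 2) := by
      rw [← Real.sin_two_mul, mul_div_cancel₀ _ two_ne_zero]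
    rw [h2, h3]
    push_cast
    ring
  rw [log_im, this, arg_mul_cos_add_sin_mul_I (by positivity)
    ⟨by linarith [Real.pi_pos], by linarith [Real.pi_pos]⟩]

theorem arg_one_sub_exp' {ψ : ℝ} (h₀ : -(2 * Real.pi) < ψ) (h₁ : ψ < 0) :
    (log (1 - exp (ψ * I))).im = (ψ + Real.pi) / 2 := by
  have h := arg_one_sub_exp (ψ := ψ + 2 * Real.pi) (by linarith) (by linarith)
  have h2 : exp (((ψ + 2 * Real.pi : ℝ) : ℂ) * I) = exp (ψ * I) := by
    push_cast
    rw [add_mul, exp_add, exp_two_pi_mul_I, mul_one]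
  rw [h2] at h
  rw [h]
  ring

/-- Seen from a point of the circle the disc fills only a half-plane. Hence the change of argument
along a path in the disc is given by the principal logarithms at its ends. -/
theorem re_one_sub_pos {b z : ℂ} (hb : ‖b‖ = 1) (hz : ‖z‖ ≤ 1) (hne : z ≠ b) :
    0 < (1 - (starRingEnd ℂ) b * z).re := by
  have h : 0 < normSq (z - b) := normSq_pos.2 (sub_ne_zero.2 hne)
  have h1 : normSq b = 1 := by rw [normSq_eq_norm_sq, hb, one_pow]
  have h2 : normSq z ≤ 1 := by
    rw [normSq_eq_norm_sq]
    exact pow_le_one₀ (norm_nonneg z) hz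
  simp only [normSq_apply, sub_re, sub_im, one_re, mul_re, conj_re, conj_im] at *
  nlinarith

/-- Two paths in the closed disc meet if their ends alternate on the circle. -/
theorem exists_eq_of_alternating {f g : ℝ → ℂ} (hf : Continuous f) (hg : Continuous g)
    (hf1 : ∀ t, ‖f t‖ ≤ 1) (hg1 : ∀ t, ‖g t‖ ≤ 1) {α β γ δ : ℝ} (hαβ : α < β) (hβγ : β < γ)
    (hγδ : γ < δ) (hδα : δ < α + 2 * Real.pi) (hf₀ : f 0 = exp (α * I)) (hf₁ : f 1 = exp (γ * I))
    (hg₀ : g 0 = exp (β * I)) (hg₁ : g 1 = exp (δ * I)) : ∃ s t, f s = g t := by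
  by_contra! hne
  -- If the paths do not meet, the difference `f s - g t` has no zero on the simply connected plane
  -- of parameters, so it has a continuous logarithm there.
  obtain ⟨L, hL⟩ : ∃ L : C(ℝ × ℝ, ℂ), ∀ s t, exp (L (s, t)) = f s - g t := by
    obtain ⟨L, hL, -⟩ := isCoveringMapOn_exp.existsUnique_continuousMap_lifts
      (⟨fun p : ℝ × ℝ => f p.1 - g p.2, by fun_prop⟩ : C(ℝ × ℝ, ℂ)) (a₀ := (0, 0))
      (e₀ := log (f 0 - g 0)) (exp_log (sub_ne_zero.2 (hne 0 0)))
      (fun p => sub_ne_zero.2 (hne p.1 p.2))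
    exact ⟨L, fun s t => congrFun hL.2 (s, t)⟩
  have hnorm : ∀ x : ℝ, ‖exp (x * I)‖ = 1 := norm_exp_ofReal_mul_I
  have hconj : ∀ x y : ℝ, (starRingEnd ℂ) (exp (x * I)) * exp (y * I) = exp ((y - x : ℝ) * I) := by
    intro x y
    rw [← exp_conj, ← exp_add]
    congr 1
    simp
    ring
  have hunit : ∀ x : ℝ, exp (x * I) * (starRingEnd ℂ) (exp (x * I)) = 1 := by
    intro x
    rw [mul_comm, hconj, sub_self]
    simp
  -- On a side of the unit square one of the two points rests on the circle, so the change of `L`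
  -- depends on the ends only.
  have side₁ : ∀ (x t : ℝ), g t = exp (x * I) → L (1, t) - L (0, t) =
      log (1 - exp ((γ - x : ℝ) * I)) - log (1 - exp ((α - x : ℝ) * I)) := by
    intro x t hx
    have := log_sub_log_eq (ℓ := fun s => L (s, t))
      (γ := fun s => 1 - (starRingEnd ℂ) (exp (x * I)) * f s) (by fun_prop) (by fun_prop)
      (fun s => re_one_sub_pos (hnorm x) (hf1 s) (hx ▸ hne s t)) (w := -exp (x * I)) (by
        intro s
        rw [hL, hx]
        linear_combination (-f s) * hunit x) 1 0
    simpa only [hf₀, hf₁, hconj] using this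
  have side₂ : ∀ (x s : ℝ), f s = exp (x * I) → L (s, 1) - L (s, 0) =
      log (1 - exp ((δ - x : ℝ) * I)) - log (1 - exp ((β - x : ℝ) * I)) := by
    intro x s hx
    have := log_sub_log_eq (ℓ := fun t => L (s, t))
      (γ := fun t => 1 - (starRingEnd ℂ) (exp (x * I)) * g t) (by fun_prop) (by fun_prop)
      (fun t => re_one_sub_pos (hnorm x) (hg1 t) (hx ▸ (hne s t).symm)) (w := exp (x * I)) (by
        intro t
        rw [hL, hx]
        linear_combination (g t) * hunit x) 1 0
    simpa only [hg₀, hg₁, hconj] using this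
  -- The two ways along the sides from `(0, 0)` to `(1, 1)` should change the argument equally, but
  -- for alternating ends the changes differ by `2 * π`.
  have e₁ := congrArg im (side₁ β 0 hg₀)
  have e₂ := congrArg im (side₂ γ 1 hf₁)
  have e₃ := congrArg im (side₁ δ 1 hg₁)
  have e₄ := congrArg im (side₂ α 0 hf₀)
  rw [sub_im, sub_im, arg_one_sub_exp (by linarith) (by linarith),
    arg_one_sub_exp' (by linarith) (by linarith)] at e₁ e₂
  rw [sub_im, sub_im, arg_one_sub_exp' (by linarith) (by linarith),
    arg_one_sub_exp' (by linarith) (by linarith)] at e₃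
  rw [sub_im, sub_im, arg_one_sub_exp (by linarith) (by linarith),
    arg_one_sub_exp (by linarith) (by linarith)] at e₄
  linarith [Real.pi_pos]

end Crossing

/-! ### Outerplanar embeddings and noncrossing orders -/

section Embedding

variable {V : Type u} {G : SimpleGraph V}

theorem OuterplanarEmbedding.exists_path (E : OuterplanarEmbedding G) {a c : V}
    (hac : G.Adj a c) : ∃ f : ℝ → ℂ, Continuous f ∧ (∀ t, ‖f t‖ ≤ 1) ∧ f 0 = E.pos a ∧
      f 1 = E.pos c ∧ ∀ t, f t ∈ Set.range (E.arc ⟨s(a, c), hac⟩) := by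
  set e : G.edgeSet := ⟨s(a, c), hac⟩ with he
  have hnorm : ∀ t, ‖E.arc e t‖ ≤ 1 := fun t => by simpa using E.arc_mem_disc e t
  have hends := E.arc_ends e
  rw [he, Sym2.map_mk, Sym2.eq_iff] at hends
  obtain ⟨h₀, h₁⟩ | ⟨h₀, h₁⟩ := hends
  · refine ⟨fun t => E.arc e (Set.projIcc 0 1 zero_le_one t), by fun_prop, fun t => hnorm _, ?_, ?_,
      fun t => ⟨_, rfl⟩⟩
    · rw [← h₀]; simp; rfl
    · rw [← h₁]; simp; rfl
  · refine ⟨fun t => E.arc e (Set.projIcc 0 1 zero_le_one (1 - t)), by fun_prop, fun t => hnorm _,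
      ?_, ?_, fun t => ⟨_, rfl⟩⟩
    · rw [← h₁]; simp; rfl
    · rw [← h₀]; simp; rfl

/-- The order is by argument on the circle. The arcs of crossing edges would meet, while arcs may
meet only in a common end and the four ends are distinct. -/
theorem OuterplanarEmbedding.noncrossingOn (E : OuterplanarEmbedding G) :
    NoncrossingOn G (fun v => (E.pos v).arg) Set.univ := by
  have hpos : ∀ v, E.pos v = Complex.exp ((E.pos v).arg * Complex.I) := by
    intro v
    have h : ‖E.pos v‖ = 1 := by simpa using E.pos_mem_circle v
    conv_lhs => rw [← Complex.norm_mul_exp_arg_mul_I (E.pos v), h]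
    simp
  refine ⟨fun v _ w _ hvw => E.pos_injective ?_, ?_⟩
  · rw [hpos v, hpos w]
    rw [show (E.pos v).arg = (E.pos w).arg from hvw]
  · intro a _ b _ c _ d _ hab hbc hcd hac hbd
    obtain ⟨f, hf, hf1, hf₀, hf₁, hfr⟩ := E.exists_path hac
    obtain ⟨g, hg, hg1, hg₀, hg₁, hgr⟩ := E.exists_path hbd
    obtain ⟨s, t, hst⟩ := exists_eq_of_alternating hf hg hf1 hg1 hab hbc hcd
      (by linarith [Complex.arg_le_pi (E.pos d), Complex.neg_pi_lt_arg (E.pos a)])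
      (hf₀.trans (hpos a)) (hf₁.trans (hpos c)) (hg₀.trans (hpos b)) (hg₁.trans (hpos d))
    have hne : ∀ {x y : V}, (E.pos x).arg < (E.pos y).arg → x ≠ y := by
      rintro x _ h rfl
      exact lt_irrefl _ h
    have h₁ := hne hab
    have h₂ := hne hbc
    have h₃ := hne hcd
    have h₄ := hne ((hab.trans hbc).trans hcd)
    obtain ⟨w, hw, hw', -⟩ := E.arc_inter ⟨s(a, c), hac⟩ ⟨s(b, d), hbd⟩ (by
      intro h
      have := Sym2.eq_iff.1 (congrArg Subtype.val h)
      tauto) (f s) ⟨hfr s, hst ▸ hgr t⟩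
    simp only [Sym2.mem_iff] at hw hw'
    obtain rfl | rfl := hw <;> obtain h | h := hw'
    exacts [h₁ h, h₄ h, h₂ h.symm, h₃ h]

/-- The rational parametrization of the unit circle. -/
noncomputable def circlePoint (x : ℝ) : ℂ := ⟨(1 - x ^ 2) / (1 + x ^ 2), 2 * x / (1 + x ^ 2)⟩

/-- An affine form that vanishes on the line through two points of the circle. -/
noncomputable def chordForm (a b : ℝ) (z : ℂ) : ℝ :=
  (1 + a * b) / 2 + (a * b - 1) / 2 * z.re - (a + b) / 2 * z.im

/-- The sign on the circle thus tells whether the parameter `x` lies between `a` and `b`, which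
links the geometry to the order. -/
theorem chordForm_circlePoint (a b x : ℝ) :
    chordForm a b (circlePoint x) = (x - a) * (x - b) / (1 + x ^ 2) := by
  have : (1 + x ^ 2) ≠ 0 := by positivity
  simp only [chordForm, circlePoint]
  field_simp
  ring

theorem chordForm_lineMap (a b : ℝ) (z w : ℂ) (t : ℝ) :
    chordForm a b (AffineMap.lineMap z w t) = (1 - t) * chordForm a b z + t * chordForm a b w := by
  simp only [chordForm, AffineMap.lineMap_apply_module', Complex.add_re, Complex.add_im,
    Complex.real_smul, Complex.re_ofReal_mul, Complex.im_ofReal_mul, Complex.sub_re, Complex.sub_im]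
  ring

theorem norm_circlePoint (x : ℝ) : ‖circlePoint x‖ = 1 := by
  have : (1 + x ^ 2) ≠ 0 := by positivity
  rw [Complex.norm_def, Real.sqrt_eq_one, Complex.normSq_apply]
  simp only [circlePoint]
  field_simp
  ring

theorem circlePoint_injective : Function.Injective circlePoint := by
  intro x y h
  have := chordForm_circlePoint y y x
  rw [h, chordForm_circlePoint, sub_self, zero_mul, zero_div, eq_comm, div_eq_zero_iff] at this
  obtain h | h := this
  · exact sub_eq_zero.1 (mul_self_eq_zero.1 h)
  · exact absurd h (by positivity)

/-- A noncrossing order gives an embedding by straight chords. -/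
theorem NoncrossingOn.isOuterplanar {f : V → ℝ} (hf : NoncrossingOn G f Set.univ) :
    IsOuterplanar G := by
  have hinj : Function.Injective f := fun x y h => hf.injOn trivial trivial h
  have hpinj : Function.Injective fun v => circlePoint (f v) := circlePoint_injective.comp hinj
  have hadj : ∀ e : G.edgeSet, G.Adj e.1.out.1 e.1.out.2 := fun e => by
    have := e.2
    rwa [← Quot.out_eq e.1] at this
  have hmem : ∀ (e : G.edgeSet) (v : V), v ∈ e.1 ↔ v = e.1.out.1 ∨ v = e.1.out.2 := fun e v => by
    conv_lhs => rw [← Quot.out_eq e.1]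
    exact Sym2.mem_iff
  have hzero : ∀ a b x, chordForm (f a) (f b) (circlePoint (f x)) = 0 ↔ x = a ∨ x = b := by
    intro a b x
    have : (1 + f x ^ 2) ≠ 0 := by positivity
    rw [chordForm_circlePoint, div_eq_zero_iff, or_iff_left this, mul_eq_zero, sub_eq_zero,
      sub_eq_zero, hinj.eq_iff, hinj.eq_iff]
  have hline : ∀ a b (t : ℝ), chordForm (f a) (f b)
      (AffineMap.lineMap (circlePoint (f a)) (circlePoint (f b)) t) = 0 := by
    intro a b t
    rw [chordForm_lineMap, (hzero a b a).2 (.inl rfl), (hzero a b b).2 (.inr rfl)]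
    ring
  refine ⟨⟨fun v => circlePoint (f v), fun e => ⟨fun t => AffineMap.lineMap
    (circlePoint (f e.1.out.1)) (circlePoint (f e.1.out.2)) (t : ℝ), by fun_prop⟩, hpinj,
    fun v => by simp [norm_circlePoint], ?_, ?_, ?_, ?_, ?_⟩⟩
  · intro e s t hst
    exact Subtype.ext (AffineMap.lineMap_injective ℝ (hpinj.ne (hadj e).ne) hst)
  · intro e t
    refine (convex_closedBall (0 : ℂ) 1).segment_subset (x := circlePoint (f e.1.out.1))
      (y := circlePoint (f e.1.out.2)) ?_ ?_ ?_
    · simp [norm_circlePoint]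
    · simp [norm_circlePoint]
    · rw [segment_eq_image_lineMap]
      exact ⟨t, t.2, rfl⟩
  · intro e
    conv_rhs => rw [← Quot.out_eq e.1]
    simp only [ContinuousMap.coe_mk, Set.Icc.coe_zero, Set.Icc.coe_one, AffineMap.lineMap_apply_zero,
      AffineMap.lineMap_apply_one]
    rfl
  · rintro e w ⟨t, ht⟩
    rw [hmem, ← hzero, ← ht]
    exact hline _ _ _
  · rintro e e' hne z ⟨⟨s, rfl⟩, ⟨t, ht⟩⟩
    -- The affine form of the first chord vanishes at the common point, so a weighted mean of its
    -- values at the ends `c` and `d` of the second chord is zero.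
    have hz := hline e.1.out.1 e.1.out.2 s
    simp only [ContinuousMap.coe_mk] at ht ⊢
    rw [← ht, chordForm_lineMap] at hz
    have hab := hadj e
    have hcd := hadj e'
    have hea : e.1 = s(e.1.out.1, e.1.out.2) := (Quot.out_eq e.1).symm
    have hec : e'.1 = s(e'.1.out.1, e'.1.out.2) := (Quot.out_eq e'.1).symm
    simp only [hmem]
    rw [← ht]
    have hne' : e.1 ≠ e'.1 := fun h => hne (Subtype.ext h)
    rw [hea, hec] at hne'
    clear ht hea hec
    generalize e.1.out.1 = a at *
    generalize e.1.out.2 = b at *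
    generalize e'.1.out.1 = c at *
    generalize e'.1.out.2 = d at *
    have ht0 := t.2.1
    have ht1 := t.2.2
    by_cases hc : c = a ∨ c = b
    · by_cases hd : d = a ∨ d = b
      · exfalso
        apply hne'
        have := hcd.ne
        rw [Sym2.eq_iff]
        grind
      · rw [(hzero a b c).2 hc, mul_zero, zero_add, mul_eq_zero,
          or_iff_left (fun h => hd ((hzero a b d).1 h))] at hz
        refine ⟨c, hc, .inl rfl, ?_⟩
        rw [hz, AffineMap.lineMap_apply_zero]
    · by_cases hd : d = a ∨ d = b
      · rw [(hzero a b d).2 hd, mul_zero, add_zero, mul_eq_zero,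
          or_iff_left (fun h => hc ((hzero a b c).1 h)), sub_eq_zero] at hz
        refine ⟨d, hd, .inr rfl, ?_⟩
        rw [← hz, AffineMap.lineMap_apply_one]
      · exfalso
        -- If no end is shared, noncrossing puts `c` and `d` strictly on the same side of the first
        -- chord, so the weighted mean cannot vanish.
        have key : ∀ {p q c d : V}, G.Adj p q → G.Adj c d → f p < f q → f p < f c → f c < f q →
            d ≠ p → d ≠ q → f p < f d ∧ f d < f q := by
          intro p q c d hpq hcd h h₁ h₂ h₃ h₄
          by_contra hcon
          have h₃ := hinj.ne h₃
          have h₄ := hinj.ne h₄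
          by_cases hdp : f p < f d
          · exact hf.not_cross p trivial c trivial q trivial d trivial h₁ h₂
              (lt_of_le_of_ne (not_lt.1 fun h => hcon ⟨hdp, h⟩) h₄.symm) hpq hcd
          · exact hf.not_cross d trivial p trivial c trivial q trivial
              (lt_of_le_of_ne (not_lt.1 hdp) h₃) h₁ h₂ hcd.symm hpq
        have sign : ∀ {p q : V}, G.Adj p q → f p < f q → c ≠ p → c ≠ q → d ≠ p → d ≠ q →
            0 < (f c - f p) * (f c - f q) * ((f d - f p) * (f d - f q)) := by
          intro p q hpq h h₁ h₂ h₃ h₄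
          by_cases hin : f p < f c ∧ f c < f q
          · have := key hpq hcd h hin.1 hin.2 h₃ h₄
            exact mul_pos_of_neg_of_neg (mul_neg_of_pos_of_neg (by linarith) (by linarith))
              (mul_neg_of_pos_of_neg (by linarith) (by linarith))
          · have hin' : ¬ (f p < f d ∧ f d < f q) := fun h' =>
              hin (key hpq hcd.symm h h'.1 h'.2 h₁ h₂)
            have pos : ∀ x : ℝ, x ≠ f p → x ≠ f q → ¬ (f p < x ∧ x < f q) →
                0 < (x - f p) * (x - f q) := by
              intro x hxp hxq hx
              obtain hlt | hlt := lt_or_gt_of_ne hxp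
              · exact mul_pos_of_neg_of_neg (by linarith) (by linarith)
              · have := lt_of_le_of_ne (not_lt.1 fun h => hx ⟨hlt, h⟩) hxq.symm
                exact mul_pos (by linarith) (by linarith)
            exact mul_pos (pos _ (hinj.ne h₁) (hinj.ne h₂) hin) (pos _ (hinj.ne h₃) (hinj.ne h₄) hin')
        push Not at hc hd
        have hsign : 0 < chordForm (f a) (f b) (circlePoint (f c)) *
            chordForm (f a) (f b) (circlePoint (f d)) := by
          rw [chordForm_circlePoint, chordForm_circlePoint, div_mul_div_comm]
          refine div_pos ?_ (by positivity)
          obtain h | h := lt_or_gt_of_ne (hinj.ne hab.ne)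
          · exact sign hab h hc.1 hc.2 hd.1 hd.2
          · rw [mul_comm (f c - f a), mul_comm (f d - f a)]
            exact sign hab.symm h hc.2 hc.1 hd.2 hd.1
        generalize chordForm (f a) (f b) (circlePoint (f c)) = x at hz hsign
        generalize chordForm (f a) (f b) (circlePoint (f d)) = y at hz hsign
        have h₁ : (1 - (t : ℝ)) * x ^ 2 + t * (x * y) = 0 := by linear_combination x * hz
        have h₂ : 0 ≤ (1 - (t : ℝ)) * x ^ 2 := mul_nonneg (by linarith) (sq_nonneg x)
        have h₃ : 0 ≤ (t : ℝ) * (x * y) := mul_nonneg ht0 hsign.le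
        have h₄ : (t : ℝ) = 0 :=
          (mul_eq_zero.1 (by linarith : (t : ℝ) * (x * y) = 0)).resolve_right hsign.ne'
        rw [h₄] at hz
        have : x = 0 := by linarith
        simp [this] at hsign

theorem isOuterplanar_iff : IsOuterplanar G ↔ ∃ f, NoncrossingOn G f Set.univ :=
  ⟨fun ⟨E⟩ => ⟨_, E.noncrossingOn⟩, fun ⟨_, hf⟩ => hf.isOuterplanar⟩

end Embedding

/-! ### Connected sets of vertices -/

section Connected

variable {V : Type u} {G H : SimpleGraph V} {A B C : Set V}

/-- `A` is nonempty and cannot be split without cutting an edge inside `A`. -/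
def IsConn (G : SimpleGraph V) (A : Set V) : Prop :=
  A.Nonempty ∧ ∀ P : Set V, (∃ a ∈ A, a ∈ P) → (∃ b ∈ A, b ∉ P) →
    ∃ u ∈ A, ∃ v ∈ A, G.Adj u v ∧ u ∈ P ∧ v ∉ P

/-- There is an edge between `A` and `B`. -/
def Touch (G : SimpleGraph V) (A B : Set V) : Prop := ∃ a ∈ A, ∃ b ∈ B, G.Adj a b

theorem Touch.symm (h : Touch G A B) : Touch G B A := by
  obtain ⟨a, ha, b, hb, hab⟩ := h
  exact ⟨b, hb, a, ha, hab.symm⟩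

theorem Touch.mono (h : Touch G A B) {A' B' : Set V} (hA : A ⊆ A') (hB : B ⊆ B') :
    Touch G A' B' := by
  obtain ⟨a, ha, b, hb, hab⟩ := h
  exact ⟨a, hA ha, b, hB hb, hab⟩

theorem Touch.of_le (hHG : H ≤ G) (h : Touch H A B) : Touch G A B := by
  obtain ⟨a, ha, b, hb, hab⟩ := h
  exact ⟨a, ha, b, hb, hHG hab⟩

theorem IsConn.of_adj (h : IsConn H A) (hHG : ∀ u ∈ A, ∀ v ∈ A, H.Adj u v → G.Adj u v) :
    IsConn G A := by
  refine ⟨h.1, fun P ha hb => ?_⟩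
  obtain ⟨u, hu, v, hv, huv, h'⟩ := h.2 P ha hb
  exact ⟨u, hu, v, hv, hHG u hu v hv huv, h'⟩

theorem IsConn.of_le (hHG : H ≤ G) (h : IsConn H A) : IsConn G A :=
  h.of_adj fun _ _ _ _ h => hHG h

theorem isConn_singleton (v : V) : IsConn G {v} := by
  refine ⟨⟨v, rfl⟩, ?_⟩
  rintro P ⟨a, rfl, ha⟩ ⟨b, rfl, hb⟩
  exact (hb ha).elim

theorem isConn_iff_connected : IsConn G A ↔ (G.induce A).Connected := by
  constructor
  · rintro ⟨⟨a, ha⟩, h⟩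
    rw [SimpleGraph.connected_iff_exists_forall_reachable]
    refine ⟨⟨a, ha⟩, fun b => ?_⟩
    by_contra hb
    obtain ⟨u, hu, v, hv, huv, ⟨hu', h₁⟩, h₂⟩ :=
      h {v | ∃ hv : v ∈ A, (G.induce A).Reachable ⟨a, ha⟩ ⟨v, hv⟩}
        ⟨a, ha, ha, .refl _⟩ ⟨b, b.2, fun ⟨_, h⟩ => hb h⟩
    exact h₂ ⟨hv, h₁.trans (SimpleGraph.Adj.reachable (G := G.induce A) huv)⟩
  · intro h
    obtain ⟨⟨a, ha⟩⟩ := h.nonempty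
    refine ⟨⟨a, ha⟩, ?_⟩
    rintro P ⟨b, hb, hbP⟩ ⟨c, hc, hcP⟩
    obtain ⟨p⟩ := h.preconnected ⟨b, hb⟩ ⟨c, hc⟩
    obtain ⟨d, -, h₁, h₂⟩ := p.exists_boundary_dart (Subtype.val ⁻¹' P) hbP hcP
    exact ⟨d.fst, d.fst.2, d.snd, d.snd.2, d.adj, h₁, h₂⟩

theorem IsConn.union_of_touch (hA : IsConn G A) (hB : IsConn G B) (h : Touch G A B) :
    IsConn G (A ∪ B) := by
  refine ⟨hA.1.mono Set.subset_union_left, ?_⟩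
  intro P ha hb
  by_cases hA₁ : ∃ a ∈ A, a ∈ P
  · by_cases hA₂ : ∃ a ∈ A, a ∉ P
    · obtain ⟨u, hu, v, hv, h'⟩ := hA.2 P hA₁ hA₂
      exact ⟨u, .inl hu, v, .inl hv, h'⟩
    · by_cases hB₁ : ∃ b ∈ B, b ∈ P
      · have hB₂ : ∃ b ∈ B, b ∉ P := by
          obtain ⟨b, hb | hb, hbP⟩ := hb
          · exact (hA₂ ⟨b, hb, hbP⟩).elim
          · exact ⟨b, hb, hbP⟩
        obtain ⟨u, hu, v, hv, h'⟩ := hB.2 P hB₁ hB₂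
        exact ⟨u, .inr hu, v, .inr hv, h'⟩
      · push Not at hA₂ hB₁
        obtain ⟨a, ha, b, hb, hab⟩ := h
        exact ⟨a, .inl ha, b, .inr hb, hab, hA₂ a ha, hB₁ b hb⟩
  · have hB₁ : ∃ b ∈ B, b ∈ P := by
      obtain ⟨a, ha | ha, haP⟩ := ha
      · exact (hA₁ ⟨a, ha, haP⟩).elim
      · exact ⟨a, ha, haP⟩
    by_cases hB₂ : ∃ b ∈ B, b ∉ P
    · obtain ⟨u, hu, v, hv, h'⟩ := hB.2 P hB₁ hB₂
      exact ⟨u, .inr hu, v, .inr hv, h'⟩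
    · push Not at hA₁ hB₂
      obtain ⟨a, ha, b, hb, hab⟩ := h
      exact ⟨b, .inr hb, a, .inl ha, hab.symm, hB₂ b hb, hA₁ a ha⟩

theorem IsConn.insert (hA : IsConn G A) {v w : V} (hv : v ∈ A) (hvw : G.Adj v w) :
    IsConn G (A ∪ {w}) :=
  hA.union_of_touch (isConn_singleton w) ⟨v, hv, w, rfl, hvw⟩

theorem IsConn.union_of_mem (hA : IsConn G A) (hB : IsConn G B) {c : V} (hcA : c ∈ A)
    (hcB : c ∈ B) : IsConn G (A ∪ B) := by
  refine ⟨hA.1.mono Set.subset_union_left, ?_⟩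
  rintro P ⟨a, ha, haP⟩ ⟨b, hb, hbP⟩
  by_cases hc : c ∈ P
  · obtain hb | hb := hb
    · obtain ⟨u, hu, v, hv, h⟩ := hA.2 P ⟨c, hcA, hc⟩ ⟨b, hb, hbP⟩
      exact ⟨u, .inl hu, v, .inl hv, h⟩
    · obtain ⟨u, hu, v, hv, h⟩ := hB.2 P ⟨c, hcB, hc⟩ ⟨b, hb, hbP⟩
      exact ⟨u, .inr hu, v, .inr hv, h⟩
  · obtain ha | ha := ha
    · obtain ⟨u, hu, v, hv, h⟩ := hA.2 P ⟨a, ha, haP⟩ ⟨c, hcA, hc⟩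
      exact ⟨u, .inl hu, v, .inl hv, h⟩
    · obtain ⟨u, hu, v, hv, h⟩ := hB.2 P ⟨a, ha, haP⟩ ⟨c, hcB, hc⟩
      exact ⟨u, .inr hu, v, .inr hv, h⟩

/-- The vertices that can be reached from `s` inside `A`. -/
def comp (G : SimpleGraph V) (A : Set V) (s : V) : Set V :=
  {v | Relation.ReflTransGen (fun u v => G.Adj u v ∧ v ∈ A) s v}

theorem mem_comp_self (s : V) : s ∈ comp G A s := Relation.ReflTransGen.refl

theorem comp_subset {s : V} (hs : s ∈ A) : comp G A s ⊆ A := by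
  intro v hv
  induction hv with
  | refl => exact hs
  | tail _ h _ => exact h.2

theorem mem_comp_of_adj {s v w : V} (hv : v ∈ comp G A s) (hw : w ∈ A) (hvw : G.Adj v w) :
    w ∈ comp G A s :=
  Relation.ReflTransGen.tail hv ⟨hvw, hw⟩

theorem comp_subset_of_closed {s : V} {P : Set V} (hs : s ∈ P)
    (hP : ∀ v ∈ P, ∀ w ∈ A, G.Adj v w → w ∈ P) : comp G A s ⊆ P := by
  intro v hv
  induction hv with
  | refl => exact hs
  | tail _ h ih => exact hP _ ih _ h.2 h.1

theorem isConn_comp (s : V) : IsConn G (comp G A s) := by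
  have key : ∀ v ∈ comp G A s, ∃ C ⊆ comp G A s, IsConn G C ∧ s ∈ C ∧ v ∈ C := by
    intro v hv
    induction hv with
    | refl =>
      exact ⟨{s}, by simpa using mem_comp_self s, isConn_singleton s, rfl, rfl⟩
    | tail hv h ih =>
      obtain ⟨C, hC, hconn, hs, hv'⟩ := ih
      refine ⟨C ∪ {_}, Set.union_subset hC ?_, hconn.insert hv' h.1, .inl hs, .inr rfl⟩
      rintro _ rfl
      exact mem_comp_of_adj (hC hv') h.2 h.1
  refine ⟨⟨s, mem_comp_self s⟩, ?_⟩
  rintro P ⟨a, ha, haP⟩ ⟨b, hb, hbP⟩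
  obtain ⟨C, hC, hconn, hsC, haC⟩ := key a ha
  obtain ⟨D, hD, hconn', hsD, hbD⟩ := key b hb
  obtain ⟨u, hu, v, hv, h⟩ := (hconn.union_of_mem hconn' hsC hsD).2 P ⟨a, .inl haC, haP⟩
    ⟨b, .inr hbD, hbP⟩
  exact ⟨u, Set.union_subset hC hD hu, v, Set.union_subset hC hD hv, h⟩

theorem IsConn.subset_comp (hC : IsConn G C) (hCA : C ⊆ A) {s v : V} (hv : v ∈ C)
    (hv' : v ∈ comp G A s) : C ⊆ comp G A s := by
  by_contra hsub
  obtain ⟨w, hw, hw'⟩ := Set.not_subset.1 hsub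
  obtain ⟨x, -, y, hy, hxy, hx', hy'⟩ := hC.2 (comp G A s) ⟨v, hv, hv'⟩ ⟨w, hw, hw'⟩
  exact hy' (mem_comp_of_adj hx' (hCA hy) hxy)

theorem mem_comp_symm {s t : V} (hs : s ∈ A) (h : t ∈ comp G A s) : s ∈ comp G A t :=
  (isConn_comp s).subset_comp (comp_subset hs) h (mem_comp_self t) (mem_comp_self s)

end Connected

/-! ### Two disjoint connections -/

section Menger

variable {V : Type u} {G H : SimpleGraph V}

/-- Edges leave `U ∪ {c}` only at `c`. A cut of the intersection therefore extends to a cut of `X`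
that puts everything outside `U ∪ {c}` on the side of `c`. -/
theorem isConn_inter_of_closed {H : SimpleGraph V} {X U : Set V} {c : V} (hX : IsConn H X)
    (hc : c ∈ X) (hU : ∀ v ∈ U, ∀ w, w ≠ c → H.Adj v w → w ∈ U) :
    IsConn H (X ∩ (U ∪ {c})) := by
  refine ⟨⟨c, hc, .inr rfl⟩, ?_⟩
  rintro P ⟨a, ⟨haX, haU⟩, haP⟩ ⟨b, ⟨hbX, hbU⟩, hbP⟩
  obtain ⟨u, hu, v, hv, huv, huP, hvP⟩ := hX.2
    {v | (v ∈ U ∪ {c} ∧ v ∈ P) ∨ (v ∉ U ∪ {c} ∧ c ∈ P)} ⟨a, haX, .inl ⟨haU, haP⟩⟩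
    ⟨b, hbX, by rintro (h | h); exacts [hbP h.2, h.1 hbU]⟩
  have key : ∀ x y, H.Adj x y → x ∈ U ∪ {c} → y ∉ U ∪ {c} → x = c := by
    rintro x y hxy (hx | hx) hy
    · by_contra
      exact hy (.inl (hU x hx y (fun h => hy (.inr h)) hxy))
    · exact hx
  obtain ⟨huU, huP⟩ | ⟨huU, hcP⟩ := huP
  · by_cases hvU : v ∈ U ∪ {c}
    · exact ⟨u, ⟨hu, huU⟩, v, ⟨hv, hvU⟩, huv, huP, fun h => hvP (.inl ⟨hvU, h⟩)⟩
    · obtain rfl := key u v huv huU hvU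
      exact (hvP (.inr ⟨hvU, huP⟩)).elim
  · by_cases hvU : v ∈ U ∪ {c}
    · obtain rfl := key v u huv.symm hvU huU
      exact (hvP (.inl ⟨hvU, hcP⟩)).elim
    · exact (hvP (.inr ⟨hvU, hcP⟩)).elim

/-- `X` is a connected set that meets `S` and `T`. -/
def Joins (H : SimpleGraph V) (S T X : Set V) : Prop :=
  IsConn H X ∧ (∃ s ∈ X, s ∈ S) ∧ ∃ t ∈ X, t ∈ T

theorem Joins.symm {S T X : Set V} (h : Joins H S T X) : Joins H T S X := ⟨h.1, h.2.2, h.2.1⟩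

/-- The vertices that can be joined to `S` without using `c`. -/
def side (H : SimpleGraph V) (S : Set V) (c : V) : Set V :=
  {v | ∃ X, Joins H S {v} X ∧ c ∉ X}

theorem subset_side {S X : Set V} {c : V} (hX : IsConn H X) (hS : ∃ s ∈ X, s ∈ S) (hc : c ∉ X) :
    X ⊆ side H S c := fun v hv => ⟨X, ⟨hX, hS, v, hv, rfl⟩, hc⟩

theorem mem_side_of_adj {S : Set V} {c v w : V} (hv : v ∈ side H S c) (hw : w ≠ c)
    (hvw : H.Adj v w) : w ∈ side H S c := by
  obtain ⟨X, ⟨hX, ⟨s, hs, hsS⟩, v', hv', rfl⟩, hc⟩ := hv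
  refine ⟨X ∪ {w}, ⟨hX.insert hv' hvw, ⟨s, .inl hs, hsS⟩, w, .inr rfl, rfl⟩, ?_⟩
  rintro (h | h)
  exacts [hc h, hw h.symm]

/-- One half of the induction step of Menger's theorem. -/
theorem exists_joins_of_separated {H' : SimpleGraph V} {S T : Set V} {c x y : V}
    (hHH : ∀ u v, H.Adj u v → H'.Adj u v ∨ u = x ∧ v = y ∨ u = y ∧ v = x)
    (hsep : ∀ X, Joins H' S T X → c ∈ X) (hy : y ∉ side H' S c)
    (h : ∀ z, ∃ X, Joins H S T X ∧ z ∉ X) (z : V) : ∃ X, Joins H' S {c, x} X ∧ z ∉ X := by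
  obtain ⟨X, ⟨hX, ⟨s, hs, hsS⟩, t, ht, htT⟩, hz⟩ := h z
  -- The part of `X` reachable from `s` in `H'` must reach `c` or `x`. Otherwise it misses `t` by
  -- the separation property, and leaving it would need the edge `xy`, which would put `x` or `y` in
  -- it; yet `y` is not on the side of `S`.
  have hKX : comp H' X s ⊆ X := comp_subset hs
  refine ⟨comp H' X s, ⟨isConn_comp s, ⟨s, mem_comp_self s, hsS⟩, ?_⟩, fun h => hz (hKX h)⟩
  by_contra hcx
  have hc : c ∉ comp H' X s := fun h => hcx ⟨c, h, .inl rfl⟩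
  have hx : x ∉ comp H' X s := fun h => hcx ⟨x, h, .inr rfl⟩
  have hK := subset_side (isConn_comp s) ⟨s, mem_comp_self s, hsS⟩ hc
  have htK : t ∉ comp H' X s := fun h =>
    hc (hsep _ ⟨isConn_comp s, ⟨s, mem_comp_self s, hsS⟩, t, h, htT⟩)
  obtain ⟨u, -, v, hv, huv, huK, hvK⟩ := hX.2 (comp H' X s) ⟨s, hs, mem_comp_self s⟩ ⟨t, ht, htK⟩
  obtain h | ⟨rfl, rfl⟩ | ⟨rfl, rfl⟩ := hHH u v huv
  · exact hvK (mem_comp_of_adj huK hv h)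
  · exact hx huK
  · exact hy (hK huK)

/-- One connection ends at `c` and the other at `x`. Trimming the first to the side of `S` ensures
that the halves coming from `S` and from `T` overlap at most in `c`. -/
theorem exists_joins_pair {H' : SimpleGraph V} {S : Set V} {c x : V} (hcx : c ≠ x)
    (h : ∃ X Y, Joins H' S {c, x} X ∧ Joins H' S {c, x} Y ∧ Disjoint X Y) :
    ∃ X Y, IsConn H' X ∧ IsConn H' Y ∧ (∃ s ∈ X, s ∈ S) ∧ (∃ s ∈ Y, s ∈ S) ∧ c ∈ X ∧ x ∈ Y ∧
      c ∉ Y ∧ Disjoint X Y ∧ X ⊆ side H' S c ∪ {c} ∧ Y ⊆ side H' S c := by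
  obtain ⟨X, Y, hXc, hYx, hX, hY, hXS, hYS, hXY⟩ : ∃ X Y, c ∈ X ∧ x ∈ Y ∧ IsConn H' X ∧
      IsConn H' Y ∧ (∃ s ∈ X, s ∈ S) ∧ (∃ s ∈ Y, s ∈ S) ∧ Disjoint X Y := by
    obtain ⟨X, Y, ⟨hX, hXS, p, hp, hpX⟩, ⟨hY, hYS, q, hq, hqY⟩, hXY⟩ := h
    obtain rfl | rfl := hpX <;> obtain rfl | rfl := hqY
    · exact (Set.disjoint_left.1 hXY hp hq).elim
    · exact ⟨X, Y, hp, hq, hX, hY, hXS, hYS, hXY⟩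
    · exact ⟨Y, X, hq, hp, hY, hX, hYS, hXS, hXY.symm⟩
    · exact (Set.disjoint_left.1 hXY hp hq).elim
  have hcY : c ∉ Y := Set.disjoint_left.1 hXY hXc
  have hYU := subset_side hY hYS hcY
  refine ⟨X ∩ (side H' S c ∪ {c}), Y, isConn_inter_of_closed hX hXc
    (fun v hv w hw hvw => mem_side_of_adj hv hw hvw), hY, ?_, hYS, ⟨hXc, .inr rfl⟩, hYx, hcY,
    hXY.mono_left Set.inter_subset_left, Set.inter_subset_right, hYU⟩
  obtain ⟨s, hs, hsS⟩ := hXS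
  refine ⟨s, ⟨hs, ?_⟩, hsS⟩
  by_cases hsc : s = c
  · exact .inr hsc
  · exact .inl (subset_side (isConn_singleton s) ⟨s, rfl, hsS⟩ (fun h => hsc h.symm) rfl)

/-- Menger's theorem for two disjoint connections. -/
theorem exists_disjoint_joins [Finite V] [Nonempty V] (H : SimpleGraph V) (S T : Set V)
    (h : ∀ z, ∃ X, Joins H S T X ∧ z ∉ X) :
    ∃ X Y, Joins H S T X ∧ Joins H S T Y ∧ Disjoint X Y := by
  induction hn : H.edgeSet.ncard using Nat.strong_induction_on generalizing H S T with
  | _ n ih =>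
  by_cases hedge : ∃ x y, H.Adj x y
  · obtain ⟨x, y, hxy⟩ := hedge
    set H' := H.deleteEdges {s(x, y)} with hH'
    have hle : H' ≤ H := SimpleGraph.deleteEdges_le _
    have hlt : H'.edgeSet.ncard < n := by
      rw [← hn, hH', SimpleGraph.edgeSet_deleteEdges]
      exact Set.ncard_lt_ncard (Set.sdiff_singleton_ssubset.2 hxy)
    have hHH : ∀ u v, H.Adj u v → H'.Adj u v ∨ u = x ∧ v = y ∨ u = y ∧ v = x := by
      intro u v huv
      rw [hH', SimpleGraph.deleteEdges_adj]
      by_cases he : s(u, v) = s(x, y)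
      · exact .inr (Sym2.eq_iff.1 he)
      · exact .inl ⟨huv, he⟩
    have hmono : ∀ {S T X}, Joins H' S T X → Joins H S T X := fun h => ⟨h.1.of_le hle, h.2⟩
    -- If deleting `xy` destroys the hypothesis, some `c` meets every connection in `H'`, and the
    -- sides of `S` and `T` without `c` are disjoint.
    by_cases hgood : ∀ z, ∃ X, Joins H' S T X ∧ z ∉ X
    · obtain ⟨X, Y, hX, hY, hXY⟩ := ih _ hlt H' S T hgood rfl
      exact ⟨X, Y, hmono hX, hmono hY, hXY⟩
    push Not at hgood
    obtain ⟨c, hc⟩ := hgood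
    have hdisj : ∀ v, v ∈ side H' S c → v ∉ side H' T c := by
      rintro v ⟨X, ⟨hX, ⟨s, hs, hsS⟩, v', hv', rfl⟩, hcX⟩ ⟨Y, ⟨hY, ⟨t, ht, htT⟩, v', hv'', rfl⟩, hcY⟩
      obtain h | h := hc (X ∪ Y) ⟨hX.union_of_mem hY hv' hv'', ⟨s, .inl hs, hsS⟩, t, .inr ht, htT⟩
      exacts [hcX h, hcY h]
    obtain ⟨X, ⟨hX, ⟨s, hs, hsS⟩, t, ht, htT⟩, hcX⟩ := h c
    have hsc : s ∈ side H' S c := subset_side (isConn_singleton s) ⟨s, rfl, hsS⟩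
      (fun h : c ∈ ({s} : Set V) => hcX ((Set.mem_singleton_iff.1 h).symm ▸ hs)) rfl
    have htc : t ∈ side H' T c := subset_side (isConn_singleton t) ⟨t, rfl, htT⟩
      (fun h : c ∈ ({t} : Set V) => hcX ((Set.mem_singleton_iff.1 h).symm ▸ ht)) rfl
    have main : ∀ x y, H.Adj x y →
        (∀ u v, H.Adj u v → H'.Adj u v ∨ u = x ∧ v = y ∨ u = y ∧ v = x) →
        x ∈ side H' S c → y ∈ side H' T c →
        ∃ X Y, Joins H S T X ∧ Joins H S T Y ∧ Disjoint X Y := by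
      intro x y hxy hHH hx hy
      have hne : ∀ {S v}, v ∈ side H' S c → c ≠ v := by
        rintro S v ⟨X, ⟨-, -, v', hv', rfl⟩, hcX⟩ rfl
        exact hcX hv'
      -- The induction hypothesis joins `S` to `{c, x}` and `T` to `{c, y}`. One pair of halves is
      -- merged at `c`, the other across the edge `xy`.
      obtain ⟨X₁, Y₁, hX₁, hY₁, hX₁S, hY₁S, hcX₁, hxY₁, hcY₁, hd₁, hs₁, ht₁⟩ :=
        exists_joins_pair (hne hx) (ih _ hlt H' S {c, x} (exists_joins_of_separated hHH hc
          (fun h => hdisj y h hy) h) rfl)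
      obtain ⟨X₂, Y₂, hX₂, hY₂, hX₂T, hY₂T, hcX₂, hyY₂, hcY₂, hd₂, hs₂, ht₂⟩ :=
        exists_joins_pair (hne hy) (ih _ hlt H' T {c, y} (exists_joins_of_separated
          (fun u v huv => (hHH u v huv).imp id fun h => h.symm.imp id id)
          (fun X hX => hc X hX.symm) (fun h => hdisj x hx h)
          (fun z => (h z).imp fun X hX => ⟨hX.1.symm, hX.2⟩)) rfl)
      obtain ⟨s₁, hs₁', hs₁S⟩ := hX₁S
      obtain ⟨s₂, hs₂', hs₂S⟩ := hY₁S
      obtain ⟨t₁, ht₁', ht₁T⟩ := hX₂T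
      obtain ⟨t₂, ht₂', ht₂T⟩ := hY₂T
      refine ⟨X₁ ∪ X₂, Y₁ ∪ Y₂, ⟨((hX₁.union_of_mem hX₂ hcX₁ hcX₂).of_le hle), ⟨s₁, .inl hs₁', hs₁S⟩,
        t₁, .inr ht₁', ht₁T⟩, ⟨(hY₁.of_le hle).union_of_touch (hY₂.of_le hle) ⟨x, hxY₁, y, hyY₂, hxy⟩,
        ⟨s₂, .inl hs₂', hs₂S⟩, t₂, .inr ht₂', ht₂T⟩, ?_⟩
      rw [Set.disjoint_left]
      rintro v (hv | hv) (hv' | hv')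
      · exact Set.disjoint_left.1 hd₁ hv hv'
      · obtain h | rfl := hs₁ hv
        · exact hdisj v h (ht₂ hv')
        · exact hcY₂ hv'
      · obtain h | rfl := hs₂ hv
        · exact hdisj v (ht₁ hv') h
        · exact hcY₁ hv'
      · exact Set.disjoint_left.1 hd₂ hv hv'
    -- A connection avoiding `c` can leave either side only along `xy`, so one end of this edge is
    -- on the side of `S` and the other on that of `T`.
    obtain ⟨u, hu, v, hv, huv, huS, hvS⟩ := hX.2 (side H' S c) ⟨s, hs, hsc⟩
      ⟨t, ht, fun h => hdisj t h htc⟩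
    obtain ⟨p, hp, q, hq, hpq, hpT, hqT⟩ := hX.2 (side H' T c) ⟨t, ht, htc⟩
      ⟨s, hs, hdisj s hsc⟩
    have e₁ : u = x ∧ v = y ∨ u = y ∧ v = x := (hHH u v huv).resolve_left fun h =>
      hvS (mem_side_of_adj huS (fun h => hcX (h ▸ hv)) h)
    have e₂ : p = x ∧ q = y ∨ p = y ∧ q = x := (hHH p q hpq).resolve_left fun h =>
      hqT (mem_side_of_adj hpT (fun h => hcX (h ▸ hq)) h)
    obtain ⟨rfl, rfl⟩ | ⟨rfl, rfl⟩ := e₁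
    · refine main u v hxy hHH huS ?_
      obtain ⟨rfl, rfl⟩ | ⟨rfl, rfl⟩ := e₂
      · exact (hdisj _ huS hpT).elim
      · exact hpT
    · refine main u v hxy.symm (fun a b hab => (hHH a b hab).imp id Or.symm) huS ?_
      obtain ⟨rfl, rfl⟩ | ⟨rfl, rfl⟩ := e₂
      · exact hpT
      · exact (hdisj _ huS hpT).elim
  · push Not at hedge
    have hsing : ∀ X, Joins H S T X → ∃ x ∈ X, x ∈ S ∧ x ∈ T := by
      rintro X ⟨hX, ⟨s, hs, hsS⟩, t, ht, htT⟩
      by_cases hst : t = s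
      · exact ⟨s, hs, hsS, hst ▸ htT⟩
      · obtain ⟨u, -, v, -, huv, -⟩ := hX.2 {s} ⟨s, hs, rfl⟩ ⟨t, ht, hst⟩
        exact (hedge u v huv).elim
    have hjoin : ∀ x, x ∈ S → x ∈ T → Joins H S T {x} := fun x hS hT =>
      ⟨isConn_singleton x, ⟨x, rfl, hS⟩, x, rfl, hT⟩
    obtain ⟨X, hX, -⟩ := h (Classical.arbitrary V)
    obtain ⟨x, -, hxS, hxT⟩ := hsing X hX
    obtain ⟨Y, hY, hxY⟩ := h x
    obtain ⟨y, hy, hyS, hyT⟩ := hsing Y hY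
    refine ⟨{x}, {y}, hjoin x hxS hxT, hjoin y hyS hyT, ?_⟩
    rw [Set.disjoint_singleton]
    rintro rfl
    exact hxY hy

end Menger

/-! ### Minors of outerplanar graphs -/

section Minor

variable {V W : Type u} {G : SimpleGraph V} {H : SimpleGraph W}

/-- A connected set that avoids `u` and `v` can pass from inside the edge `uv` to outside only along
an edge that crosses `uv`. -/
theorem NoncrossingOn.not_separated {f : V → ℝ} (h : NoncrossingOn G f Set.univ) {C : Set V}
    (hC : IsConn G C) {u v p q : V} (hu : u ∉ C) (hv : v ∉ C) (huv : G.Adj u v) (hp : p ∈ C)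
    (hq : q ∈ C) (hup : f u < f p) (hpv : f p < f v) : f u < f q ∧ f q < f v := by
  by_contra hout
  obtain ⟨x, hx, y, hy, hxy, ⟨hux, hxv⟩, hy'⟩ := hC.2 {x | f u < f x ∧ f x < f v}
    ⟨p, hp, hup, hpv⟩ ⟨q, hq, hout⟩
  have hyu : f y ≠ f u := fun e => hu (h.injOn trivial trivial e ▸ hy)
  have hyv : f y ≠ f v := fun e => hv (h.injOn trivial trivial e ▸ hy)
  obtain hlt | hgt := hyu.lt_or_gt
  · exact h.not_cross y trivial u trivial x trivial v trivial hlt hux hxv hxy.symm huv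
  · have : f v < f y := hyv.lt_or_gt.resolve_left fun h => hy' ⟨hgt, h⟩
    exact h.not_cross u trivial x trivial v trivial y trivial hux hxv this huv hxy

/-- If the sets alternate, `A` contains an edge leaving the interval between `b` and `d`. This edge
separates `b` from `d`, which the connected set `C` does not allow. -/
theorem NoncrossingOn.not_cross_isConn {f : V → ℝ} (h : NoncrossingOn G f Set.univ) {A C : Set V}
    (hA : IsConn G A) (hC : IsConn G C) (hAC : Disjoint A C) {a b c d : V} (ha : a ∈ A)
    (hb : b ∈ C) (hc : c ∈ A) (hd : d ∈ C) (hab : f a < f b) (hbc : f b < f c) : ¬ f c < f d := by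
  intro hcd
  obtain ⟨x, hx, y, hy, hxy, ⟨hbx, hxd⟩, hy'⟩ := hA.2 {x | f b < f x ∧ f x < f d}
    ⟨c, hc, hbc, hcd⟩ ⟨a, ha, fun h => hab.not_gt h.1⟩
  have hxC := Set.disjoint_left.1 hAC hx
  have hyC := Set.disjoint_left.1 hAC hy
  have hyb : f y ≠ f b := fun e => hyC (h.injOn trivial trivial e ▸ hb)
  have hyd : f y ≠ f d := fun e => hyC (h.injOn trivial trivial e ▸ hd)
  obtain hlt | hgt := hyb.lt_or_gt
  · exact hxd.not_gt (h.not_separated hC hyC hxC hxy.symm hb hd hlt hbx).2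
  · have : f d < f y := hyd.lt_or_gt.resolve_left fun h => hy' ⟨hgt, h⟩
    exact hbx.not_gt (h.not_separated hC hxC hyC hxy hd hb hxd this).1

/-- The minor is ordered by one representative of each branch set. Crossing edges would make two
disjoint unions of adjacent branch sets alternate. -/
theorem IsOuterplanar.of_isMinor [Finite V] [Finite W] (hG : IsOuterplanar G) (h : IsMinor H G) :
    IsOuterplanar H := by
  rw [isOuterplanar_iff] at hG ⊢
  obtain ⟨f, hf⟩ := hG
  obtain ⟨B, hconn, hdisj, hadj⟩ := h
  have hB : ∀ x, IsConn G (B x) := fun x => isConn_iff_connected.2 (hconn x)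
  choose r hr using fun x => (hB x).1
  refine ⟨fun x => f (r x), ⟨fun x _ y _ hxy => ?_, ?_⟩⟩
  · by_contra hne
    have := hf.injOn trivial trivial hxy
    exact Set.disjoint_left.1 (hdisj x y hne) (hr x) (this ▸ hr y)
  · intro a _ b _ c _ d _ h₁ h₂ h₃ hac hbd
    have hne : ∀ {x y}, f (r x) < f (r y) → Disjoint (B x) (B y) := fun {x y} hlt =>
      hdisj x y (by rintro rfl; exact hlt.false)
    refine hf.not_cross_isConn ((hB a).union_of_touch (hB c) (hadj a c hac))
      ((hB b).union_of_touch (hB d) (hadj b d hbd)) ?_ (.inl (hr a)) (.inl (hr b)) (.inr (hr c))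
      (.inr (hr d)) h₁ h₂ h₃
    rw [Set.disjoint_union_left, Set.disjoint_union_right, Set.disjoint_union_right]
    exact ⟨⟨hne h₁, hne (h₁.trans (h₂.trans h₃))⟩, (hne h₂).symm, hne h₃⟩

theorem isMinor_four {A B C D : Set V} (hA : IsConn G A) (hB : IsConn G B) (hC : IsConn G C)
    (hD : IsConn G D) (dAB : Disjoint A B) (dAC : Disjoint A C) (dAD : Disjoint A D)
    (dBC : Disjoint B C) (dBD : Disjoint B D) (dCD : Disjoint C D) (tAB : Touch G A B)
    (tAC : Touch G A C) (tAD : Touch G A D) (tBC : Touch G B C) (tBD : Touch G B D)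
    (tCD : Touch G C D) : IsMinor (⊤ : SimpleGraph (ULift.{u} (Fin 4))) G := by
  refine ⟨fun x => ![A, B, C, D] x.down, ?_, ?_, ?_⟩
  · rintro ⟨x⟩
    rw [← isConn_iff_connected]
    fin_cases x <;> assumption
  · rintro ⟨x⟩ ⟨y⟩ hxy
    fin_cases x <;> fin_cases y <;> first | exact absurd rfl hxy | assumption |
      (apply Disjoint.symm; assumption)
  · rintro ⟨x⟩ ⟨y⟩ hxy
    change Touch G _ _
    fin_cases x <;> fin_cases y <;> first | exact absurd rfl hxy | assumption |
      (apply Touch.symm; assumption)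

theorem isMinor_twoThree {P Q X Y Z : Set V} (hP : IsConn G P) (hQ : IsConn G Q)
    (hX : IsConn G X) (hY : IsConn G Y) (hZ : IsConn G Z) (dPQ : Disjoint P Q)
    (dPX : Disjoint P X) (dPY : Disjoint P Y) (dPZ : Disjoint P Z) (dQX : Disjoint Q X)
    (dQY : Disjoint Q Y) (dQZ : Disjoint Q Z) (dXY : Disjoint X Y) (dXZ : Disjoint X Z)
    (dYZ : Disjoint Y Z) (tPX : Touch G P X) (tPY : Touch G P Y) (tPZ : Touch G P Z)
    (tQX : Touch G Q X) (tQY : Touch G Q Y) (tQZ : Touch G Q Z) :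
    IsMinor (completeBipartiteGraph (ULift.{u} (Fin 2)) (ULift.{u} (Fin 3))) G := by
  refine ⟨Sum.elim (fun x => ![P, Q] x.down) (fun x => ![X, Y, Z] x.down), ?_, ?_, ?_⟩
  · rintro (⟨x⟩ | ⟨x⟩) <;> rw [← isConn_iff_connected] <;> fin_cases x <;> assumption
  · rintro (⟨x⟩ | ⟨x⟩) (⟨y⟩ | ⟨y⟩) hxy <;> fin_cases x <;> fin_cases y <;>
      first | exact absurd rfl hxy | assumption | (apply Disjoint.symm; assumption)
  · rintro (⟨x⟩ | ⟨x⟩) (⟨y⟩ | ⟨y⟩) hxy <;> simp at hxy <;> change Touch G _ _ <;>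
      fin_cases x <;> fin_cases y <;> first | assumption | (apply Touch.symm; assumption)

end Minor

/-! ### Two internally disjoint connections -/

section TwoConnections

variable {V : Type u} {G H : SimpleGraph V} {A B : Set V} {s t : V}

/-- Otherwise `s` together with the components of `B \ {s, t}` at its neighbours would be closed in
`B` and miss `t`. -/
theorem exists_isConn_between (hst : s ≠ t) (hadj : ¬ H.Adj s t) (ht : t ∈ comp H B s) :
    ∃ X, IsConn H X ∧ X ⊆ B \ {s, t} ∧ Touch H {s} X ∧ Touch H {t} X := by
  by_contra hno
  have hP : comp H B s ⊆ {v | v = s ∨ ∃ n ∈ B \ {s, t}, H.Adj s n ∧ v ∈ comp H (B \ {s, t}) n} := by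
    refine comp_subset_of_closed (.inl rfl) ?_
    rintro v hv w hw hvw
    by_cases hws : w = s
    · exact .inl hws
    obtain rfl | ⟨n, hn, hsn, hv⟩ := hv
    · have hwt : w ≠ t := by rintro rfl; exact hadj hvw
      exact .inr ⟨w, ⟨hw, by simp [hws, hwt]⟩, hvw, mem_comp_self w⟩
    · have hwt : w ≠ t := by
        rintro rfl
        exact hno ⟨_, isConn_comp n, comp_subset hn, ⟨s, rfl, n, mem_comp_self n, hsn⟩,
          ⟨w, rfl, v, hv, hvw.symm⟩⟩
      exact .inr ⟨n, hn, hsn, mem_comp_of_adj hv ⟨hw, by simp [hws, hwt]⟩ hvw⟩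
  obtain h | ⟨n, hn, -, h⟩ := hP ht
  · exact hst h.symm
  · exact (comp_subset hn h).2 (by simp)

/-- Menger's theorem is applied to the neighbours of `s` and of `t` in `D`. Only edges inside `D`
are kept, so that connections cannot leave `D`. -/
theorem exists_two_isConn_between [Finite V] (hst : s ≠ t) (hadj : ¬ H.Adj s t)
    (ht : t ∈ comp H A s) (hcut : ∀ c ∈ A, c ≠ s → c ≠ t → t ∈ comp H (A \ {c}) s) :
    ∃ X Y, IsConn H X ∧ IsConn H Y ∧ X ⊆ A \ {s, t} ∧ Y ⊆ A \ {s, t} ∧ Disjoint X Y ∧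
      Touch H {s} X ∧ Touch H {t} X ∧ Touch H {s} Y ∧ Touch H {t} Y := by
  set D := A \ {s, t} with hD
  let HD : SimpleGraph V :=
    { Adj := fun u v => H.Adj u v ∧ u ∈ D ∧ v ∈ D
      symm := ⟨fun _ _ h => ⟨h.1.symm, h.2.2, h.2.1⟩⟩
      loopless := ⟨fun _ h => h.1.ne rfl⟩ }
  have : Nonempty V := ⟨s⟩
  have hle : HD ≤ H := fun _ _ h => h.1
  have hsub : ∀ X, Joins HD {v | v ∈ D ∧ H.Adj s v} {v | v ∈ D ∧ H.Adj t v} X →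
      IsConn H X ∧ X ⊆ D ∧ Touch H {s} X ∧ Touch H {t} X := by
    rintro X ⟨hX, ⟨p, hp, hpD, hsp⟩, q, hq, hqD, htq⟩
    refine ⟨hX.of_le hle, fun v hv => ?_, ⟨s, rfl, p, hp, hsp⟩, ⟨t, rfl, q, hq, htq⟩⟩
    by_contra hvD
    obtain ⟨x, -, y, -, hxy, -, hy⟩ := hX.2 D ⟨p, hp, hpD⟩ ⟨v, hv, hvD⟩
    exact hy hxy.2.2
  obtain ⟨X, Y, hX, hY, hXY⟩ := exists_disjoint_joins HD {v | v ∈ D ∧ H.Adj s v}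
    {v | v ∈ D ∧ H.Adj t v} (by
      intro z
      have hB : ∃ B ⊆ A, t ∈ comp H B s ∧ z ∉ B \ {s, t} := by
        by_cases hz : z ∈ D
        · have : z ≠ s ∧ z ≠ t := by simpa using hz.2
          exact ⟨A \ {z}, Set.sdiff_subset, hcut z hz.1 this.1 this.2, fun h => h.1.2 rfl⟩
        · exact ⟨A, subset_rfl, ht, hz⟩
      obtain ⟨B, hBA, htB, hz⟩ := hB
      obtain ⟨X, hX, hXB, ⟨_, rfl, p, hp, hsp⟩, ⟨_, rfl, q, hq, htq⟩⟩ :=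
        exists_isConn_between hst hadj htB
      have hXD : X ⊆ D := hXB.trans (Set.sdiff_subset_sdiff_left hBA)
      exact ⟨X, ⟨hX.of_adj fun u hu v hv h => ⟨h, hXD hu, hXD hv⟩, ⟨p, hp, hXD hp, hsp⟩,
        q, hq, hXD hq, htq⟩, fun h => hz (hXB h)⟩)
  obtain ⟨h₁, h₂, h₃, h₄⟩ := hsub X hX
  obtain ⟨h₅, h₆, h₇, h₈⟩ := hsub Y hY
  exact ⟨X, Y, h₁, h₅, h₂, h₆, hXY, h₃, h₄, h₇, h₈⟩

end TwoConnections

/-! ### Gluing noncrossing orders -/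

section Glue

variable {V : Type u} {G : SimpleGraph V} {f g : V → ℝ} {A A₁ A₂ : Set V} {c s t : V} {θ k : ℝ}

theorem NoncrossingOn.of_lt (h : NoncrossingOn G f A)
    (hg : ∀ a ∈ A, ∀ b ∈ A, f a < f b → g a < g b) : NoncrossingOn G g A := by
  have hg' : ∀ a ∈ A, ∀ b ∈ A, g a < g b → f a < f b := by
    intro a ha b hb hab
    by_contra hle
    obtain hlt | heq := (not_lt.1 hle).lt_or_eq
    · exact hab.not_gt (hg b hb a ha hlt)
    · exact hab.ne (congrArg g (h.injOn hb ha heq)).symm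
  refine ⟨fun a ha b hb hab => ?_, fun a ha b hb c hc d hd h₁ h₂ h₃ =>
    h.not_cross a ha b hb c hc d hd (hg' a ha b hb h₁) (hg' b hb c hc h₂) (hg' c hc d hd h₃)⟩
  by_contra hne
  obtain hlt | hlt := lt_or_gt_of_ne fun e => hne (h.injOn ha hb e)
  · exact (hg a ha b hb hlt).ne hab
  · exact (hg b hb a ha hlt).ne hab.symm

theorem NoncrossingOn.of_gt (h : NoncrossingOn G f A)
    (hg : ∀ a ∈ A, ∀ b ∈ A, f a < f b → g b < g a) : NoncrossingOn G g A := by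
  have hneg : NoncrossingOn G (fun v => - f v) A :=
    ⟨fun a ha b hb hab => h.injOn ha hb (neg_injective hab),
      fun a ha b hb c hc d hd h₁ h₂ h₃ hac hbd => h.not_cross d hd c hc b hb a ha
        (neg_lt_neg_iff.1 h₃) (neg_lt_neg_iff.1 h₂) (neg_lt_neg_iff.1 h₁) hbd.symm hac.symm⟩
  exact hneg.of_lt fun a ha b hb hab => hg b hb a ha (neg_lt_neg_iff.1 hab)

/-- If all edges across a threshold start at the first vertex `s`, then a crossing lies on one side
of the threshold, or on the upper side with `s` moved to the end. -/
theorem noncrossingOn_of_threshold (hinj : Set.InjOn f A)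
    (h₁ : ∀ a ∈ A, ∀ b ∈ A, ∀ c ∈ A, ∀ d ∈ A, f d ≤ θ → f a < f b → f b < f c → f c < f d →
      G.Adj a c → ¬ G.Adj b d)
    (h₂ : ∀ a ∈ A, ∀ b ∈ A, ∀ c ∈ A, ∀ d ∈ A, θ ≤ f a → f a < f b → f b < f c → f c < f d →
      G.Adj a c → ¬ G.Adj b d)
    (h₃ : ∀ b ∈ A, ∀ c ∈ A, ∀ d ∈ A, f s < θ → θ ≤ f b → f b < f c → f c < f d →
      G.Adj s c → ¬ G.Adj b d)
    (hcut : ∀ p ∈ A, ∀ u ∈ A, f p < θ → θ < f u → G.Adj p u → p = s)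
    (hs : ∀ a ∈ A, f s ≤ f a) : NoncrossingOn G f A := by
  refine ⟨hinj, fun a ha b hb c hc d hd hab hbc hcd hac hbd => ?_⟩
  obtain hd' | hd' := le_or_gt (f d) θ
  · exact h₁ a ha b hb c hc d hd hd' hab hbc hcd hac hbd
  -- Now `a` is below and `d` above the threshold. If `b` were below, the edge `bd` would force `b =
  -- s`, which is impossible after `a`; so `ac` passes the threshold and `a = s`.
  obtain ha' | ha' := le_or_gt θ (f a)
  · exact h₂ a ha b hb c hc d hd ha' hab hbc hcd hac hbd
  have hb' : θ ≤ f b := by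
    by_contra hlt
    obtain rfl := hcut b hb d hd (not_le.1 hlt) hd' hbd
    exact hab.not_ge (hs a ha)
  obtain rfl := hcut a ha c hc ha' (hb'.trans_lt hbc) hac
  exact h₃ b hb c hc d hd ha' hb' hbc hcd hac hbd

/-- There is a noncrossing order of `A` that starts at `s` and ends at `t`. -/
def HasOrderFromTo (G : SimpleGraph V) (A : Set V) (s t : V) : Prop :=
  ∃ f, NoncrossingOn G f A ∧ (∀ a ∈ A, f s ≤ f a) ∧ ∀ a ∈ A, f a ≤ f t

theorem hasOrderFromTo_of_threshold (hinj : Set.InjOn f A) (h₁ : NoncrossingOn G f A₁)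
    (h₂ : NoncrossingOn G f A₂) (hA₁ : ∀ a ∈ A, f a ≤ θ → a ∈ A₁) (hA₂ : ∀ a ∈ A, θ ≤ f a → a ∈ A₂)
    (hcut : ∀ p ∈ A, ∀ u ∈ A, f p < θ → θ < f u → G.Adj p u → p = s ∧ u = t)
    (hsA : s ∈ A) (hs : ∀ a ∈ A, f s ≤ f a) (ht : ∀ a ∈ A, f a ≤ f t) : HasOrderFromTo G A s t := by
  refine ⟨f, noncrossingOn_of_threshold hinj ?_ ?_ ?_
    (fun p hp u hu h₁ h₂ h => (hcut p hp u hu h₁ h₂ h).1) hs, hs, ht⟩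
  · intro a ha b hb c hc d hd hdθ hab hbc hcd
    exact h₁.not_cross a (hA₁ a ha (by linarith)) b (hA₁ b hb (by linarith)) c
      (hA₁ c hc (by linarith)) d (hA₁ d hd hdθ) hab hbc hcd
  · intro a ha b hb c hc d hd haθ hab hbc hcd
    exact h₂.not_cross a (hA₂ a ha haθ) b (hA₂ b hb (by linarith)) c
      (hA₂ c hc (by linarith)) d (hA₂ d hd (by linarith)) hab hbc hcd
  · intro b _ c hc d hd hsθ hbθ hbc hcd hsc
    obtain ⟨-, rfl⟩ := hcut s hsA c hc hsθ (by linarith) hsc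
    exact absurd hcd (not_lt.2 (ht d hd))

/-- Rotate the orders to start at `s` and at `t`, and put the second, reversed, behind the first. An
edge from the first vertex to the last crosses nothing. -/
theorem hasOrderFromTo_of_disjoint [Finite V] (hs₁ : s ∈ A₁) (ht₂ : t ∈ A₂)
    (hd : Disjoint A₁ A₂) (h₁ : ∃ f, NoncrossingOn G f A₁) (h₂ : ∃ f, NoncrossingOn G f A₂)
    (hcut : ∀ p ∈ A₁, ∀ u ∈ A₂, G.Adj p u → p = s ∧ u = t) :
    HasOrderFromTo G (A₁ ∪ A₂) s t := by
  classical
  obtain ⟨f₁, h₁⟩ := h₁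
  obtain ⟨f₁, h₁, hf₁⟩ := h₁.exists_rotate (Set.toFinite _) hs₁
  obtain ⟨f₂, h₂⟩ := h₂
  obtain ⟨f₂, h₂, hf₂⟩ := h₂.exists_rotate (Set.toFinite _) ht₂
  obtain ⟨M₁, hM₁⟩ := exists_forall_lt_of_finite A₁.toFinite f₁
  obtain ⟨M₂, hM₂⟩ := exists_forall_lt_of_finite A₂.toFinite f₂
  simp only [abs_lt] at hM₁ hM₂
  let f : V → ℝ := fun v => if v ∈ A₁ then f₁ v else M₁ + M₂ - f₂ v
  have e₁ : ∀ v ∈ A₁, f v = f₁ v := fun v hv => if_pos hv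
  have e₂ : ∀ v ∈ A₂, f v = M₁ + M₂ - f₂ v := fun v hv => if_neg (Set.disjoint_right.1 hd hv)
  have l₁ : ∀ v ∈ A₁, f v < M₁ := fun v hv => by rw [e₁ v hv]; exact (hM₁ v hv).2
  have l₂ : ∀ v ∈ A₂, M₁ < f v := fun v hv => by rw [e₂ v hv]; linarith [(hM₂ v hv).2]
  have n₁ : NoncrossingOn G f A₁ := h₁.of_lt fun a ha b hb hab => by rwa [e₁ a ha, e₁ b hb]
  have n₂ : NoncrossingOn G f A₂ := h₂.of_gt fun a ha b hb hab => by
    rw [e₂ a ha, e₂ b hb]; linarith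
  refine hasOrderFromTo_of_threshold (f := f) (θ := M₁) ?_ n₁ n₂ ?_ ?_ ?_ (.inl hs₁) ?_ ?_
  · rintro a (ha | ha) b (hb | hb) hab
    · exact n₁.injOn ha hb hab
    · linarith [l₁ a ha, l₂ b hb]
    · linarith [l₁ b hb, l₂ a ha]
    · exact n₂.injOn ha hb hab
  · rintro a (ha | ha) h
    exacts [ha, absurd (l₂ a ha) (not_lt.2 h)]
  · rintro a (ha | ha) h
    exacts [absurd (l₁ a ha) (not_lt.2 h), ha]
  · rintro p (hp | hp) u (hu | hu) hpθ huθ hpu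
    · exact absurd (l₁ u hu) huθ.not_gt
    · exact hcut p hp u hu hpu
    · exact absurd (l₁ u hu) huθ.not_gt
    · exact absurd (l₂ p hp) hpθ.not_gt
  · rintro a (ha | ha)
    · rw [e₁ s hs₁, e₁ a ha]; exact hf₁ a ha
    · linarith [l₁ s hs₁, l₂ a ha]
  · rintro a (ha | ha)
    · linarith [l₁ a ha, l₂ t ht₂]
    · rw [e₂ t ht₂, e₂ a ha]; linarith [hf₂ a ha]

/-- The second order is translated so that both agree at `c`. Only the edge between the outermost
vertices may pass over `c`. -/
theorem HasOrderFromTo.trans (h₁ : HasOrderFromTo G A₁ s c) (h₂ : HasOrderFromTo G A₂ c t)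
    (hs₁ : s ∈ A₁) (ht₂ : t ∈ A₂) (hc₁ : c ∈ A₁) (hc₂ : c ∈ A₂)
    (hint : ∀ v ∈ A₁, v ∈ A₂ → v = c)
    (hcut : ∀ p ∈ A₁, ∀ u ∈ A₂, p ≠ c → u ≠ c → G.Adj p u → p = s ∧ u = t) :
    HasOrderFromTo G (A₁ ∪ A₂) s t := by
  classical
  obtain ⟨f₁, h₁, hs, hc⟩ := h₁
  obtain ⟨f₂, h₂, hc', ht⟩ := h₂
  let f : V → ℝ := fun v => if v ∈ A₁ then f₁ v else f₂ v - f₂ c + f₁ c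
  have e₁ : ∀ v ∈ A₁, f v = f₁ v := fun v hv => if_pos hv
  have e₂ : ∀ v ∈ A₂, f v = f₂ v - f₂ c + f₁ c := fun v hv => by
    by_cases hv₁ : v ∈ A₁
    · rw [hint v hv₁ hv, e₁ c hc₁]; ring
    · exact if_neg hv₁
  have l₁ : ∀ v ∈ A₁, f v ≤ f₁ c := fun v hv => by rw [e₁ v hv]; exact hc v hv
  have l₂ : ∀ v ∈ A₂, f₁ c ≤ f v := fun v hv => by rw [e₂ v hv]; linarith [hc' v hv]
  have n₁ : NoncrossingOn G f A₁ := h₁.of_lt fun a ha b hb hab => by rwa [e₁ a ha, e₁ b hb]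
  have n₂ : NoncrossingOn G f A₂ := h₂.of_lt fun a ha b hb hab => by
    rw [e₂ a ha, e₂ b hb]; linarith
  have ec : f c = f₁ c := e₁ c hc₁
  have q₁ : ∀ v ∈ A₁, f₁ c ≤ f v → v = c := fun v hv h =>
    n₁.injOn hv hc₁ (le_antisymm ((l₁ v hv).trans ec.ge) (ec.le.trans h))
  have q₂ : ∀ v ∈ A₂, f v ≤ f₁ c → v = c := fun v hv h =>
    n₂.injOn hv hc₂ (le_antisymm (h.trans ec.ge) (ec.le.trans (l₂ v hv)))
  refine hasOrderFromTo_of_threshold (f := f) (θ := f₁ c) ?_ n₁ n₂ ?_ ?_ ?_ (.inl hs₁) ?_ ?_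
  · rintro a (ha | ha) b (hb | hb) hab
    · exact n₁.injOn ha hb hab
    · rw [q₁ a ha (hab ▸ l₂ b hb), q₂ b hb (hab ▸ l₁ a ha)]
    · rw [q₂ a ha (hab ▸ l₁ b hb), q₁ b hb (hab ▸ l₂ a ha)]
    · exact n₂.injOn ha hb hab
  · rintro a (ha | ha) h
    exacts [ha, q₂ a ha h ▸ hc₁]
  · rintro a (ha | ha) h
    exacts [q₁ a ha h ▸ hc₂, ha]
  · rintro p (hp | hp) u (hu | hu) hpθ huθ hpu
    · exact absurd (l₁ u hu) huθ.not_ge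
    · exact hcut p hp u hu (by rintro rfl; exact hpθ.ne ec) (by rintro rfl; exact huθ.ne' ec) hpu
    · exact absurd (l₁ u hu) huθ.not_ge
    · exact absurd (l₂ p hp) hpθ.not_ge
  · rintro a (ha | ha)
    · rw [e₁ s hs₁, e₁ a ha]; exact hs a ha
    · exact (l₁ s hs₁).trans (l₂ a ha)
  · rintro a (ha | ha)
    · exact (l₁ a ha).trans (l₂ t ht₂)
    · rw [e₂ t ht₂, e₂ a ha]; linarith [ht a ha]

/-- Two orders with the same ends fit together to a cyclic order. -/
theorem HasOrderFromTo.exists_noncrossingOn_union (h₁ : HasOrderFromTo G A₁ s t)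
    (h₂ : HasOrderFromTo G A₂ s t) (hs₁ : s ∈ A₁) (ht₁ : t ∈ A₁) (hs₂ : s ∈ A₂) (ht₂ : t ∈ A₂)
    (hint : ∀ v ∈ A₁, v ∈ A₂ → v = s ∨ v = t)
    (hcut : ∀ p ∈ A₁, ∀ u ∈ A₂, u ∉ A₁ → G.Adj p u → p = s ∨ p = t) :
    ∃ f, NoncrossingOn G f (A₁ ∪ A₂) := by
  classical
  obtain ⟨f₁, h₁, hs, ht⟩ := h₁
  obtain ⟨f₂, h₂, hs', ht'⟩ := h₂
  -- Behind `t` the order of `A₂` is run backwards. It would end at `s`, which cyclically is the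
  -- starting point.
  let f : V → ℝ := fun v => if v ∈ A₁ then f₁ v else f₁ t + f₂ t - f₂ v
  have e₁ : ∀ v ∈ A₁, f v = f₁ v := fun v hv => if_pos hv
  have e₂ : ∀ v ∈ A₂, v ∉ A₁ → f v = f₁ t + f₂ t - f₂ v := fun v _ hv => if_neg hv
  have et : f t = f₁ t := e₁ t ht₁
  have l₁ : ∀ v ∈ A₁, f v ≤ f₁ t := fun v hv => by rw [e₁ v hv]; exact ht v hv
  have l₂ : ∀ v ∈ A₂, v ∉ A₁ → f₁ t < f v := fun v hv hv₁ => by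
    have : f₂ v ≠ f₂ t := fun e => hv₁ (h₂.injOn hv ht₂ e ▸ ht₁)
    rw [e₂ v hv hv₁]
    linarith [(ht' v hv).lt_of_ne this]
  have n₁ : NoncrossingOn G f A₁ := h₁.of_lt fun a ha b hb hab => by rwa [e₁ a ha, e₁ b hb]
  have mem₁ : ∀ v ∈ A₁ ∪ A₂, f v ≤ f₁ t → v ∈ A₁ := by
    rintro v (hv | hv) h
    · exact hv
    · by_contra hv₁
      exact absurd (l₂ v hv hv₁) (not_lt.2 h)
  have mem₂ : ∀ v ∈ A₁ ∪ A₂, f₁ t ≤ f v → v ∈ A₂ ∧ f v = f₁ t + f₂ t - f₂ v := by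
    intro v hv h
    by_cases hv₁ : v ∈ A₁
    · obtain rfl : v = t := n₁.injOn hv₁ ht₁ (le_antisymm ((l₁ v hv₁).trans et.ge) (et.le.trans h))
      exact ⟨ht₂, by rw [et]; ring⟩
    · have hv₂ := hv.resolve_left hv₁
      exact ⟨hv₂, e₂ v hv₂ hv₁⟩
  have hsmin : ∀ a ∈ A₁ ∪ A₂, f s ≤ f a := by
    intro a ha
    by_cases ha₁ : a ∈ A₁
    · rw [e₁ s hs₁, e₁ a ha₁]; exact hs a ha₁
    · exact (l₁ s hs₁).trans (l₂ a (ha.resolve_left ha₁) ha₁).le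
  refine ⟨f, noncrossingOn_of_threshold (θ := f₁ t) (s := s) ?_ ?_ ?_ ?_ ?_ hsmin⟩
  · intro a ha b hb hab
    obtain h | h := le_or_gt (f a) (f₁ t)
    · exact n₁.injOn (mem₁ a ha h) (mem₁ b hb (hab ▸ h)) hab
    · obtain ⟨ha', ea⟩ := mem₂ a ha h.le
      obtain ⟨hb', eb⟩ := mem₂ b hb (hab ▸ h.le)
      exact h₂.injOn ha' hb' (by linarith)
  · intro a ha b hb c hc d hd hdθ hab hbc hcd
    exact n₁.not_cross a (mem₁ a ha (by linarith)) b (mem₁ b hb (by linarith)) c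
      (mem₁ c hc (by linarith)) d (mem₁ d hd hdθ) hab hbc hcd
  · intro a ha b hb c hc d hd haθ hab hbc hcd hac hbd
    obtain ⟨ha', ea⟩ := mem₂ a ha haθ
    obtain ⟨hb', eb⟩ := mem₂ b hb (by linarith)
    obtain ⟨hc', ec⟩ := mem₂ c hc (by linarith)
    obtain ⟨hd', ed⟩ := mem₂ d hd (by linarith)
    exact h₂.not_cross d hd' c hc' b hb' a ha' (by linarith) (by linarith) (by linarith)
      hbd.symm hac.symm
  · intro b hb c hc d hd hsθ hbθ hbc hcd hsc hbd
    obtain ⟨hb', eb⟩ := mem₂ b hb hbθ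
    obtain ⟨hc', ec⟩ := mem₂ c hc (by linarith)
    obtain ⟨hd', ed⟩ := mem₂ d hd (by linarith)
    have hne : f₂ s ≠ f₂ d := fun e => by
      obtain rfl := h₂.injOn hs₂ hd' e
      linarith
    exact h₂.not_cross s hs₂ d hd' c hc' b hb' ((hs' d hd').lt_of_ne hne) (by linarith)
      (by linarith) hsc hbd.symm
  · intro p hp w hw hpθ hwθ hpw
    have hw₁ : w ∉ A₁ := fun h => (l₁ w h).not_gt hwθ
    obtain h | rfl := hcut p (mem₁ p hp hpθ.le) w (hw.resolve_left hw₁) hw₁ hpw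
    · exact h
    · exact absurd hpθ et.not_lt

end Glue

/-! ### Graphs without the two excluded minors -/

section Excluded

variable {V : Type u} {G : SimpleGraph V} {A : Set V} {s t : V}

/-- `s` and `t` are joined by a connected set outside `A`. -/
def LinkedOutside (G : SimpleGraph V) (A : Set V) (s t : V) : Prop :=
  ∃ Z, IsConn G Z ∧ Disjoint Z A ∧ Touch G {s} Z ∧ Touch G {t} Z

/-- The link from `t` back to `s` is absorbed into `C`. No new vertices of `A` are gained, so the
result can serve as an outside link for a smaller set. -/
theorem exists_isConn_extension (hlink : G.Adj s t ∨ LinkedOutside G A s t) {C : Set V}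
    (hC : IsConn G C) (ht : t ∈ C) :
    ∃ Z, IsConn G Z ∧ C ⊆ Z ∧ (∀ v ∈ Z, v ∈ A → v ∈ C) ∧ Touch G {s} Z := by
  obtain hst | ⟨Z, hZ, hZA, hsZ, htZ⟩ := hlink
  · exact ⟨C, hC, subset_rfl, fun _ h _ => h, s, rfl, t, ht, hst⟩
  · refine ⟨C ∪ Z, hC.union_of_touch hZ (htZ.mono (by simpa using ht) subset_rfl),
      Set.subset_union_left, ?_, hsZ.mono subset_rfl Set.subset_union_right⟩
    rintro v (hv | hv) hvA
    exacts [hv, (Set.disjoint_left.1 hZA hv hvA).elim]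

theorem touch_comp_of_mem_comp {H : SimpleGraph V} {c : V} (hs : s ∈ A)
    (ht : t ∈ comp H A s) (ht' : t ∉ comp H (A \ {c}) s) : Touch H {c} (comp H (A \ {c}) s) := by
  obtain ⟨x, -, y, hy, hxy, hxC, hy'⟩ := (isConn_comp (G := H) (A := A) s).2 (comp H (A \ {c}) s)
    ⟨s, mem_comp_self s, mem_comp_self s⟩ ⟨t, ht, ht'⟩
  have : y = c := by
    by_contra hyc
    exact hy' (mem_comp_of_adj hxC ⟨comp_subset hs hy, hyc⟩ hxy)
  exact ⟨y, this, x, hxC, hxy.symm⟩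

/-- Either `A` has a noncrossing order from `s` to `t`, or there are two disjoint connections
between `s` and `t` inside `A`, provided smaller sets have noncrossing orders. -/
theorem hasOrderFromTo_or_exists_two [Finite V] (hs : s ∈ A) (ht : t ∈ A) (hst : s ≠ t)
    (hlink : G.Adj s t ∨ LinkedOutside G A s t)
    (hmain : ∀ B : Set V, B.ncard < A.ncard → ∃ f, NoncrossingOn G f B)
    (htwo : ∀ B : Set V, B.ncard < A.ncard → ∀ s ∈ B, ∀ t ∈ B, s ≠ t → LinkedOutside G B s t →
      HasOrderFromTo G B s t) :
    HasOrderFromTo G A s t ∨ ∃ X Y, IsConn G X ∧ IsConn G Y ∧ X ⊆ A \ {s, t} ∧ Y ⊆ A \ {s, t} ∧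
      Disjoint X Y ∧ Touch G {s} X ∧ Touch G {t} X ∧ Touch G {s} Y ∧ Touch G {t} Y := by
  -- The edge `st` is harmless in an order from `s` to `t`, so connectivity is tested without it:
  -- either `s` and `t` are disconnected, or a vertex `c` separates them, or Menger's theorem gives
  -- two connections.
  set H := G.deleteEdges {s(s, t)} with hH
  have hle : H ≤ G := SimpleGraph.deleteEdges_le _
  have hHG : ∀ u v, G.Adj u v → ¬ H.Adj u v → u = s ∧ v = t ∨ u = t ∧ v = s := by
    intro u v huv hn
    rw [hH, SimpleGraph.deleteEdges_adj] at hn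
    by_contra he
    exact hn ⟨huv, fun e => he (Sym2.eq_iff.1 e)⟩
  have hadj : ¬ H.Adj s t := by simp [hH]
  have hlt : ∀ {B : Set V} {v : V}, B ⊆ A → v ∈ A → v ∉ B → B.ncard < A.ncard :=
    fun hBA hv hvB => Set.ncard_lt_ncard (Set.ssubset_iff_of_subset hBA |>.2 ⟨_, hv, hvB⟩)
  by_cases hconn : t ∈ comp H A s
  swap
  · left
    have hsub : comp H A s ⊆ A := comp_subset hs
    have := hasOrderFromTo_of_disjoint (mem_comp_self s) (A₂ := A \ comp H A s) ⟨ht, hconn⟩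
      Set.disjoint_sdiff_right (hmain _ (hlt hsub ht hconn))
      (hmain _ (hlt Set.sdiff_subset hs fun h => h.2 (mem_comp_self s))) (by
        intro p hp w hw hpw
        obtain h | ⟨rfl, -⟩ := hHG p w hpw fun h => hw.2 (mem_comp_of_adj hp hw.1 h)
        exacts [h, (hconn hp).elim])
    rwa [Set.union_sdiff_cancel hsub] at this
  by_cases hcut : ∀ c ∈ A, c ≠ s → c ≠ t → t ∈ comp H (A \ {c}) s
  · right
    obtain ⟨X, Y, hX, hY, hXA, hYA, hXY, h₁, h₂, h₃, h₄⟩ :=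
      exists_two_isConn_between hst hadj hconn hcut
    exact ⟨X, Y, hX.of_le hle, hY.of_le hle, hXA, hYA, hXY, h₁.of_le hle, h₂.of_le hle,
      h₃.of_le hle, h₄.of_le hle⟩
  left
  push Not at hcut
  obtain ⟨c, hc, hcs, hct, htc⟩ := hcut
  set C₁ := comp H (A \ {c}) s with hC₁
  set C₂ := comp H (A \ {c}) t with hC₂
  have hs' : s ∈ A \ {c} := ⟨hs, hcs.symm⟩
  have ht' : t ∈ A \ {c} := ⟨ht, hct.symm⟩
  have hsub₁ : C₁ ⊆ A \ {c} := comp_subset hs'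
  have hsub₂ : C₂ ⊆ A \ {c} := comp_subset ht'
  have hsC₂ : s ∉ C₂ := fun h => htc (mem_comp_symm ht' h)
  have hdisj : Disjoint C₁ C₂ := Set.disjoint_left.2 fun v h₁ h₂ =>
    htc ((isConn_comp (G := H) t).subset_comp hsub₂ h₂ h₁ (mem_comp_self t))
  have touch₁ : Touch G {c} C₁ := (touch_comp_of_mem_comp hs hconn htc).of_le hle
  have touch₂ : Touch G {c} C₂ :=
    (touch_comp_of_mem_comp ht (mem_comp_symm hs hconn) hsC₂).of_le hle
  have hlink' : G.Adj t s ∨ LinkedOutside G A t s :=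
    hlink.imp SimpleGraph.Adj.symm fun ⟨Z, hZ, hZA, h₁, h₂⟩ => ⟨Z, hZ, hZA, h₂, h₁⟩
  -- Each part at the cut vertex `c` is linked outside through the other part and the link or edge
  -- between `s` and `t`, so the hypothesis on smaller sets orders both parts.
  obtain ⟨Z₁, hZ₁, hCZ₁, hZA₁, hsZ₁⟩ := exists_isConn_extension hlink
    ((isConn_comp (G := H) (A := A \ {c}) t).of_le hle) (mem_comp_self t)
  obtain ⟨Z₂, hZ₂, hCZ₂, hZA₂, htZ₂⟩ := exists_isConn_extension hlink'
    ((isConn_comp (G := H) (A := A \ {c}) s).of_le hle) (mem_comp_self s)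
  have hA₁ : C₁ ∪ {c} ⊆ A := Set.union_subset (hsub₁.trans Set.sdiff_subset) (by simpa using hc)
  have o₁ : HasOrderFromTo G (C₁ ∪ {c}) s c := by
    refine htwo _ (hlt hA₁ ht ?_) s (.inl (mem_comp_self s)) c (.inr rfl) hcs.symm
      ⟨Z₁, hZ₁, ?_, hsZ₁, touch₂.mono subset_rfl hCZ₁⟩
    · rintro (h | h)
      exacts [htc h, hct h.symm]
    · rw [Set.disjoint_left]
      rintro v hv (hv' | rfl)
      · exact Set.disjoint_left.1 hdisj hv' (hZA₁ v hv (hA₁ (.inl hv')))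
      · exact (hsub₂ (hZA₁ v hv hc)).2 rfl
  have hcC₁ : c ∉ C₁ := fun h => (hsub₁ h).2 rfl
  have o₂ : HasOrderFromTo G (A \ C₁) c t := by
    refine htwo _ (hlt Set.sdiff_subset hs fun h => h.2 (mem_comp_self s)) c ⟨hc, hcC₁⟩ t
      ⟨ht, htc⟩ hct ⟨Z₂, hZ₂, ?_, touch₁.mono subset_rfl hCZ₂, htZ₂⟩
    exact Set.disjoint_left.2 fun v hv hv' => hv'.2 (hZA₂ v hv hv'.1)
  have := o₁.trans o₂ (.inl (mem_comp_self s)) ⟨ht, htc⟩ (.inr rfl) ⟨hc, hcC₁⟩ (by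
      rintro v (hv | rfl) hv'
      exacts [(hv'.2 hv).elim, rfl]) (by
      rintro p (hp | rfl) w hw hpc hwc hpw
      · obtain h | ⟨rfl, -⟩ := hHG p w hpw fun h => hw.2 (mem_comp_of_adj hp ⟨hw.1, hwc⟩ h)
        exacts [h, (htc hp).elim]
      · exact (hpc rfl).elim)
  convert this using 1
  ext v
  constructor
  · intro hv
    by_cases hv' : v ∈ C₁
    exacts [.inl (.inl hv'), .inr ⟨hv, hv'⟩]
  · rintro (hv | hv)
    exacts [hA₁ hv, hv.1]

/-- Graphs without `K₄`- and `K₂,₃`-minors have noncrossing orders. -/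
theorem exists_noncrossingOn_of_excluded [Finite V]
    (h4 : ¬ IsMinor (⊤ : SimpleGraph (ULift.{u} (Fin 4))) G)
    (h23 : ¬ IsMinor (completeBipartiteGraph (ULift.{u} (Fin 2)) (ULift.{u} (Fin 3))) G)
    (A : Set V) :
    (∃ f, NoncrossingOn G f A) ∧ ∀ s ∈ A, ∀ t ∈ A, s ≠ t → LinkedOutside G A s t →
      HasOrderFromTo G A s t := by
  induction hn : A.ncard using Nat.strong_induction_on generalizing A with
  | _ n ih =>
  have hmain : ∀ B : Set V, B.ncard < A.ncard → ∃ f, NoncrossingOn G f B := fun B hB =>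
    (ih _ (hn ▸ hB) B rfl).1
  have htwo : ∀ B : Set V, B.ncard < A.ncard → ∀ s ∈ B, ∀ t ∈ B, s ≠ t → LinkedOutside G B s t →
      HasOrderFromTo G B s t := fun B hB => (ih _ (hn ▸ hB) B rfl).2
  have hdis : ∀ {s t : V} {X : Set V}, X ⊆ A \ {s, t} →
      Disjoint {s} X ∧ Disjoint {t} X := fun {s t X} hX =>
    ⟨Set.disjoint_singleton_left.2 fun h => (hX h).2 (.inl rfl),
      Set.disjoint_singleton_left.2 fun h => (hX h).2 (.inr rfl)⟩
  constructor
  · by_cases hedge : ∃ s ∈ A, ∃ t ∈ A, G.Adj s t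
    swap
    · push Not at hedge
      obtain ⟨f, hf⟩ := exists_injective_nat V
      exact ⟨fun v => (f v : ℝ), ⟨fun a _ b _ hab => hf (Nat.cast_injective hab),
        fun a ha b _ c hc d _ _ _ _ hac => (hedge a ha c hc hac).elim⟩⟩
    obtain ⟨s, hs, t, ht, hst⟩ := hedge
    obtain ⟨f, hf, -⟩ | ⟨X, Y, hX, hY, hXA, hYA, hXY, hsX, htX, hsY, htY⟩ :=
      hasOrderFromTo_or_exists_two hs ht hst.ne (.inl hst) hmain htwo
    · exact ⟨f, hf⟩
    obtain ⟨x, hx⟩ := hX.1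
    obtain ⟨y, hy⟩ := hY.1
    set D := comp G (A \ {s, t}) x with hD
    have hDA : D ⊆ A \ {s, t} := comp_subset (hXA hx)
    have hXD : X ⊆ D := hX.subset_comp hXA hx (mem_comp_self x)
    have hsD : s ∉ D := fun h => (hDA h).2 (.inl rfl)
    have htD : t ∉ D := fun h => (hDA h).2 (.inr rfl)
    have hxD : x ∈ D := mem_comp_self x
    -- If `Y` lies in other components of `A \ {s, t}`, then `D ∪ {s, t}` and `A \ D` are linked
    -- outside through each other, and their orders close up to a cyclic one.
    by_cases hYD : Disjoint Y D
    · have hA₁ : D ∪ {s, t} ⊆ A := Set.union_subset (hDA.trans Set.sdiff_subset)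
        (Set.insert_subset hs (by simpa using ht))
      have hyA₁ : y ∉ D ∪ {s, t} := by
        rintro (h | h)
        exacts [Set.disjoint_left.1 hYD hy h, (hYA hy).2 h]
      have o₁ : HasOrderFromTo G (D ∪ {s, t}) s t := by
        refine htwo _ (Set.ncard_lt_ncard (Set.ssubset_iff_of_subset hA₁ |>.2
          ⟨y, (hYA hy).1, hyA₁⟩)) s (by simp) t (by simp) hst.ne ⟨Y, hY, ?_, hsY, htY⟩
        rw [Set.disjoint_union_right]
        exact ⟨hYD, Set.disjoint_left.2 fun v hv hv' => (hYA hv).2 hv'⟩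
      have o₂ : HasOrderFromTo G (A \ D) s t :=
        htwo _ (Set.ncard_lt_ncard (Set.ssubset_iff_of_subset Set.sdiff_subset |>.2
          ⟨x, (hXA hx).1, fun h => h.2 hxD⟩)) s ⟨hs, hsD⟩ t ⟨ht, htD⟩ hst.ne
          ⟨D, isConn_comp x, Set.disjoint_sdiff_right, hsX.mono subset_rfl hXD,
            htX.mono subset_rfl hXD⟩
      have := o₁.exists_noncrossingOn_union o₂ (by simp) (by simp) ⟨hs, hsD⟩ ⟨ht, htD⟩ (by
          rintro v (hv | hv) hv'
          exacts [(hv'.2 hv).elim, hv]) (by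
          rintro p (hp | hp) w hw hw' hpw
          · exact (hw.2 (mem_comp_of_adj hp (Set.mem_sdiff_of_mem hw.1 fun h => hw' (.inr h)) hpw)).elim
          · exact hp)
      convert this using 3
      ext v
      constructor
      · intro hv
        by_cases hv' : v ∈ D
        exacts [.inl (.inl hv'), .inr ⟨hv, hv'⟩]
      · rintro (hv | hv)
        exacts [hA₁ hv, hv.1]
    -- Here `X` can be enlarged inside `D \ Y` until it touches `Y`. With the edge `st` this gives a
    -- `K₄`-minor.
    · obtain ⟨z, hzY, hzD⟩ := Set.not_disjoint_iff.1 hYD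
      have hxY : x ∉ Y := Set.disjoint_left.1 hXY hx
      set X' := comp G (D \ Y) x with hX'
      have hX'D : X' ⊆ D \ Y := comp_subset ⟨hxD, hxY⟩
      have hXX' : X ⊆ X' := hX.subset_comp
        (Set.subset_sdiff.2 ⟨hXD, hXY⟩) hx (mem_comp_self x)
      have touch : Touch G X' Y := by
        obtain ⟨a, -, b, hb, hab, ha', hb'⟩ := (isConn_comp (G := G) (A := A \ {s, t}) x).2 X'
          ⟨x, hxD, mem_comp_self x⟩ ⟨z, hzD, fun h => (hX'D h).2 hzY⟩
        refine ⟨a, ha', b, ?_, hab⟩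
        by_contra hbY
        exact hb' (mem_comp_of_adj ha' ⟨hb, hbY⟩ hab)
      have hX'A : X' ⊆ A \ {s, t} := (hX'D.trans Set.sdiff_subset).trans hDA
      exact (h4 (isMinor_four (isConn_singleton s) (isConn_singleton t) (isConn_comp x) hY
        (Set.disjoint_singleton.2 hst.ne) (hdis hX'A).1 (hdis hYA).1 (hdis hX'A).2 (hdis hYA).2
        (Set.disjoint_left.2 fun v hv => (hX'D hv).2) ⟨s, rfl, t, rfl, hst⟩
        (hsX.mono subset_rfl hXX') hsY (htX.mono subset_rfl hXX') htY touch)).elim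
  · rintro s hs t ht hst hlink
    obtain h | ⟨X, Y, hX, hY, hXA, hYA, hXY, hsX, htX, hsY, htY⟩ :=
      hasOrderFromTo_or_exists_two hs ht hst (.inr hlink) hmain htwo
    · exact h
    -- The two inner connections and the outer one form a `K_{2,3}`-minor with `s` and `t` on the
    -- small side.
    obtain ⟨Z, hZ, hZA, hsZ, htZ⟩ := hlink
    exact (h23 (isMinor_twoThree (isConn_singleton s) (isConn_singleton t) hX hY hZ
      (Set.disjoint_singleton.2 hst) (hdis hXA).1 (hdis hYA).1
      (hZA.symm.mono_left (by simpa using hs)) (hdis hXA).2 (hdis hYA).2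
      (hZA.symm.mono_left (by simpa using ht)) hXY
      (hZA.symm.mono_left (hXA.trans Set.sdiff_subset))
      (hZA.symm.mono_left (hYA.trans Set.sdiff_subset)) hsX hsY hsZ htX htY htZ)).elim

end Excluded

end MarkovSlim

theorem mainTheorem9 (K : Type v) [Field K] :
    IsGreatest
      {𝒞 : Set MarkovSlim.FinGraph.{u} |
        MarkovSlim.MinorClosed 𝒞 ∧ ∀ G ∈ 𝒞, MarkovSlim.IsMarkovSlim K G.graph}
      {G : MarkovSlim.FinGraph.{u} | MarkovSlim.IsOuterplanar G.graph} := by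
  refine ⟨⟨fun G H hHG hG => ?_, fun G hG => ?_⟩, ?_⟩
  · have := G.finite_V
    have := H.finite_V
    exact MarkovSlim.IsOuterplanar.of_isMinor hG hHG
  · have := G.finite_V
    obtain ⟨f, hf⟩ := MarkovSlim.isOuterplanar_iff.1 hG
    exact MarkovSlim.isMarkovSlim_of_noncrossing K G.graph f hf
  · rintro 𝒞 ⟨hminor, hslim⟩ G hG
    have := G.finite_V
    obtain ⟨f, hf⟩ := (MarkovSlim.exists_noncrossingOn_of_excluded (G := G.graph)
      (fun h => MarkovSlim.not_isMarkovSlim_four K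
        (hslim _ (hminor G ⟨_, inferInstance, _⟩ h hG)))
      (fun h => MarkovSlim.not_isMarkovSlim_twoThree K
        (hslim _ (hminor G ⟨_, inferInstance, _⟩ h hG))) Set.univ).1
    exact MarkovSlim.isOuterplanar_iff.2 ⟨f, hf⟩
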